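/- Let $\Delta>1$ and let $q\in(0,1)$ be defined by $\Delta=(q+q^{-1})/2$. For $L\ge 1$ let $\mathcal H_L=(\mathbb C^2)^{\otimes L}$ with spin-$\frac12$ matrices $S_x^1,S_x^2,S_x^3$ acting on the $x$-th factor (eigenvalues $\pm\frac12$; $S^3|\uparrow\rangle=\frac12|\uparrow\rangle$, $S^-|\uparrow\rangle=|\downarrow\rangle$). Put $A(\Delta)=\frac12\sqrt{1-\Delta^{-2}}$ and $$H^{++}_{[1,L]}=\sum_{x=1}^{L-1}\Big(-\Delta^{-1}\big(\vec S_x\cdot\vec S_{x+1}-\tfrac14\big)-(1-\Delta^{-1})\big(S_x^3S_{x+1}^3-\tfrac14\big)\Big)-A(\Delta)\,(S_1^3+S_L^3).$$ For $0\le n\le L$ let $\mathcal H_{L,n}\subset\mathcal H_L$ be the span of the product basis vectors with exactly $n$ down spins. On an interval $[a,b]$ of sites define the kink and antikink states $$\psi^{+-}_{[a,b]}(n)=\sum_{a\le x_1<\dots<x_n\le b}q^{\sum_{k}(b+1-x_k)}\Big(\prod_{k}S^-_{x_k}\Big)|\uparrow\cdots\uparrow\rangle,\qquad \psi^{-+}_{[a,b]}(n)=\sum_{a\le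 x_1<\dots<x_n\le b}q^{\sum_{k}(x_k+1-a)}\Big(\prod_{k}S^-_{x_k}\Big)|\uparrow\cdots\uparrow\rangle$$ (on an empty interval the state with $0$ down spins is the scalar $1$), and let $$\mathcal K_{L,n}=\operatorname{span}\big\{\psi^{+-}_{[1,x]}(\lfloor n/2\rfloor)\otimes\psi^{-+}_{[x+1,L]}(\lceil n/2\rceil):\ \lfloor n/2\rfloor\le x\le L-\lceil n/2\rceil\big\}\subset\mathcal H_{L,n}.$$ Write $\operatorname{Proj}(V)$ for the orthogonal projection of $\mathcal H_L$ onto $V$, and $\gamma=1-\Delta^{-1}$. Then there is a constant $C<\infty$, depending only on $q$, such that: (a) for all $L\ge1$ and $0\le n\le L$, $$\big\|(H^{++}_{[1,L]}-A(\Delta))\operatorname{Proj}(\mathcal K_{L,n})\big\|\le C\,q^{n/2};$$ (b) there is a sequence $(\epsilon_n)$, depending only on $q$ (not on $L$), with $\epsilon_n\to0$ and $\epsilon_n=O(n^{-1/4})$ as $n\to\infty$, such that for all $L\ge1$ and $0\le n\le L$, as an inequality between self-adjoint operators on $\mathcal H_L$, $$H^{++}_{[1,L]}\operatorname{Proj}(\mathcal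 H_{L,n})\ \ge\ (A(\Delta)-2C\,q^{n/2})\operatorname{Proj}(\mathcal H_{L,n})+(\gamma-\epsilon_n)\big(\operatorname{Proj}(\mathcal H_{L,n})-\operatorname{Proj}(\mathcal K_{L,n})\big).$$ -/

import Mathlib

noncomputable section

namespace XXZ

/-- The state space `ℂ² ⊗ ⋯ ⊗ ℂ²` (`L` factors) with its standard inner product, written in the
product basis: `σ i = 0` means "up at site `i`", `σ i = 1` means "down at site `i`". The site called
`x ∈ {1, …, L}` in the usual labelling is the element `x - 1` of `Fin L`. -/
abbrev State (L : ℕ) : Type := EuclideanSpace ℂ (Fin L → Fin 2)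

/-- The algebra of operators on `State L`, as matrices in the product basis. -/
abbrev Op (L : ℕ) : Type := Matrix (Fin L → Fin 2) (Fin L → Fin 2) ℂ

/-- The spin-1/2 matrix `S¹`. -/
def spin1 : Matrix (Fin 2) (Fin 2) ℂ := !![0, 1 / 2; 1 / 2, 0]

/-- The spin-1/2 matrix `S²`. -/
def spin2 : Matrix (Fin 2) (Fin 2) ℂ := !![0, -Complex.I / 2; Complex.I / 2, 0]

/-- The spin-1/2 matrix `S³`. -/
def spin3 : Matrix (Fin 2) (Fin 2) ℂ := !![1 / 2, 0; 0, -1 / 2]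

/-- The one-site matrix `M` acting at site `x`, extended by the identity on all other sites. -/
def siteOp {L : ℕ} (x : Fin L) (M : Matrix (Fin 2) (Fin 2) ℂ) : Op L :=
  Matrix.of fun σ τ => if ∀ y, y ≠ x → σ y = τ y then M (σ x) (τ x) else 0

/-- The pair interaction
`- Δ⁻¹ (S_x · S_y - 1/4) - (1 - Δ⁻¹) (S³_x S³_y - 1/4)`. -/
def pairOp (Δ : ℝ) {L : ℕ} (x y : Fin L) : Op L :=
  -((Δ⁻¹ : ℝ) : ℂ) • (siteOp x spin1 * siteOp y spin1 + siteOp x spin2 * siteOp y spin2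
      + siteOp x spin3 * siteOp y spin3 - (1 / 4 : ℂ) • (1 : Op L))
    - ((1 - Δ⁻¹ : ℝ) : ℂ) • (siteOp x spin3 * siteOp y spin3 - (1 / 4 : ℂ) • (1 : Op L))

/-- `A(Δ) = (1/2) √(1 - Δ⁻²)`. -/
def fieldA (Δ : ℝ) : ℝ := 1 / 2 * Real.sqrt (1 - (Δ ^ 2)⁻¹)

/-- `H^{αβ}_{[1,L]} = ∑_{x=1}^{L-1} H^{XXZ}_{x,x+1} - A(Δ) (α S³_1 + β S³_L)`, as a matrix. -/
def hamMatrix (Δ α β : ℝ) (L : ℕ) (hL : 0 < L) : Op L :=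
  (∑ i : Fin (L - 1), pairOp Δ (⟨i, by omega⟩ : Fin L) (⟨i + 1, by omega⟩ : Fin L))
    - (fieldA Δ : ℂ) • ((α : ℂ) • siteOp (⟨0, hL⟩ : Fin L) spin3
      + (β : ℂ) • siteOp (⟨L - 1, by omega⟩ : Fin L) spin3)

/-- `H^{αβ}_{[1,L]}` as an operator on the Hilbert space. -/
def ham (Δ α β : ℝ) (L : ℕ) (hL : 0 < L) : State L →L[ℂ] State L :=
  Matrix.toEuclideanCLM (𝕜 := ℂ) (hamMatrix Δ α β L hL)

/-- The basis vector `(∏_{x ∈ X} S⁻_x) |↑ ⋯ ↑⟩`: spins down exactly on `X`. -/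
def downState {L : ℕ} (X : Finset (Fin L)) : State L :=
  EuclideanSpace.single (fun i => if i ∈ X then 1 else 0) 1

/-- `𝓗_{L,n}`: the states with exactly `n` down spins. -/
def sector (L n : ℕ) : Submodule ℂ (State L) :=
  Submodule.span ℂ {v | ∃ X : Finset (Fin L), X.card = n ∧ v = downState X}

/-- The kink state `ψ^{+-}(n)` on a chain of length `L`. The site `i : Fin L` is `x = i + 1`, so the
exponent `L + 1 - x` is `L - i`. -/
def kink (q : ℝ) (L n : ℕ) : State L :=
  ∑ X ∈ (Finset.univ : Finset (Fin L)).powersetCard n,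
    ((q ^ (∑ i ∈ X, (L - (i : ℕ))) : ℝ) : ℂ) • downState X

/-- The antikink state `ψ^{-+}(n)` on a chain of length `L`. The site `i : Fin L` is `x = i + 1`. -/
def antikink (q : ℝ) (L n : ℕ) : State L :=
  ∑ X ∈ (Finset.univ : Finset (Fin L)).powersetCard n,
    ((q ^ (∑ i ∈ X, ((i : ℕ) + 1)) : ℝ) : ℂ) • downState X

/-- The tensor product `φ ⊗ χ` of a state on the first `x` sites and a state on the remaining
`L - x` sites. -/
def tensor {L x : ℕ} (hx : x ≤ L) (φ : State x) (χ : State (L - x)) : State L :=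
  WithLp.toLp 2 fun σ =>
    φ (fun i : Fin x => σ ⟨i, by omega⟩) * χ (fun j : Fin (L - x) => σ ⟨x + j, by omega⟩)

/-- The droplet state `ξ_{L,n}(x) = ψ^{+-}_{[1,x]}(⌊n/2⌋) ⊗ ψ^{-+}_{[x+1,L]}(⌈n/2⌉)`; in `ℕ`,
`n / 2 = ⌊n/2⌋` and `(n + 1) / 2 = ⌈n/2⌉`. -/
def droplet (q : ℝ) (L n x : ℕ) (hx : x ≤ L) : State L :=
  tensor hx (kink q x (n / 2)) (antikink q (L - x) ((n + 1) / 2))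

/-- `𝓚_{L,n}`: the span of the `ξ_{L,n}(x)` with `⌊n/2⌋ ≤ x ≤ L - ⌈n/2⌉`. -/
def dropletSpace (q : ℝ) (L n : ℕ) : Submodule ℂ (State L) :=
  Submodule.span ℂ {v | ∃ (x : ℕ) (hx : x ≤ L),
    n / 2 ≤ x ∧ x + (n + 1) / 2 ≤ L ∧ v = droplet q L n x hx}

end XXZ

end

/-!
Write `c = 1 / (2 Δ)`, `γ = 1 - 2 c = 1 - Δ⁻¹` and `A = A(Δ)`. The Hamiltonian has real matrix
elements in the product basis, so that everything is proved for real functions of spin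
configurations.

**Cutting.** For a cut between the sites `x` and `x + 1`, the operator `H^{++} - A` is the sum of
the kink Hamiltonian to the left of the cut, the antikink Hamiltonian to the right of it, and a term
on the two sites next to the cut that vanishes where both are down (`hamR_eq`, `cutBond_of_down`).
The first two form the cut Hamiltonian `T_x`, a sum of bond projections. Distant bonds commute, and
neighbouring ones satisfy the Temperley–Lieb relation, so that `T_x² ≥ γ T_x`, and `T_x` has the
gap `γ` above its kernel (`cutOp_gap`). The kernel is spanned by the kink–antikink states, one for
each choice of the numbers of down spins on the two sides (`kernel_proportional`).

**Holes are expensive.** Deleting an up spin from a configuration moves all spins behind it towards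
the cut. Hence the configurations with an up spin that has at least `r` down spins behind it carry
at most a part `q ^ (2 r)` of the norm of a kernel element (`kernel_mass_right`,
`kernel_mass_left`). In particular a droplet state is concentrated on configurations that determine
the cut: the number `mult` of cuts with `⌊n/2⌋` down spins on their left is `1` up to an error
`O(q ^ n)` (`xi_mult`).

**Droplets have energy almost `A`.** Droplet states with different cuts are almost orthogonal, as
they live on different configurations, and `H^{++} - A` acts on each of them only where a site next
to the cut is up. This gives `‖(H^{++} - A) f‖² ≤ C q ^ n ‖f‖²` on their span (`droplet_energy`).
For small `n` a crude bound on the Hamiltonian suffices (`hamR_sector_bound`).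

**The gap.** Let `f` have `n` down spins and be orthogonal to the droplet states. A partition of
unity `chi` on configurations is chosen, with one function for each cut `x`, supported where the
`R` sites on either side of it are down, and one function for the configurations without a long
interval of down spins, where `R` is a small multiple of `n`. It varies on the scale `R` and only
`O(n)` of its functions are nonzero at a configuration, so that cutting `f` into pieces costs an
energy `O(n / R²) = O(1 / n)` (`ims_localisation`).

The piece without long intervals has many domain walls, each of which costs an energy at least
`γ / 2`, and so has energy at least `A + γ` (`energy_none`). The energy of the piece at the cut `x`
is `A` plus its energy for `T_x`, which is at least `γ` on the orthogonal complement of the kernel.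
So the component of the piece in the kernel has to be small (`kernel_overlap`):

* If the cut does not divide the down spins at `⌊n/2⌋`, the piece is supported on configurations
  without a long interval of down spins in the middle. Such a configuration has an up spin with
  at least `R` down spins behind it, and the kernel has little mass there (`overlap_off`).
* If the cut does divide the down spins at `⌊n/2⌋`, then `f` is orthogonal to the kernel element,
  which is a droplet state, and a constant can be subtracted from the cutoff function. A Poincaré
  inequality for the droplet state, which again follows from the gap of `T_x`, shows that the cutoff
  function is almost constant in it (`xi_poincare`, `overlap_on`).

Altogether the gap is at least `γ - B / n` (`energy_lower`, `exists_gapErr_le`). The cross terms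
between the droplet space and its complement are bounded by the estimate for the droplets
(`le_re_inner_add`); for the finitely many `n` where the above does not apply, `H^{++} ≥ -A`
suffices once the constants are large.
-/

noncomputable section

namespace XXZ

open Finset

/-! ### Configurations and nearest-neighbour exchanges -/

/-- Spin configurations: the labels of the product basis, with value `1` for a down spin. -/
abbrev Cfg (L : ℕ) : Type := Fin L → Fin 2

/-- The left site of the `i`-th bond. -/
def lo {L : ℕ} (i : Fin (L - 1)) : Fin L := ⟨i, by omega⟩

/-- The right site of the `i`-th bond. -/
def hi {L : ℕ} (i : Fin (L - 1)) : Fin L := ⟨i + 1, by omega⟩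

/-- The configuration with the spins on the `i`-th bond exchanged. -/
def hop {L : ℕ} (i : Fin (L - 1)) (σ : Cfg L) : Cfg L := σ ∘ Equiv.swap (lo i) (hi i)

@[simp] lemma lo_val {L : ℕ} (i : Fin (L - 1)) : ((lo i : Fin L) : ℕ) = i := rfl

@[simp] lemma hi_val {L : ℕ} (i : Fin (L - 1)) : ((hi i : Fin L) : ℕ) = i + 1 := rfl

lemma lo_ne_hi {L : ℕ} (i : Fin (L - 1)) : (lo i : Fin L) ≠ hi i := by
  intro h; have := congrArg Fin.val h; simp at this

@[simp] lemma hop_lo {L : ℕ} (i : Fin (L - 1)) (σ : Cfg L) : hop i σ (lo i) = σ (hi i) := by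
  simp [hop]

@[simp] lemma hop_hi {L : ℕ} (i : Fin (L - 1)) (σ : Cfg L) : hop i σ (hi i) = σ (lo i) := by
  simp [hop]

lemma hop_of_ne {L : ℕ} (i : Fin (L - 1)) (σ : Cfg L) (j : Fin L) (h1 : j ≠ lo i)
    (h2 : j ≠ hi i) : hop i σ j = σ j := by
  simp [hop, Equiv.swap_apply_of_ne_of_ne h1 h2]

@[simp] lemma hop_hop {L : ℕ} (i : Fin (L - 1)) (σ : Cfg L) : hop i (hop i σ) = σ := by
  funext j; simp [hop]

lemma hop_eq_self {L : ℕ} {i : Fin (L - 1)} {σ : Cfg L} (h : σ (lo i) = σ (hi i)) :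
    hop i σ = σ := by
  funext j
  by_cases h1 : j = lo i
  · subst h1; simp [h]
  by_cases h2 : j = hi i
  · subst h2; simp [h]
  exact hop_of_ne i σ j h1 h2

/-- Exchanging a bond is an involution of the configurations. -/
def hopEquiv {L : ℕ} (i : Fin (L - 1)) : Cfg L ≃ Cfg L :=
  ⟨hop i, hop i, hop_hop i, hop_hop i⟩

lemma sum_hop {L : ℕ} (i : Fin (L - 1)) (F : Cfg L → ℝ) : ∑ σ, F (hop i σ) = ∑ σ, F σ :=
  Equiv.sum_comp (hopEquiv i) F

lemma hop_comm {L : ℕ} {i j : Fin (L - 1)} (h : (i : ℕ) + 2 ≤ j) (σ : Cfg L) :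
    hop i (hop j σ) = hop j (hop i σ) := by
  have h1 : (lo i : Fin L) ≠ lo j := by intro h; have := congrArg Fin.val h; simp at this; omega
  have h2 : (lo i : Fin L) ≠ hi j := by intro h; have := congrArg Fin.val h; simp at this; omega
  have h3 : (hi i : Fin L) ≠ lo j := by intro h; have := congrArg Fin.val h; simp at this; omega
  have h4 : (hi i : Fin L) ≠ hi j := by intro h; have := congrArg Fin.val h; simp at this; omega
  funext k
  by_cases k1 : k = lo i
  · subst k1; rw [hop_lo, hop_of_ne j _ _ h3 h4, hop_of_ne j _ _ h1 h2, hop_lo]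
  by_cases k2 : k = hi i
  · subst k2; rw [hop_hi, hop_of_ne j _ _ h1 h2, hop_of_ne j _ _ h3 h4, hop_hi]
  rw [hop_of_ne i _ _ k1 k2]
  by_cases k3 : k = lo j
  · subst k3; rw [hop_lo, hop_lo, hop_of_ne i _ _ h2.symm h4.symm]
  by_cases k4 : k = hi j
  · subst k4; rw [hop_hi, hop_hi, hop_of_ne i _ _ h1.symm h3.symm]
  rw [hop_of_ne j _ _ k3 k4, hop_of_ne j _ _ k3 k4, hop_of_ne i _ _ k1 k2]

/-- The number of down spins among the first `x` sites. -/
def cnt {L : ℕ} (x : ℕ) (σ : Cfg L) : ℕ :=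
  ∑ j : Fin L, if (j : ℕ) < x ∧ σ j = 1 then 1 else 0

/-- The distance of site `j` from the cut between the sites `x - 1` and `x`; the two sites next to
the cut have distance `1`. -/
def depth (x j : ℕ) : ℕ := if j < x then x - j else j - x + 1

/-- The exponent of `q` in the amplitude of a kink–antikink state with cut at `x`. -/
def wt {L : ℕ} (x : ℕ) (σ : Cfg L) : ℕ := ∑ j : Fin L, if σ j = 1 then depth x j else 0

lemma cnt_hop {L : ℕ} (x : ℕ) (i : Fin (L - 1)) (h : (i : ℕ) + 1 ≠ x) (σ : Cfg L) :
    cnt x (hop i σ) = cnt x σ := by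
  unfold cnt
  rw [← Equiv.sum_comp (Equiv.swap (lo i) (hi i))]
  refine Finset.sum_congr rfl fun j _ => ?_
  have e : hop i σ (Equiv.swap (lo i) (hi i) j) = σ j := by simp [hop]
  rw [e]
  have : ((Equiv.swap (lo i) (hi i) j : Fin L) : ℕ) < x ↔ (j : ℕ) < x := by
    by_cases h1 : j = lo i
    · subst h1; simp; omega
    by_cases h2 : j = hi i
    · subst h2; simp; omega
    rw [Equiv.swap_apply_of_ne_of_ne h1 h2]
  simp only [this]

lemma cnt_hop_total {L : ℕ} (i : Fin (L - 1)) (σ : Cfg L) : cnt L (hop i σ) = cnt L σ :=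
  cnt_hop L i (by omega) σ

/-! ### Bond operators of the kink and antikink Hamiltonians -/

/-- The off-diagonal coupling `1 / (2 Δ)`, in terms of `q`. -/
def cpl (q : ℝ) : ℝ := (q + q⁻¹)⁻¹

/-- The ratio of the amplitudes of `hop i σ` and `σ` in the kink state (`b = true`) or the antikink
state (`b = false`), when the spins on the bond differ. -/
def rate {L : ℕ} (q : ℝ) (b : Bool) (i : Fin (L - 1)) (σ : Cfg L) : ℝ :=
  if decide (σ (lo i) = 1) = b then q⁻¹ else q

/-- The bond operator of the kink Hamiltonian (`b = true`) or antikink Hamiltonian (`b = false`),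
acting on real amplitudes. It is the orthogonal projection whose kernel on the span of the two
configurations `σ`, `hop i σ` is the ground state of the bond. -/
def bondOp {L : ℕ} (q : ℝ) (b : Bool) (i : Fin (L - 1)) (f : Cfg L → ℝ) (σ : Cfg L) : ℝ :=
  if σ (lo i) ≠ σ (hi i) then cpl q * (rate q b i σ * f σ - f (hop i σ)) else 0

lemma rate_pos {L : ℕ} {q : ℝ} (hq : 0 < q) (b : Bool) (i : Fin (L - 1)) (σ : Cfg L) :
    0 < rate q b i σ := by
  unfold rate; split_ifs <;> positivity

lemma cpl_pos {q : ℝ} (hq : 0 < q) : 0 < cpl q := by unfold cpl; positivity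

lemma fin2_eq_of_ne {a b c : Fin 2} (h1 : a ≠ b) (h2 : a ≠ c) : b = c := by
  revert a b c; decide

lemma fin2_one_iff {a b : Fin 2} (h : a ≠ b) : (b = 1) ↔ ¬ (a = 1) := by
  revert a b; decide

lemma rate_hop {L : ℕ} {q : ℝ} (b : Bool) (i : Fin (L - 1)) (σ : Cfg L)
    (h : σ (lo i) ≠ σ (hi i)) : rate q b i (hop i σ) = (rate q b i σ)⁻¹ := by
  unfold rate
  rw [hop_lo]
  have := fin2_one_iff h
  by_cases h1 : σ (lo i) = 1 <;> by_cases h2 : σ (hi i) = 1 <;> cases b <;> simp_all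

lemma rate_add_inv {L : ℕ} {q : ℝ} (b : Bool) (i : Fin (L - 1)) (σ : Cfg L) :
    rate q b i σ + (rate q b i σ)⁻¹ = q + q⁻¹ := by
  unfold rate; split_ifs
  · rw [inv_inv]; ring
  · rfl

lemma bondOp_hop {L : ℕ} {q : ℝ} (hq : 0 < q) (b : Bool) (i : Fin (L - 1)) (f : Cfg L → ℝ)
    (σ : Cfg L) :
    rate q b i σ * bondOp q b i f (hop i σ) = - bondOp q b i f σ := by
  unfold bondOp
  by_cases h : σ (lo i) = σ (hi i)
  · simp [h]
  · have h' : σ (hi i) ≠ σ (lo i) := fun e => h e.symm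
    simp only [hop_lo, hop_hi, ne_eq, h, h', not_false_eq_true, if_true, hop_hop, rate_hop b i σ h]
    have := (rate_pos hq b i σ).ne'
    field_simp
    ring

lemma bondOp_idem {L : ℕ} {q : ℝ} (hq : 0 < q) (b : Bool) (i : Fin (L - 1)) (f : Cfg L → ℝ) :
    bondOp q b i (bondOp q b i f) = bondOp q b i f := by
  funext σ
  by_cases h : σ (lo i) = σ (hi i)
  · simp [bondOp, h]
  have e := bondOp_hop hq b i f σ
  have hr := (rate_pos hq b i σ).ne'
  have e2 : bondOp q b i f (hop i σ) = - ((rate q b i σ)⁻¹ * bondOp q b i f σ) := by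
    field_simp; linarith
  have : bondOp q b i (bondOp q b i f) σ
      = cpl q * (rate q b i σ * bondOp q b i f σ - bondOp q b i f (hop i σ)) := by
    generalize bondOp q b i f = a
    unfold bondOp
    rw [if_pos h]
  rw [this, e2]
  have s := rate_add_inv (q := q) b i σ
  have : cpl q * (q + q⁻¹) = 1 := by unfold cpl; exact inv_mul_cancel₀ (by positivity)
  calc _ = cpl q * (rate q b i σ + (rate q b i σ)⁻¹) * bondOp q b i f σ := by ring
    _ = _ := by rw [s, this, one_mul]

lemma bondOp_symm {L : ℕ} (q : ℝ) (b : Bool) (i : Fin (L - 1)) (f h : Cfg L → ℝ) :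
    ∑ σ, f σ * bondOp q b i h σ = ∑ σ, bondOp q b i f σ * h σ := by
  have key : ∑ σ : Cfg L, (if σ (lo i) ≠ σ (hi i) then cpl q * (f σ * h (hop i σ)) else 0)
      = ∑ σ : Cfg L, (if σ (lo i) ≠ σ (hi i) then cpl q * (f (hop i σ) * h σ) else 0) := by
    rw [← sum_hop i]
    refine Finset.sum_congr rfl fun σ _ => ?_
    simp only [hop_lo, hop_hi, hop_hop, ne_comm]
  have e1 : ∀ σ, f σ * bondOp q b i h σ
      = (if σ (lo i) ≠ σ (hi i) then cpl q * rate q b i σ * (f σ * h σ) else 0)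
        - (if σ (lo i) ≠ σ (hi i) then cpl q * (f σ * h (hop i σ)) else 0) := by
    intro σ; unfold bondOp; split_ifs <;> ring
  have e2 : ∀ σ, bondOp q b i f σ * h σ
      = (if σ (lo i) ≠ σ (hi i) then cpl q * rate q b i σ * (f σ * h σ) else 0)
        - (if σ (lo i) ≠ σ (hi i) then cpl q * (f (hop i σ) * h σ) else 0) := by
    intro σ; unfold bondOp; split_ifs <;> ring
  simp only [e1, e2, Finset.sum_sub_distrib, key]

lemma bondOp_norm {L : ℕ} {q : ℝ} (hq : 0 < q) (b : Bool) (i : Fin (L - 1)) (f : Cfg L → ℝ) :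
    ∑ σ, f σ * bondOp q b i f σ = ∑ σ, bondOp q b i f σ ^ 2 := by
  conv_lhs => rw [← bondOp_idem hq b i f]
  rw [bondOp_symm]
  exact Finset.sum_congr rfl fun σ _ => by ring

lemma bondOp_comm {L : ℕ} {q : ℝ} (b b' : Bool) {i j : Fin (L - 1)} (hij : (i : ℕ) + 2 ≤ j)
    (f : Cfg L → ℝ) :
    bondOp q b i (bondOp q b' j f) = bondOp q b' j (bondOp q b i f) := by
  have h1 : (lo i : Fin L) ≠ lo j := by intro h; have := congrArg Fin.val h; simp at this; omega
  have h2 : (lo i : Fin L) ≠ hi j := by intro h; have := congrArg Fin.val h; simp at this; omega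
  have h3 : (hi i : Fin L) ≠ lo j := by intro h; have := congrArg Fin.val h; simp at this; omega
  have h4 : (hi i : Fin L) ≠ hi j := by intro h; have := congrArg Fin.val h; simp at this; omega
  funext σ
  have r1 : rate q b i (hop j σ) = rate q b i σ := by
    unfold rate; rw [hop_of_ne j σ _ h1 h2]
  have r2 : rate q b' j (hop i σ) = rate q b' j σ := by
    unfold rate; rw [hop_of_ne i σ _ h1.symm h3.symm]
  unfold bondOp
  simp only [r1, r2, hop_of_ne j σ _ h1 h2, hop_of_ne j σ _ h3 h4, hop_of_ne i σ _ h1.symm h3.symm,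
    hop_of_ne i σ _ h2.symm h4.symm, hop_comm hij]
  split_ifs <;> ring

/-- The Temperley–Lieb relation for neighbouring bonds. -/
lemma bondOp_temperleyLieb {L : ℕ} {q : ℝ} (hq : 0 < q) (b : Bool) {i j : Fin (L - 1)}
    (hij : (j : ℕ) = i + 1) (f : Cfg L → ℝ) (σ : Cfg L) :
    bondOp q b i (bondOp q b j (bondOp q b i f)) σ = cpl q ^ 2 * bondOp q b i f σ := by
  have ej : (lo j : Fin L) = hi i := by apply Fin.ext; simp [hij]
  have h1 : (hi j : Fin L) ≠ lo i := by intro h; have := congrArg Fin.val h; simp at this; omega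
  have h2 : (hi j : Fin L) ≠ hi i := by intro h; have := congrArg Fin.val h; simp at this; omega
  by_cases h : σ (lo i) = σ (hi i)
  · simp [bondOp, h]
  have hr := (rate_pos hq b i σ).ne'
  have e := bondOp_hop hq b i f σ
  set a := bondOp q b i f with ha
  have e0 : ∀ τ : Cfg L, τ (lo i) = τ (hi i) → a τ = 0 := by
    intro τ hτ; simp [ha, bondOp, hτ]
  have outer : bondOp q b i (bondOp q b j a) σ
      = cpl q * (rate q b i σ * bondOp q b j a σ - bondOp q b j a (hop i σ)) := by
    conv_lhs => unfold bondOp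
    rw [if_pos h]
    rfl
  rw [outer]
  have loi : ∀ τ : Cfg L, hop j τ (lo i) = τ (lo i) := fun τ =>
    hop_of_ne j τ _ (by rw [ej]; exact lo_ne_hi i) h1.symm
  have hij' : ∀ τ : Cfg L, hop j τ (hi i) = τ (hi j) := fun τ => by rw [← ej, hop_lo]
  -- For three neighbouring spins, exactly one of the two configurations `σ`, `hop i σ` has a wall
  -- at `j`, and exchanging that wall leads to equal spins on the bond `i`, where `a` vanishes.
  by_cases hz : σ (hi i) = σ (hi j)
  · have p1 : bondOp q b j a σ = 0 := by simp [bondOp, ej, hz]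
    have p2 : a (hop j (hop i σ)) = 0 := by
      apply e0
      rw [loi, hij', hop_lo, hop_of_ne i σ _ h1 h2, hz]
    have p3 : bondOp q b j a (hop i σ) = cpl q * (rate q b j (hop i σ) * a (hop i σ)) := by
      unfold bondOp
      rw [if_pos, p2, sub_zero]
      rw [ej, hop_hi, hop_of_ne i σ _ h1 h2, ← hz]; exact h
    have p4 : rate q b j (hop i σ) = rate q b i σ := by unfold rate; rw [ej, hop_hi]
    rw [p1, p3, p4, e]; ring
  · have hz' : σ (lo i) = σ (hi j) := fin2_eq_of_ne (fun e => h e.symm) hz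
    have p1 : bondOp q b j a (hop i σ) = 0 := by
      unfold bondOp
      rw [if_neg]
      rw [ej, hop_hi, hop_of_ne i σ _ h1 h2, hz']; simp
    have p2 : a (hop j σ) = 0 := by
      apply e0; rw [loi, hij', hz']
    have p3 : bondOp q b j a σ = cpl q * (rate q b j σ * a σ) := by
      conv_lhs => unfold bondOp
      rw [if_pos (by rw [ej]; exact hz), p2, sub_zero]
    have p4 : rate q b j σ = (rate q b i σ)⁻¹ := by
      rw [← rate_hop b i σ h]; unfold rate; rw [ej, hop_lo]
    rw [p1, p3, p4]; field_simp; ring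

/-- Distant bonds commute, so the product of their projections is nonnegative. -/
lemma sum_bondOp_mul_nonneg {L : ℕ} {q : ℝ} (hq : 0 < q) (b b' : Bool) {i j : Fin (L - 1)}
    (hij : (i : ℕ) + 2 ≤ j) (f : Cfg L → ℝ) :
    0 ≤ ∑ σ, bondOp q b i f σ * bondOp q b' j f σ := by
  calc 0 ≤ ∑ σ, bondOp q b' j (bondOp q b i f) σ ^ 2 := by positivity
    _ = ∑ σ, bondOp q b i f σ * bondOp q b' j (bondOp q b i f) σ := (bondOp_norm hq _ _ _).symm
    _ = ∑ σ, bondOp q b i f σ * bondOp q b i (bondOp q b' j f) σ := by rw [bondOp_comm b b' hij]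
    _ = _ := by rw [bondOp_symm, bondOp_idem hq]

/-- Neighbouring projections `t`, `t'` satisfy `t t' + t' t ≥ -c (t + t')` for the coupling
`c = 1 / (2 Δ)`, as the Temperley–Lieb relation bounds the cosine of their angle by `c`. -/
lemma sum_bondOp_mul_neighbour {L : ℕ} {q : ℝ} (hq : 0 < q) (b : Bool) {i j : Fin (L - 1)}
    (hij : (j : ℕ) = i + 1) (f : Cfg L → ℝ) :
    -(cpl q / 2) * (∑ σ, bondOp q b i f σ ^ 2 + ∑ σ, bondOp q b j f σ ^ 2)
      ≤ ∑ σ, bondOp q b i f σ * bondOp q b j f σ := by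
  have hc := cpl_pos hq
  have e1 : ∑ σ, bondOp q b i f σ * bondOp q b j f σ
      = ∑ σ, bondOp q b j (bondOp q b i f) σ * bondOp q b j f σ := by
    rw [← bondOp_symm q b j (bondOp q b i f), bondOp_idem hq]
  have e2 : ∑ σ, bondOp q b j (bondOp q b i f) σ ^ 2
      = cpl q ^ 2 * ∑ σ, bondOp q b i f σ ^ 2 := by
    rw [← bondOp_norm hq, Finset.mul_sum]
    calc _ = ∑ σ, bondOp q b i (bondOp q b i f) σ * bondOp q b j (bondOp q b i f) σ := by
          rw [bondOp_idem hq]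
      _ = ∑ σ, bondOp q b i f σ * bondOp q b i (bondOp q b j (bondOp q b i f)) σ := by
          rw [bondOp_symm q b i]
      _ = _ := by
          refine Finset.sum_congr rfl fun σ _ => ?_
          rw [bondOp_temperleyLieb hq b hij]; ring
  -- `|t' t f + c t' f|² ≥ 0`, where `|t' t f|² = c² |t f|²` by the Temperley–Lieb relation.
  have e3 : 0 ≤ ∑ σ, (bondOp q b j (bondOp q b i f) σ + cpl q * bondOp q b j f σ) ^ 2 := by
    positivity
  have e4 : ∑ σ, (bondOp q b j (bondOp q b i f) σ + cpl q * bondOp q b j f σ) ^ 2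
      = ∑ σ, bondOp q b j (bondOp q b i f) σ ^ 2
        + 2 * cpl q * ∑ σ, bondOp q b j (bondOp q b i f) σ * bondOp q b j f σ
        + cpl q ^ 2 * ∑ σ, bondOp q b j f σ ^ 2 := by
    rw [Finset.mul_sum, Finset.mul_sum, ← Finset.sum_add_distrib, ← Finset.sum_add_distrib]
    exact Finset.sum_congr rfl fun σ _ => by ring
  rw [e4, e2, ← e1] at e3
  have : 0 ≤ cpl q * (cpl q / 2 * (∑ σ, bondOp q b i f σ ^ 2 + ∑ σ, bondOp q b j f σ ^ 2)
      + ∑ σ, bondOp q b i f σ * bondOp q b j f σ) := by nlinarith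
  have := nonneg_of_mul_nonneg_right this hc
  linarith

/-- The sum of the kink Hamiltonian on the first `x` sites and the antikink Hamiltonian on the
remaining sites. -/
def cutOp {L : ℕ} (q : ℝ) (x : ℕ) (f : Cfg L → ℝ) (σ : Cfg L) : ℝ :=
  ∑ i : Fin (L - 1), if (i : ℕ) + 1 = x then 0 else bondOp q (decide ((i : ℕ) + 1 < x)) i f σ

/-- A sum of projections, of which distant ones commute and neighbouring ones have angle at most
`c`, has square at least `1 - 2 c` times itself. -/
lemma sum_gram_ge {M : ℕ} (G : Fin M → Fin M → ℝ) (c : ℝ) (hc : 0 ≤ c)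
    (hs : ∀ i j, G i j = G j i) (hd : ∀ i, 0 ≤ G i i)
    (hfar : ∀ i j : Fin M, (i : ℕ) + 2 ≤ j → 0 ≤ G i j)
    (hnb : ∀ i j : Fin M, (j : ℕ) = i + 1 → -(c / 2) * (G i i + G j j) ≤ G i j) :
    (1 - 2 * c) * ∑ i, G i i ≤ ∑ i, ∑ j, G i j := by
  have hp : ∀ i j : Fin M, (if i = j then G i i else 0)
      - (if (j : ℕ) = i + 1 then c / 2 * (G i i + G j j) else 0)
      - (if (i : ℕ) = j + 1 then c / 2 * (G i i + G j j) else 0) ≤ G i j := by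
    intro i j
    rcases lt_trichotomy (i : ℕ) j with h | h | h
    · rw [if_neg (by intro e; subst e; omega), if_neg (by omega : ¬ (i : ℕ) = j + 1)]
      split_ifs with h1
      · linarith [hnb i j h1]
      · linarith [hfar i j (by omega)]
    · have : i = j := Fin.ext h
      subst this
      simp
    · rw [if_neg (by intro e; subst e; omega), if_neg (by omega : ¬ (j : ℕ) = i + 1)]
      split_ifs with h1
      · linarith [hnb j i h1, hs i j]
      · linarith [hfar j i (by omega), hs i j]
  -- Each index has at most one right neighbour and at most one left neighbour.
  have s1 : ∀ F : Fin M → ℝ, (∀ i, 0 ≤ F i) → ∀ i : Fin M,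
      ∑ j : Fin M, (if (j : ℕ) = i + 1 then F i else 0) ≤ F i := by
    intro F hF i
    rw [← Finset.sum_filter, Finset.sum_const, nsmul_eq_mul]
    have : (Finset.univ.filter fun j : Fin M => (j : ℕ) = i + 1).card ≤ 1 := by
      rw [Finset.card_le_one]
      intro a ha b hb
      simp at ha hb; exact Fin.ext (by omega)
    have : ((Finset.univ.filter fun j : Fin M => (j : ℕ) = i + 1).card : ℝ) ≤ 1 := by
      exact_mod_cast this
    nlinarith [hF i]
  have s2 : ∀ F : Fin M → ℝ, (∀ i, 0 ≤ F i) → ∀ i : Fin M,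
      ∑ j : Fin M, (if (i : ℕ) = j + 1 then F i else 0) ≤ F i := by
    intro F hF i
    rw [← Finset.sum_filter, Finset.sum_const, nsmul_eq_mul]
    have : (Finset.univ.filter fun j : Fin M => (i : ℕ) = j + 1).card ≤ 1 := by
      rw [Finset.card_le_one]
      intro a ha b hb
      simp at ha hb; exact Fin.ext (by omega)
    have : ((Finset.univ.filter fun j : Fin M => (i : ℕ) = j + 1).card : ℝ) ≤ 1 := by
      exact_mod_cast this
    nlinarith [hF i]
  have t1 := Finset.sum_le_sum fun i (_ : i ∈ Finset.univ) => s1 (fun i => G i i) hd i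
  have t2 := Finset.sum_le_sum fun i (_ : i ∈ Finset.univ) => s2 (fun i => G i i) hd i
  have t1' : ∑ i : Fin M, ∑ j : Fin M, (if (j : ℕ) = i + 1 then G j j else 0) ≤ ∑ i, G i i := by
    rw [Finset.sum_comm]; exact t2
  have t2' : ∑ i : Fin M, ∑ j : Fin M, (if (i : ℕ) = j + 1 then G j j else 0) ≤ ∑ i, G i i := by
    rw [Finset.sum_comm]; exact t1
  have total := Finset.sum_le_sum fun i (_ : i ∈ Finset.univ) =>
    Finset.sum_le_sum fun j (_ : j ∈ Finset.univ) => hp i j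
  have split : ∀ i j : Fin M, (if i = j then G i i else 0)
      - (if (j : ℕ) = i + 1 then c / 2 * (G i i + G j j) else 0)
      - (if (i : ℕ) = j + 1 then c / 2 * (G i i + G j j) else 0)
      = (if i = j then G i i else 0)
        - c / 2 * ((if (j : ℕ) = i + 1 then G i i else 0) + (if (j : ℕ) = i + 1 then G j j else 0)
        + (if (i : ℕ) = j + 1 then G i i else 0) + (if (i : ℕ) = j + 1 then G j j else 0)) := by
    intro i j; split_ifs <;> ring
  simp only [split, Finset.sum_sub_distrib, ← Finset.mul_sum, Finset.sum_add_distrib,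
    Finset.sum_ite_eq, Finset.mem_univ, if_true] at total
  nlinarith

/-- `T² ≥ (1 - Δ⁻¹) T` for the cut Hamiltonian `T`. Bonds on different sides of the cut are never
neighbours, as the bond at the cut is left out. -/
lemma sum_cutOp_sq {L : ℕ} {q : ℝ} (hq : 0 < q) (x : ℕ) (f : Cfg L → ℝ) :
    (1 - 2 * cpl q) * ∑ σ, f σ * cutOp q x f σ ≤ ∑ σ, cutOp q x f σ ^ 2 := by
  have hc := cpl_pos hq
  let a : Fin (L - 1) → Cfg L → ℝ := fun i σ =>
    if (i : ℕ) + 1 = x then 0 else bondOp q (decide ((i : ℕ) + 1 < x)) i f σ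
  have ha : ∀ i : Fin (L - 1), ¬ ((i : ℕ) + 1 = x) →
      a i = bondOp q (decide ((i : ℕ) + 1 < x)) i f := by
    intro i hi; funext σ; simp only [a, if_neg hi]
  have ha0 : ∀ i : Fin (L - 1), (i : ℕ) + 1 = x → ∀ σ, a i σ = 0 := by
    intro i hi σ; simp only [a, if_pos hi]
  have h := sum_gram_ge (fun i j => ∑ σ, a i σ * a j σ) (cpl q) hc.le
    (fun i j => Finset.sum_congr rfl fun σ _ => mul_comm _ _)
    (fun i => Finset.sum_nonneg fun σ _ => mul_self_nonneg _)
    (by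
      intro i j hij
      by_cases hi : (i : ℕ) + 1 = x
      · simp [ha0 i hi]
      by_cases hj : (j : ℕ) + 1 = x
      · simp [ha0 j hj]
      simp only [ha i hi, ha j hj]
      exact sum_bondOp_mul_nonneg hq _ _ hij f)
    (by
      intro i j hij
      have n1 : 0 ≤ ∑ σ, a i σ * a i σ := Finset.sum_nonneg fun σ _ => mul_self_nonneg _
      have n2 : 0 ≤ ∑ σ, a j σ * a j σ := Finset.sum_nonneg fun σ _ => mul_self_nonneg _
      by_cases hi : (i : ℕ) + 1 = x
      · have : ∑ σ, a i σ * a j σ = 0 := by simp [ha0 i hi]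
        rw [this]; nlinarith [mul_nonneg hc.le n1, mul_nonneg hc.le n2]
      by_cases hj : (j : ℕ) + 1 = x
      · have : ∑ σ, a i σ * a j σ = 0 := by simp [ha0 j hj]
        rw [this]; nlinarith [mul_nonneg hc.le n1, mul_nonneg hc.le n2]
      rw [ha i hi, ha j hj]
      have : decide ((j : ℕ) + 1 < x) = decide ((i : ℕ) + 1 < x) := by
        rw [decide_eq_decide]; omega
      rw [this]
      simpa only [← sq] using sum_bondOp_mul_neighbour hq (decide ((i : ℕ) + 1 < x)) hij f)
  have e1 : ∑ σ, f σ * cutOp q x f σ = ∑ i, ∑ σ, a i σ * a i σ := by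
    have : ∀ σ, f σ * cutOp q x f σ = ∑ i, f σ * a i σ := fun σ => by
      rw [← Finset.mul_sum]; rfl
    simp only [this]
    rw [Finset.sum_comm]
    refine Finset.sum_congr rfl fun i _ => ?_
    by_cases hi : (i : ℕ) + 1 = x
    · simp [ha0 i hi]
    · simp only [ha i hi, bondOp_norm hq, sq]
  have e2 : ∑ σ, cutOp q x f σ ^ 2 = ∑ i, ∑ j, ∑ σ, a i σ * a j σ := by
    have : ∀ σ, cutOp q x f σ ^ 2 = ∑ i, ∑ j, a i σ * a j σ := fun σ => by
      rw [sq, ← Finset.sum_mul_sum]; rfl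
    simp only [this]
    rw [Finset.sum_comm]
    exact Finset.sum_congr rfl fun i _ => Finset.sum_comm
  rw [e1, e2]; exact h

lemma sum_mul_cutOp_nonneg {L : ℕ} {q : ℝ} (hq : 0 < q) (x : ℕ) (f : Cfg L → ℝ) :
    0 ≤ ∑ σ, f σ * cutOp q x f σ := by
  simp only [cutOp, Finset.mul_sum]
  rw [Finset.sum_comm]
  refine Finset.sum_nonneg fun i _ => ?_
  split_ifs
  · simp
  · rw [bondOp_norm hq]; positivity

lemma cutOp_symm {L : ℕ} (q : ℝ) (x : ℕ) (f h : Cfg L → ℝ) :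
    ∑ σ, f σ * cutOp q x h σ = ∑ σ, cutOp q x f σ * h σ := by
  simp only [cutOp, Finset.mul_sum, Finset.sum_mul]
  rw [Finset.sum_comm]
  conv_rhs => rw [Finset.sum_comm]
  refine Finset.sum_congr rfl fun i _ => ?_
  split_ifs
  · simp
  · exact bondOp_symm _ _ _ _ _

/-- In the kernel of the cut Hamiltonian every bond is in its ground state. -/
lemma bondOp_eq_zero_of_cutOp {L : ℕ} {q : ℝ} (hq : 0 < q) {x : ℕ} {f : Cfg L → ℝ}
    (hf : ∀ σ, cutOp q x f σ = 0) (i : Fin (L - 1)) (hi : (i : ℕ) + 1 ≠ x) (σ : Cfg L) :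
    bondOp q (decide ((i : ℕ) + 1 < x)) i f σ = 0 := by
  have h0 : ∑ σ, f σ * cutOp q x f σ = 0 := by simp [hf]
  simp only [cutOp, Finset.mul_sum] at h0
  rw [Finset.sum_comm] at h0
  rw [Finset.sum_eq_zero_iff_of_nonneg] at h0
  · have := h0 i (Finset.mem_univ _)
    simp only [if_neg hi] at this
    rw [bondOp_norm hq, Finset.sum_eq_zero_iff_of_nonneg (fun _ _ => sq_nonneg _)] at this
    exact pow_eq_zero_iff (two_ne_zero) |>.1 (this σ (Finset.mem_univ _))
  · intro i _
    split_ifs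
    · simp
    · rw [bondOp_norm hq]; positivity

lemma bondOp_linear {L : ℕ} (q : ℝ) (b : Bool) (i : Fin (L - 1)) (f h : Cfg L → ℝ) (s : ℝ)
    (σ : Cfg L) :
    bondOp q b i (fun τ => f τ + s * h τ) σ = bondOp q b i f σ + s * bondOp q b i h σ := by
  unfold bondOp; split_ifs <;> ring

lemma cutOp_linear {L : ℕ} (q : ℝ) (x : ℕ) (f h : Cfg L → ℝ) (s : ℝ) (σ : Cfg L) :
    cutOp q x (fun τ => f τ + s * h τ) σ = cutOp q x f σ + s * cutOp q x h σ := by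
  unfold cutOp
  rw [Finset.mul_sum, ← Finset.sum_add_distrib]
  refine Finset.sum_congr rfl fun i _ => ?_
  split_ifs
  · simp
  · exact bondOp_linear _ _ _ _ _ _ _

/-- A symmetric operator `T` with `T² ≥ γ T ≥ 0` has spectral gap `γ` above its kernel. -/
lemma exists_kernel_part {E : Type*} [NormedAddCommGroup E] [InnerProductSpace ℝ E]
    [FiniteDimensional ℝ E] (T : E →ₗ[ℝ] E) (hT : T.IsSymmetric) {γ : ℝ} (hγ : 0 < γ)
    (hpos : ∀ v, 0 ≤ inner ℝ v (T v)) (hsq : ∀ v, γ * inner ℝ v (T v) ≤ inner ℝ (T v) (T v))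
    (φ : E) : ∃ e, T e = 0 ∧ inner ℝ e e = inner ℝ e φ ∧
      γ * (inner ℝ φ φ - inner ℝ e e) ≤ inner ℝ φ (T φ) := by
  obtain ⟨e, he, p, hp, rfl⟩ := (LinearMap.ker T).exists_add_mem_mem_orthogonal φ
  have he' : T e = 0 := he
  have hp' : p ∈ LinearMap.range T := by
    rw [← Submodule.orthogonal_orthogonal (LinearMap.range T), hT.orthogonal_range]
    exact hp
  obtain ⟨η, rfl⟩ := hp'
  have h0 : inner ℝ e (T η) = 0 := hp e he
  have h0' : inner ℝ (T η) e = 0 := by rw [real_inner_comm]; exact h0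
  refine ⟨e, he', by rw [inner_add_right, h0, add_zero], ?_⟩
  have h1 : inner ℝ (e + T η) (e + T η) - inner ℝ e e = inner ℝ (T η) (T η) := by
    rw [inner_add_left, inner_add_right, inner_add_right, h0, h0']; ring
  have h2 : inner ℝ (e + T η) (T (e + T η)) = inner ℝ (T η) (T (T η)) := by
    rw [map_add, he', zero_add, inner_add_left, ← hT e, he', inner_zero_left, zero_add]
  rw [h1, h2]
  set N := inner ℝ (T η) (T η) with hN
  set S := inner ℝ (T η) (T (T η)) with hS
  set Q := inner ℝ η (T η) with hQ
  -- Positivity of `T` on `s • Tη - η` for every `s`, i.e. Cauchy–Schwarz for its form.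
  have key : ∀ s : ℝ, 0 ≤ s ^ 2 * S - 2 * s * N + Q := by
    intro s
    have := hpos (s • T η - η)
    have e : inner ℝ (s • T η - η) (T (s • T η - η)) = s ^ 2 * S - 2 * s * N + Q := by
      rw [map_sub, map_smul, inner_sub_left, inner_sub_right, inner_sub_right, inner_smul_left,
        inner_smul_left, inner_smul_right, inner_smul_right, ← hT η (T η)]
      simp only [conj_trivial, ← hN, ← hS, ← hQ]
      ring
    rwa [e] at this
  have k := key (1 / γ)
  have hs := hsq η
  rw [← hN, ← hQ] at hs
  have hg : γ * (1 / γ) = 1 := by field_simp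
  have : 0 ≤ γ * γ * ((1 / γ) ^ 2 * S - 2 * (1 / γ) * N + Q) := by positivity
  have e : γ * γ * ((1 / γ) ^ 2 * S - 2 * (1 / γ) * N + Q) = S - 2 * γ * N + γ * (γ * Q) := by
    field_simp
  rw [e] at this
  nlinarith

/-- The spectral gap `1 - Δ⁻¹` of the cut Hamiltonian: `e` is the projection of `φ` to the
kernel. -/
lemma cutOp_gap {L : ℕ} {q : ℝ} (hq : 0 < q) (hγ : 0 < 1 - 2 * cpl q) (x : ℕ) (φ : Cfg L → ℝ) :
    ∃ e : Cfg L → ℝ, (∀ σ, cutOp q x e σ = 0) ∧ ∑ σ, e σ ^ 2 = ∑ σ, e σ * φ σ ∧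
      (1 - 2 * cpl q) * (∑ σ, φ σ ^ 2 - ∑ σ, e σ ^ 2) ≤ ∑ σ, φ σ * cutOp q x φ σ := by
  let T : EuclideanSpace ℝ (Cfg L) →ₗ[ℝ] EuclideanSpace ℝ (Cfg L) :=
    { toFun := fun v => WithLp.toLp 2 (cutOp q x v)
      map_add' := fun v w => by
        ext σ
        have := cutOp_linear q x v w 1 σ
        simp only [one_mul] at this
        exact this
      map_smul' := fun s v => by
        ext σ
        have := cutOp_linear q x (fun _ => 0) v s σ
        have z : cutOp q x (fun _ : Cfg L => (0 : ℝ)) σ = 0 := by simp [cutOp, bondOp]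
        rw [z] at this
        simpa [Pi.smul_def] using this }
  have hin : ∀ v w : EuclideanSpace ℝ (Cfg L), inner ℝ v w = ∑ σ, v σ * w σ := by
    intro v w
    simp [PiLp.inner_apply, mul_comm]
  have hTv : ∀ v σ, T v σ = cutOp q x v σ := fun _ _ => rfl
  obtain ⟨e, h1, h2, h3⟩ := exists_kernel_part T
    (fun v w => by rw [hin, hin]; simp only [hTv]; exact (cutOp_symm q x v w).symm) hγ
    (fun v => by rw [hin]; exact sum_mul_cutOp_nonneg hq x v)
    (fun v => by
      rw [hin, hin]; simp only [hTv, ← sq]; exact sum_cutOp_sq hq x v) (WithLp.toLp 2 φ)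
  refine ⟨e, fun σ => ?_, ?_, ?_⟩
  · rw [← hTv, h1]; rfl
  · rw [hin, hin] at h2; simpa [sq] using h2
  · simp only [hin, hTv, ← sq] at h3; exact h3

/-! ### Kernel of the cut Hamiltonian -/

/-- The unnormalised kink–antikink amplitude `q ^ wt` with cut at `x`. -/
def gs {L : ℕ} (q : ℝ) (x : ℕ) (σ : Cfg L) : ℝ := q ^ wt x σ

lemma gs_pos {L : ℕ} {q : ℝ} (hq : 0 < q) (x : ℕ) (σ : Cfg L) : 0 < gs q x σ := by
  unfold gs; positivity

lemma wt_hop {L : ℕ} (x : ℕ) (i : Fin (L - 1)) (σ : Cfg L) :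
    (wt x (hop i σ) : ℤ) = wt x σ
      + ((if σ (lo i) = 1 then (depth x (i + 1) : ℤ) - depth x i else 0)
        + (if σ (hi i) = 1 then (depth x i : ℤ) - depth x (i + 1) else 0)) := by
  have e1 : wt x (hop i σ)
      = ∑ j : Fin L, if σ j = 1 then depth x ((Equiv.swap (lo i) (hi i) j : Fin L) : ℕ) else 0 := by
    unfold wt
    rw [← Equiv.sum_comp (Equiv.swap (lo i) (hi i))]
    refine Finset.sum_congr rfl fun j _ => ?_
    have e : hop i σ (Equiv.swap (lo i) (hi i) j) = σ j := by simp [hop]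
    rw [e]
  have e2 : ∑ j : Fin L, ((if σ j = 1 then (depth x ((Equiv.swap (lo i) (hi i) j : Fin L) : ℕ) : ℤ)
        else 0) - (if σ j = 1 then (depth x (j : ℕ) : ℤ) else 0))
      = (if σ (lo i) = 1 then (depth x (i + 1) : ℤ) - depth x i else 0)
        + (if σ (hi i) = 1 then (depth x i : ℤ) - depth x (i + 1) else 0) := by
    rw [Fintype.sum_eq_add (lo i) (hi i) (lo_ne_hi i)]
    · rw [Equiv.swap_apply_left, Equiv.swap_apply_right]
      simp only [lo_val, hi_val]
      split_ifs <;> ring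
    · rintro j ⟨h1, h2⟩
      rw [Equiv.swap_apply_of_ne_of_ne h1 h2, sub_self]
  rw [← e2, Finset.sum_sub_distrib, e1]
  unfold wt
  push_cast
  ring

/-- Away from the cut, the kink–antikink amplitude satisfies the ground state equation of each bond.
-/
lemma gs_hop {L : ℕ} {q : ℝ} (hq : 0 < q) (x : ℕ) (i : Fin (L - 1)) (hi' : (i : ℕ) + 1 ≠ x)
    (σ : Cfg L) (h : σ (lo i) ≠ σ (hi i)) :
    gs q x (hop i σ) = rate q (decide ((i : ℕ) + 1 < x)) i σ * gs q x σ := by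
  have key := wt_hop x i σ
  have hf := fin2_one_iff h
  have up : wt x (hop i σ) = wt x σ + 1 → gs q x (hop i σ) = q * gs q x σ := by
    intro e; unfold gs; rw [e, pow_succ]; ring
  have dn : wt x (hop i σ) + 1 = wt x σ → gs q x (hop i σ) = q⁻¹ * gs q x σ := by
    intro e; unfold gs; rw [← e, pow_succ]; field_simp
  unfold rate
  by_cases hx : (i : ℕ) + 1 < x
  · have d1 : depth x i = depth x (i + 1) + 1 := by unfold depth; split_ifs <;> omega
    by_cases h1 : σ (lo i) = 1
    · have h2 : ¬ σ (hi i) = 1 := by simp [hf, h1]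
      rw [if_pos (by simp [hx, h1])]
      apply dn
      rw [if_pos h1, if_neg h2, d1] at key; push_cast at key; omega
    · have h2 : σ (hi i) = 1 := by simp [hf, h1]
      rw [if_neg (by simp [hx, h1])]
      apply up
      rw [if_neg h1, if_pos h2, d1] at key; push_cast at key; omega
  · have d1 : depth x (i + 1) = depth x i + 1 := by unfold depth; split_ifs <;> omega
    by_cases h1 : σ (lo i) = 1
    · have h2 : ¬ σ (hi i) = 1 := by simp [hf, h1]
      rw [if_neg (by simp [hx, h1])]
      apply up
      rw [if_pos h1, if_neg h2, d1] at key; push_cast at key; omega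
    · have h2 : σ (hi i) = 1 := by simp [hf, h1]
      rw [if_pos (by simp [hx, h1])]
      apply dn
      rw [if_neg h1, if_pos h2, d1] at key; push_cast at key; omega

/-- A function that is multiplied by the right ratio under each exchange away from the cut is in
the kernel. -/
lemma cutOp_gs_mul {L : ℕ} {q : ℝ} (hq : 0 < q) (x : ℕ) (F : Cfg L → ℝ)
    (hF : ∀ i : Fin (L - 1), (i : ℕ) + 1 ≠ x → ∀ σ, F (hop i σ) = F σ) (σ : Cfg L) :
    cutOp q x (fun τ => gs q x τ * F τ) σ = 0 := by
  unfold cutOp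
  refine Finset.sum_eq_zero fun i _ => ?_
  split_ifs with hi'
  · rfl
  · unfold bondOp
    split_ifs with h
    · simp only [hF i hi', gs_hop hq x i hi' σ h]; ring
    · rfl

/-- Functions invariant under the exchanges away from the cut are invariant under the exchange of
any two sites on the same side of it. -/
lemma apply_swap_eq {L : ℕ} {x : ℕ} {F : Cfg L → ℝ}
    (hF : ∀ i : Fin (L - 1), (i : ℕ) + 1 ≠ x → ∀ σ, F (hop i σ) = F σ) (d : ℕ) :
    ∀ a b : Fin L, (b : ℕ) = a + 1 + d → ((b : ℕ) < x ∨ x ≤ (a : ℕ)) → ∀ σ : Cfg L,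
      F (σ ∘ Equiv.swap a b) = F σ := by
  induction d with
  | zero =>
    intro a b hab hs σ
    have := hF ⟨a, by omega⟩ (by simp only; omega) σ
    have e1 : (lo ⟨a, by omega⟩ : Fin L) = a := rfl
    have e2 : (hi ⟨a, by omega⟩ : Fin L) = b := Fin.ext (by simp [hab])
    rwa [hop, e1, e2] at this
  | succ d ih =>
    intro a b hab hs σ
    let c : Fin L := ⟨(b : ℕ) - 1, by omega⟩
    have hc : (c : ℕ) = (b : ℕ) - 1 := rfl
    have hac : a ≠ c := by intro e; have := congrArg Fin.val e; omega
    have hab' : a ≠ b := by intro e; have := congrArg Fin.val e; omega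
    have hcb : ∀ σ : Cfg L, F (σ ∘ Equiv.swap c b) = F σ := by
      intro σ
      have := hF ⟨c, by omega⟩ (by simp only; omega) σ
      have e1 : (lo ⟨c, by omega⟩ : Fin L) = c := rfl
      have e2 : (hi ⟨c, by omega⟩ : Fin L) = b := Fin.ext (by simp; omega)
      rwa [hop, e1, e2] at this
    have e : Equiv.swap a b = Equiv.swap c b * Equiv.swap a c * Equiv.swap c b := by
      rw [Equiv.swap_mul_swap_mul_swap hac hab', Equiv.swap_comm]
    rw [e]
    have : σ ∘ ⇑(Equiv.swap c b * Equiv.swap a c * Equiv.swap c b)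
        = ((σ ∘ Equiv.swap c b) ∘ Equiv.swap a c) ∘ Equiv.swap c b := rfl
    rw [this, hcb, ih a c (by omega) (by omega), hcb]

/-- If two configurations have equally many down spins in `P`, a site of `P` that is down only in
the first is matched by one that is down only in the second. -/
lemma exists_excess {L : ℕ} (P : Fin L → Prop) [DecidablePred P] (σ τ : Cfg L) (j : Fin L)
    (hj : P j) (h1 : σ j = 1) (h2 : τ j ≠ 1)
    (hc : (∑ j, if P j ∧ σ j = 1 then 1 else 0) = ∑ j, if P j ∧ τ j = 1 then 1 else 0) :
    ∃ k, P k ∧ σ k ≠ 1 ∧ τ k = 1 := by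
  by_contra! hcon
  have : (∑ j, if P j ∧ τ j = 1 then 1 else 0) < ∑ j, if P j ∧ σ j = 1 then 1 else 0 := by
    refine Finset.sum_lt_sum (fun k _ => ?_) ⟨j, Finset.mem_univ _, by simp [hj, h1, h2]⟩
    by_cases hk : P k ∧ τ k = 1
    · have : σ k = 1 := by by_contra h; exact hcon k hk.1 h hk.2
      simp [hk.1, this, hk.2]
    · simp [hk]
  omega

lemma cnt_add_right {L : ℕ} (x : ℕ) (σ : Cfg L) :
    cnt L σ = cnt x σ + ∑ j : Fin L, if ¬ ((j : ℕ) < x) ∧ σ j = 1 then 1 else 0 := by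
  unfold cnt
  rw [← Finset.sum_add_distrib]
  refine Finset.sum_congr rfl fun j _ => ?_
  have := j.2
  by_cases h : (j : ℕ) < x <;> by_cases h2 : σ j = 1 <;> simp [h, h2]

lemma sum_swap_side {L : ℕ} (P : Fin L → Prop) [DecidablePred P] (a b : Fin L) (h : P a ↔ P b)
    (σ : Cfg L) :
    (∑ j, if P j ∧ (σ ∘ Equiv.swap a b) j = 1 then 1 else 0)
      = ∑ j, if P j ∧ σ j = 1 then 1 else 0 := by
  rw [← Equiv.sum_comp (Equiv.swap a b)]
  refine Finset.sum_congr rfl fun j _ => ?_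
  have : P (Equiv.swap a b j) ↔ P j := by
    by_cases h1 : j = a
    · subst h1; simp [h]
    by_cases h2 : j = b
    · subst h2; simp [h]
    rw [Equiv.swap_apply_of_ne_of_ne h1 h2]
  simp [this]

/-- Configurations with the same numbers of down spins on both sides of the cut are connected by
exchanges away from the cut. -/
lemma eq_of_cnt_eq {L : ℕ} {x : ℕ} {F : Cfg L → ℝ}
    (hF : ∀ i : Fin (L - 1), (i : ℕ) + 1 ≠ x → ∀ σ, F (hop i σ) = F σ) (σ τ : Cfg L)
    (h1 : cnt x σ = cnt x τ) (h2 : cnt L σ = cnt L τ) : F σ = F τ := by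
  have hswap : ∀ a b : Fin L, a ≠ b → ((a : ℕ) < x ↔ (b : ℕ) < x) → ∀ σ : Cfg L,
      F (σ ∘ Equiv.swap a b) = F σ := by
    intro a b hab hs σ
    have hab' : (a : ℕ) ≠ b := fun e => hab (Fin.ext e)
    rcases Nat.lt_or_gt_of_ne hab' with h | h
    · exact apply_swap_eq hF (b - a - 1) a b (by omega) (by omega) σ
    · rw [Equiv.swap_comm]
      exact apply_swap_eq hF (a - b - 1) b a (by omega) (by omega) σ
  -- Induction on the number of sites where the two configurations disagree.
  suffices H : ∀ (d : ℕ) (σ : Cfg L), (Finset.univ.filter fun j => σ j ≠ τ j).card = d →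
      cnt x σ = cnt x τ → cnt L σ = cnt L τ → F σ = F τ from H _ σ rfl h1 h2
  intro d
  induction d using Nat.strong_induction_on with
  | _ d ih =>
    intro σ hd h1 h2
    by_cases hστ : σ = τ
    · rw [hστ]
    obtain ⟨j, hj⟩ := Function.ne_iff.1 hστ
    -- Two sites on the same side of the cut whose exchange in `σ` reduces the disagreement.
    obtain ⟨a, b, hs, ha1, ha2, hb1, hb2⟩ : ∃ a b : Fin L, ((a : ℕ) < x ↔ (b : ℕ) < x) ∧
        σ a = 1 ∧ τ a ≠ 1 ∧ σ b ≠ 1 ∧ τ b = 1 := by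
      have hr : (∑ j : Fin L, if ¬ ((j : ℕ) < x) ∧ σ j = 1 then 1 else 0)
          = ∑ j : Fin L, if ¬ ((j : ℕ) < x) ∧ τ j = 1 then 1 else 0 := by
        have := cnt_add_right x σ
        have := cnt_add_right x τ
        omega
      have hf := fin2_one_iff hj
      by_cases hside : (j : ℕ) < x
      · by_cases h : σ j = 1
        · obtain ⟨k, k1, k2, k3⟩ := exists_excess (fun j : Fin L => (j : ℕ) < x) σ τ j hside h
            (by simp [hf, h]) h1
          exact ⟨j, k, by simp [hside, k1], h, by simp [hf, h], k2, k3⟩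
        · obtain ⟨k, k1, k2, k3⟩ := exists_excess (fun j : Fin L => (j : ℕ) < x) τ σ j hside
            (by simp [hf, h]) h h1.symm
          exact ⟨k, j, by simp [hside, k1], k3, k2, h, by simp [hf, h]⟩
      · by_cases h : σ j = 1
        · obtain ⟨k, k1, k2, k3⟩ := exists_excess (fun j : Fin L => ¬ (j : ℕ) < x) σ τ j hside h
            (by simp [hf, h]) hr
          exact ⟨j, k, by simp [hside, k1], h, by simp [hf, h], k2, k3⟩
        · obtain ⟨k, k1, k2, k3⟩ := exists_excess (fun j : Fin L => ¬ (j : ℕ) < x) τ σ j hside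
            (by simp [hf, h]) h hr.symm
          exact ⟨k, j, by simp [hside, k1], k3, k2, h, by simp [hf, h]⟩
    have hab : a ≠ b := by rintro rfl; exact hb1 ha1
    have c1 : cnt x (σ ∘ Equiv.swap a b) = cnt x σ :=
      sum_swap_side (fun j : Fin L => (j : ℕ) < x) a b hs σ
    have c2 : cnt L (σ ∘ Equiv.swap a b) = cnt L σ :=
      sum_swap_side (fun j : Fin L => (j : ℕ) < L) a b (by simp) σ
    have e01 : ∀ u v : Fin 2, u ≠ 1 → v ≠ 1 → u = v := by decide
    have lt : (Finset.univ.filter fun j => (σ ∘ Equiv.swap a b) j ≠ τ j).card < d := by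
      rw [← hd]
      apply Finset.card_lt_card
      rw [Finset.ssubset_iff_of_subset]
      · exact ⟨a, by simp [ha1]; exact fun e => ha2 e.symm, by simp [e01 _ _ hb1 ha2]⟩
      · intro k hk
        simp only [Finset.mem_filter, Finset.mem_univ, true_and] at hk ⊢
        by_cases k1 : k = a
        · subst k1; rw [ha1]; exact fun e => ha2 e.symm
        by_cases k2 : k = b
        · subst k2; rw [hb2]; exact hb1
        simpa [Equiv.swap_apply_of_ne_of_ne k1 k2] using hk
    rw [← hswap a b hab hs σ]
    exact ih _ lt _ rfl (c1.trans h1) (c2.trans h2)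

/-- Elements of the kernel of the cut Hamiltonian are, for given numbers of down spins on the two
sides, multiples of the kink–antikink state. -/
lemma kernel_proportional {L : ℕ} {q : ℝ} (hq : 0 < q) {x : ℕ} {e : Cfg L → ℝ}
    (he : ∀ σ, cutOp q x e σ = 0) (σ τ : Cfg L) (h1 : cnt x σ = cnt x τ)
    (h2 : cnt L σ = cnt L τ) : e σ * gs q x τ = e τ * gs q x σ := by
  have := eq_of_cnt_eq (x := x) (F := fun σ => e σ / gs q x σ) (fun i hi' σ => ?_) σ τ h1 h2
  · have p1 := (gs_pos hq x σ).ne'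
    have p2 := (gs_pos hq x τ).ne'
    field_simp at this
    linarith
  · by_cases h : σ (lo i) = σ (hi i)
    · simp only [hop_eq_self h]
    have b0 := bondOp_eq_zero_of_cutOp hq he i hi' σ
    unfold bondOp at b0
    rw [if_pos h] at b0
    have b1 := (mul_eq_zero.1 b0).resolve_left (cpl_pos hq).ne'
    have r := (rate_pos hq (decide ((i : ℕ) + 1 < x)) i σ).ne'
    have p1 := (gs_pos hq x σ).ne'
    rw [gs_hop hq x i hi' σ h, ← sub_eq_zero.1 b1]
    field_simp

/-! ### Removing an up spin -/

/-- The occupation number of the site `j`, zero outside the chain. -/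
def dn {L : ℕ} (σ : Cfg L) (j : ℕ) : ℕ := if h : j < L then (if σ ⟨j, h⟩ = 1 then 1 else 0) else 0

lemma dn_val {L : ℕ} (σ : Cfg L) (j : Fin L) : dn σ j = if σ j = 1 then 1 else 0 := by
  unfold dn; rw [dif_pos j.2]

lemma dn_le_one {L : ℕ} (σ : Cfg L) (j : ℕ) : dn σ j ≤ 1 := by
  unfold dn; split_ifs <;> omega

lemma dn_of_le {L : ℕ} (σ : Cfg L) {j : ℕ} (h : L ≤ j) : dn σ j = 0 := by
  unfold dn; rw [dif_neg (by omega)]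

lemma cfg_ext {L : ℕ} {σ τ : Cfg L} (h : ∀ j, j < L → dn σ j = dn τ j) : σ = τ := by
  funext j
  have := h j j.2
  rw [dn_val, dn_val] at this
  have key : ∀ a b : Fin 2, (if a = 1 then 1 else 0) = (if b = 1 then 1 else 0) → a = b := by
    decide
  exact key _ _ this

lemma cnt_eq_sum {L : ℕ} (x : ℕ) (σ : Cfg L) : cnt x σ = ∑ j ∈ range x, dn σ j := by
  have h1 : cnt x σ = ∑ j ∈ range L, if j < x then dn σ j else 0 := by
    rw [← Fin.sum_univ_eq_sum_range (fun j => if j < x then dn σ j else 0)]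
    unfold cnt
    refine Finset.sum_congr rfl fun j _ => ?_
    rw [dn_val]
    by_cases h : (j : ℕ) < x <;> simp [h]
  rw [h1, ← Finset.sum_filter]
  apply Finset.sum_subset_zero_on_sdiff
  · intro j; simp
  · intro j; simp only [mem_sdiff, mem_range, mem_filter]; intro h
    exact dn_of_le σ (by omega)
  · intros; rfl

lemma cnt_succ {L : ℕ} (x : ℕ) (σ : Cfg L) : cnt (x + 1) σ = cnt x σ + dn σ x := by
  rw [cnt_eq_sum, cnt_eq_sum, Finset.sum_range_succ]

lemma cnt_zero {L : ℕ} (σ : Cfg L) : cnt 0 σ = 0 := by rw [cnt_eq_sum]; simp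

lemma cnt_mono {L : ℕ} {x y : ℕ} (h : x ≤ y) (σ : Cfg L) : cnt x σ ≤ cnt y σ := by
  rw [cnt_eq_sum, cnt_eq_sum]
  exact Finset.sum_le_sum_of_subset (by simpa using h)

lemma cnt_le_total {L : ℕ} (x : ℕ) (σ : Cfg L) : cnt x σ ≤ cnt L σ := by
  rw [cnt_add_right x σ]; omega

lemma wt_eq_sum {L : ℕ} (x : ℕ) (σ : Cfg L) : wt x σ = ∑ j ∈ range L, depth x j * dn σ j := by
  rw [← Fin.sum_univ_eq_sum_range (fun j => depth x j * dn σ j)]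
  unfold wt
  refine Finset.sum_congr rfl fun j _ => ?_
  rw [dn_val]; split_ifs <;> simp

/-- The configuration with occupation numbers `d`. -/
def ofDn (L : ℕ) (d : ℕ → ℕ) : Cfg L := fun j => if d j = 1 then 1 else 0

lemma dn_ofDn {L : ℕ} (d : ℕ → ℕ) (hd : ∀ j, d j ≤ 1) {j : ℕ} (hj : j < L) :
    dn (ofDn L d) j = d j := by
  unfold dn ofDn
  rw [dif_pos hj]
  have := hd j
  by_cases h : d j = 1
  · simp [h]
  · simp [h]; omega

/-- Remove site `y` and append an up spin at the right end. -/
def delR {L : ℕ} (y : ℕ) (σ : Cfg L) : Cfg L :=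
  ofDn L fun j => if j < y then dn σ j else dn σ (j + 1)

/-- Remove site `y` and append an up spin at the left end. -/
def delL {L : ℕ} (y : ℕ) (σ : Cfg L) : Cfg L :=
  ofDn L fun j => if j ≤ y then (if j = 0 then 0 else dn σ (j - 1)) else dn σ j

lemma dn_delR {L : ℕ} {y : ℕ} (hy : y < L) (σ : Cfg L) (j : ℕ) :
    dn (delR y σ) j = if j < y then dn σ j else dn σ (j + 1) := by
  by_cases hj : j < L
  · exact dn_ofDn (fun j => if j < y then dn σ j else dn σ (j + 1))
      (fun j => by split_ifs <;> exact dn_le_one _ _) hj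
  · rw [dn_of_le _ (by omega), if_neg (by omega), dn_of_le _ (by omega)]

lemma dn_delL {L : ℕ} {y : ℕ} (hy : y < L) (σ : Cfg L) (j : ℕ) :
    dn (delL y σ) j = if j ≤ y then (if j = 0 then 0 else dn σ (j - 1)) else dn σ j := by
  by_cases hj : j < L
  · exact dn_ofDn (fun j => if j ≤ y then (if j = 0 then 0 else dn σ (j - 1)) else dn σ j)
      (fun j => by split_ifs <;> first | exact dn_le_one _ _ | omega) hj
  · rw [dn_of_le _ (by omega), if_neg (by omega), dn_of_le _ (by omega)]

lemma cnt_delR_of_le {L : ℕ} {y : ℕ} (hy : y < L) (σ : Cfg L) {z : ℕ} (hz : z ≤ y) :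
    cnt z (delR y σ) = cnt z σ := by
  rw [cnt_eq_sum, cnt_eq_sum]
  refine Finset.sum_congr rfl fun j hj => ?_
  rw [mem_range] at hj
  rw [dn_delR hy, if_pos (by omega)]

lemma cnt_delR_of_ge {L : ℕ} {y : ℕ} (hy : y < L) {σ : Cfg L} (h0 : dn σ y = 0) {z : ℕ}
    (hz : y ≤ z) : cnt z (delR y σ) = cnt (z + 1) σ := by
  induction z, hz using Nat.le_induction with
  | base => rw [cnt_delR_of_le hy σ le_rfl, cnt_succ, h0, add_zero]
  | succ z hz ih => rw [cnt_succ, ih, cnt_succ (z + 1), dn_delR hy, if_neg (by omega)]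

lemma cnt_delL_of_le {L : ℕ} {y : ℕ} (hy : y < L) (σ : Cfg L) {z : ℕ} (hz : z ≤ y) :
    cnt (z + 1) (delL y σ) = cnt z σ := by
  induction z with
  | zero => rw [cnt_succ, cnt_zero, cnt_zero, dn_delL hy]; simp
  | succ z ih =>
    rw [cnt_succ, ih (by omega), cnt_succ z, dn_delL hy, if_pos hz, if_neg (by omega)]; simp

lemma cnt_delL_of_ge {L : ℕ} {y : ℕ} (hy : y < L) {σ : Cfg L} (h0 : dn σ y = 0) {z : ℕ}
    (hz : y + 1 ≤ z) : cnt z (delL y σ) = cnt z σ := by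
  induction z, hz using Nat.le_induction with
  | base => rw [cnt_delL_of_le hy σ le_rfl, cnt_succ, h0, add_zero]
  | succ z hz ih => rw [cnt_succ, ih, cnt_succ z, dn_delL hy, if_neg (by omega)]

lemma cnt_succ_total {L : ℕ} (σ : Cfg L) : cnt (L + 1) σ = cnt L σ := by
  rw [cnt_succ, dn_of_le σ le_rfl, add_zero]

/-- Each down spin to the right of the removed site comes closer to the cut by one. -/
lemma wt_delR {L : ℕ} {x y : ℕ} (hy : y < L) (hxy : x ≤ y) {σ : Cfg L} (h0 : dn σ y = 0) :
    wt x (delR y σ) + (cnt L σ - cnt y σ) = wt x σ := by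
  have key : ∀ M, y ≤ M → ∑ j ∈ range M, depth x j * dn (delR y σ) j + cnt (M + 1) σ
      = ∑ j ∈ range (M + 1), depth x j * dn σ j + cnt y σ := by
    intro M hM
    induction M, hM using Nat.le_induction with
    | base =>
      rw [Finset.sum_range_succ, cnt_succ, h0, mul_zero, add_zero, add_zero]
      congr 1
      refine Finset.sum_congr rfl fun j hj => ?_
      rw [dn_delR hy, if_pos (by simpa using hj)]
    | succ M hM ih =>
      have hd : depth x (M + 1) = depth x M + 1 := by unfold depth; split_ifs <;> omega
      rw [Finset.sum_range_succ, Finset.sum_range_succ _ (M + 1), cnt_succ (M + 1), dn_delR hy,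
        if_neg (by omega), hd]
      linarith
  have := key L hy.le
  rw [cnt_succ_total, Finset.sum_range_succ, dn_of_le σ le_rfl, mul_zero, add_zero, ← wt_eq_sum,
    ← wt_eq_sum] at this
  have := cnt_le_total y σ
  omega

/-- Each down spin to the left of the removed site comes closer to the cut by one. -/
lemma wt_delL {L : ℕ} {x y : ℕ} (hy : y < L) (hxy : y < x) {σ : Cfg L} (h0 : dn σ y = 0) :
    wt x (delL y σ) + cnt y σ = wt x σ := by
  have key : ∀ M, M ≤ y → ∑ j ∈ range (M + 1), depth x j * dn (delL y σ) j + cnt M σ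
      = ∑ j ∈ range M, depth x j * dn σ j := by
    intro M hM
    induction M with
    | zero => rw [cnt_zero, Finset.sum_range_succ, dn_delL hy]; simp
    | succ M ih =>
      have hd : depth x M = depth x (M + 1) + 1 := by unfold depth; split_ifs <;> omega
      have := ih (by omega)
      have hd' : dn (delL y σ) (M + 1) = dn σ M := by
        rw [dn_delL hy, if_pos hM, if_neg (by omega), Nat.add_sub_cancel]
      rw [Finset.sum_range_succ _ (M + 1),
        Finset.sum_range_succ (fun j => depth x j * dn σ j) M, cnt_succ, hd', hd]
      linarith
  have key2 : ∀ M, y + 1 ≤ M → ∑ j ∈ range M, depth x j * dn (delL y σ) j + cnt y σ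
      = ∑ j ∈ range M, depth x j * dn σ j := by
    intro M hM
    induction M, hM using Nat.le_induction with
    | base => rw [key y le_rfl, Finset.sum_range_succ, h0, mul_zero, add_zero]
    | succ M hM ih =>
      rw [Finset.sum_range_succ, Finset.sum_range_succ _ M, dn_delL hy, if_neg (by omega)]
      linarith
  rw [wt_eq_sum, wt_eq_sum]
  exact key2 L hy

/-- Removing a hole at `y ≥ x` moves everything on its right towards the cut, so that configurations
with a hole at `y` and at least `r` down spins on its right carry little of the mass of an element
of the kernel. -/
lemma kernel_mass_right {L : ℕ} {q : ℝ} (hq0 : 0 < q) (hq1 : q < 1) {x y r : ℕ} (hxy : x ≤ y)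
    (hy : y < L) {e : Cfg L → ℝ} (he : ∀ σ, cutOp q x e σ = 0) (P Q : Cfg L → Prop)
    [DecidablePred P] [DecidablePred Q]
    (hP : ∀ σ, P σ → dn σ y = 0 ∧ cnt y σ + r ≤ cnt L σ ∧ Q (delR y σ)) :
    ∑ σ with P σ, e σ ^ 2 ≤ q ^ (2 * r) * ∑ σ with Q σ, e σ ^ 2 := by
  have inj : Set.InjOn (delR y) ((Finset.univ.filter P : Finset (Cfg L)) : Set (Cfg L)) := by
    intro σ hσ τ hτ h
    simp only [coe_filter, mem_univ, true_and, Set.mem_ofPred_eq] at hσ hτ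
    refine cfg_ext fun j _ => ?_
    have hd : ∀ j, dn (delR y σ) j = dn (delR y τ) j := fun j => by rw [h]
    rcases lt_trichotomy j y with hj | hj | hj
    · simpa [dn_delR hy, hj] using hd j
    · rw [hj, (hP σ hσ).1, (hP τ hτ).1]
    · have := hd (j - 1)
      rw [dn_delR hy, dn_delR hy, if_neg (by omega), if_neg (by omega),
        Nat.sub_add_cancel (by omega)] at this
      exact this
  have bound : ∀ σ ∈ Finset.univ.filter P, e σ ^ 2 ≤ q ^ (2 * r) * e (delR y σ) ^ 2 := by
    intro σ hσ
    simp only [mem_filter, mem_univ, true_and] at hσ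
    obtain ⟨h0, hr, -⟩ := hP σ hσ
    have hk := kernel_proportional hq0 he σ (delR y σ) (cnt_delR_of_le hy σ hxy).symm
      (by rw [cnt_delR_of_ge hy h0 hy.le, cnt_succ_total])
    have hw := wt_delR hy hxy h0
    have hg : gs q x σ = gs q x (delR y σ) * q ^ (cnt L σ - cnt y σ) := by
      unfold gs; rw [← pow_add, hw]
    have hp := (gs_pos hq0 x (delR y σ)).ne'
    rw [hg] at hk
    have e1 : e σ = e (delR y σ) * q ^ (cnt L σ - cnt y σ) := by
      apply mul_right_cancel₀ hp; rw [hk]; ring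
    rw [e1, mul_pow, ← pow_mul, mul_comm]
    refine mul_le_mul_of_nonneg_right ?_ (sq_nonneg _)
    exact pow_le_pow_of_le_one hq0.le hq1.le (by omega)
  calc _ ≤ ∑ σ with P σ, q ^ (2 * r) * e (delR y σ) ^ 2 := Finset.sum_le_sum bound
    _ = q ^ (2 * r) * ∑ τ ∈ (Finset.univ.filter P).image (delR y), e τ ^ 2 := by
        rw [Finset.sum_image inj, Finset.mul_sum]
    _ ≤ _ := by
        refine mul_le_mul_of_nonneg_left ?_ (by positivity)
        refine Finset.sum_le_sum_of_subset_of_nonneg ?_ fun _ _ _ => sq_nonneg _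
        intro τ hτ
        obtain ⟨σ, hσ, rfl⟩ := Finset.mem_image.1 hτ
        simp only [mem_filter, mem_univ, true_and] at hσ ⊢
        exact (hP σ hσ).2.2

/-- The mirror image of `kernel_mass_right`. -/
lemma kernel_mass_left {L : ℕ} {q : ℝ} (hq0 : 0 < q) (hq1 : q < 1) {x y r : ℕ} (hxy : y < x)
    (hy : y < L) {e : Cfg L → ℝ} (he : ∀ σ, cutOp q x e σ = 0) (P Q : Cfg L → Prop)
    [DecidablePred P] [DecidablePred Q]
    (hP : ∀ σ, P σ → dn σ y = 0 ∧ r ≤ cnt y σ ∧ Q (delL y σ)) :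
    ∑ σ with P σ, e σ ^ 2 ≤ q ^ (2 * r) * ∑ σ with Q σ, e σ ^ 2 := by
  have inj : Set.InjOn (delL y) ((Finset.univ.filter P : Finset (Cfg L)) : Set (Cfg L)) := by
    intro σ hσ τ hτ h
    simp only [coe_filter, mem_univ, true_and, Set.mem_ofPred_eq] at hσ hτ
    refine cfg_ext fun j _ => ?_
    have hd : ∀ j, dn (delL y σ) j = dn (delL y τ) j := fun j => by rw [h]
    rcases lt_trichotomy j y with hj | hj | hj
    · have := hd (j + 1)
      have hj' : j + 1 ≤ y := hj
      simpa [dn_delL hy, hj'] using this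
    · rw [hj, (hP σ hσ).1, (hP τ hτ).1]
    · have := hd j
      rw [dn_delL hy, dn_delL hy, if_neg (by omega), if_neg (by omega)] at this
      exact this
  have bound : ∀ σ ∈ Finset.univ.filter P, e σ ^ 2 ≤ q ^ (2 * r) * e (delL y σ) ^ 2 := by
    intro σ hσ
    simp only [mem_filter, mem_univ, true_and] at hσ
    obtain ⟨h0, hr, -⟩ := hP σ hσ
    have hk := kernel_proportional hq0 he σ (delL y σ) (cnt_delL_of_ge hy h0 hxy).symm
      (cnt_delL_of_ge hy h0 hy).symm
    have hw := wt_delL hy hxy h0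
    have hg : gs q x σ = gs q x (delL y σ) * q ^ (cnt y σ) := by
      unfold gs; rw [← pow_add, hw]
    have hp := (gs_pos hq0 x (delL y σ)).ne'
    rw [hg] at hk
    have e1 : e σ = e (delL y σ) * q ^ (cnt y σ) := by
      apply mul_right_cancel₀ hp; rw [hk]; ring
    rw [e1, mul_pow, ← pow_mul, mul_comm]
    refine mul_le_mul_of_nonneg_right ?_ (sq_nonneg _)
    exact pow_le_pow_of_le_one hq0.le hq1.le (by omega)
  calc _ ≤ ∑ σ with P σ, q ^ (2 * r) * e (delL y σ) ^ 2 := Finset.sum_le_sum bound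
    _ = q ^ (2 * r) * ∑ τ ∈ (Finset.univ.filter P).image (delL y), e τ ^ 2 := by
        rw [Finset.sum_image inj, Finset.mul_sum]
    _ ≤ _ := by
        refine mul_le_mul_of_nonneg_left ?_ (by positivity)
        refine Finset.sum_le_sum_of_subset_of_nonneg ?_ fun _ _ _ => sq_nonneg _
        intro τ hτ
        obtain ⟨σ, hσ, rfl⟩ := Finset.mem_image.1 hτ
        simp only [mem_filter, mem_univ, true_and] at hσ ⊢
        exact (hP σ hσ).2.2

/-! ### The droplet Hamiltonian on real amplitudes -/

/-- The boundary field `A(Δ)`, in terms of `q`. -/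
def fld (q : ℝ) : ℝ := cpl q * (q⁻¹ - q) / 2

/-- The value of `S³` at site `j`. -/
def sp {L : ℕ} (σ : Cfg L) (j : ℕ) : ℝ := 1 / 2 - dn σ j

/-- The pair interaction of the XXZ chain on the `i`-th bond. -/
def pairR {L : ℕ} (q : ℝ) (i : Fin (L - 1)) (f : Cfg L → ℝ) (σ : Cfg L) : ℝ :=
  if σ (lo i) ≠ σ (hi i) then f σ / 2 - cpl q * f (hop i σ) else 0

/-- The Hamiltonian `H^{++}` acting on real amplitudes. -/
def hamR {L : ℕ} (q : ℝ) (f : Cfg L → ℝ) (σ : Cfg L) : ℝ :=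
  ∑ i : Fin (L - 1), pairR q i f σ - fld q * (sp σ 0 + sp σ (L - 1)) * f σ

/-- The part of `H^{++} - A(Δ)` that is not in the cut Hamiltonian. It acts on the two sites next to
the cut. -/
def cutBond {L : ℕ} (q : ℝ) (x : ℕ) (f : Cfg L → ℝ) (σ : Cfg L) : ℝ :=
  (∑ i : Fin (L - 1), if (i : ℕ) + 1 = x then pairR q i f σ else 0)
    - fld q * (sp σ (x - 1) + sp σ x) * f σ - fld q * f σ

lemma half_add_fld {q : ℝ} (hq : 0 < q) : 1 / 2 + fld q = cpl q * q⁻¹ := by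
  unfold fld cpl; field_simp; ring

lemma half_sub_fld {q : ℝ} (hq : 0 < q) : 1 / 2 - fld q = cpl q * q := by
  unfold fld cpl; field_simp; ring

lemma fld_nonneg {q : ℝ} (hq0 : 0 < q) (hq1 : q < 1) : 0 ≤ fld q := by
  have := cpl_pos hq0
  have : 1 ≤ q⁻¹ := (one_le_inv₀ hq0).2 hq1.le
  unfold fld
  have : 0 ≤ q⁻¹ - q := by linarith
  positivity

lemma fld_le_half {q : ℝ} (hq0 : 0 < q) : fld q ≤ 1 / 2 := by
  have := half_sub_fld hq0
  have := mul_pos (cpl_pos hq0) hq0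
  linarith

lemma cpl_lt_half {q : ℝ} (hq0 : 0 < q) (hq1 : q < 1) : cpl q < 1 / 2 := by
  have h : cpl q * (q + q⁻¹) = 1 := by unfold cpl; exact inv_mul_cancel₀ (by positivity)
  have hc := cpl_pos hq0
  have : 2 < q + q⁻¹ := by
    have : q + q⁻¹ - 2 = (1 - q) ^ 2 * q⁻¹ := by field_simp; ring
    have : 0 < (1 - q) ^ 2 * q⁻¹ := by
      have : 0 < 1 - q := by linarith
      positivity
    linarith
  nlinarith

lemma gap_pos {q : ℝ} (hq0 : 0 < q) (hq1 : q < 1) : 0 < 1 - 2 * cpl q := by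
  linarith [cpl_lt_half hq0 hq1]

lemma bondOp_true {L : ℕ} {q : ℝ} (hq : 0 < q) (i : Fin (L - 1)) (f : Cfg L → ℝ) (σ : Cfg L) :
    bondOp q true i f σ = pairR q i f σ - fld q * (sp σ i - sp σ (i + 1)) * f σ := by
  have h1 := half_add_fld hq
  have h2 := half_sub_fld hq
  have d1 := dn_val σ (lo i)
  have d2 := dn_val σ (hi i)
  rw [lo_val] at d1
  rw [hi_val] at d2
  unfold bondOp pairR sp rate
  rw [d1, d2]
  by_cases h : σ (lo i) = σ (hi i)
  · simp [h]
  · have hf := fin2_one_iff h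
    rw [if_pos h, if_pos h]
    by_cases h3 : σ (lo i) = 1
    · have h4 : ¬ σ (hi i) = 1 := by simp [hf, h3]
      rw [if_pos (by simp [h3]), if_pos h3, if_neg h4]
      push_cast
      linear_combination (-f σ) * h1
    · have h4 : σ (hi i) = 1 := by simp [hf, h3]
      rw [if_neg (by simp [h3]), if_neg h3, if_pos h4]
      push_cast
      linear_combination (-f σ) * h2

lemma bondOp_false {L : ℕ} {q : ℝ} (hq : 0 < q) (i : Fin (L - 1)) (f : Cfg L → ℝ) (σ : Cfg L) :
    bondOp q false i f σ = pairR q i f σ + fld q * (sp σ i - sp σ (i + 1)) * f σ := by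
  have h1 := half_add_fld hq
  have h2 := half_sub_fld hq
  have d1 := dn_val σ (lo i)
  have d2 := dn_val σ (hi i)
  rw [lo_val] at d1
  rw [hi_val] at d2
  unfold bondOp pairR sp rate
  rw [d1, d2]
  by_cases h : σ (lo i) = σ (hi i)
  · simp [h]
  · have hf := fin2_one_iff h
    rw [if_pos h, if_pos h]
    by_cases h3 : σ (lo i) = 1
    · have h4 : ¬ σ (hi i) = 1 := by simp [hf, h3]
      rw [if_neg (by simp [h3]), if_pos h3, if_neg h4]
      push_cast
      linear_combination (-f σ) * h2
    · have h4 : σ (hi i) = 1 := by simp [hf, h3]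
      rw [if_pos (by simp [h3]), if_neg h3, if_pos h4]
      push_cast
      linear_combination (-f σ) * h1

lemma sum_telescope (S : ℕ → ℝ) {x M : ℕ} (hx : 1 ≤ x) (hM : x ≤ M) :
    ∑ i ∈ range M, (if i + 1 = x then 0 else if i + 1 < x then S i - S (i + 1)
      else S (i + 1) - S i) = S 0 - S (x - 1) + S M - S x := by
  induction M, hM using Nat.le_induction with
  | base =>
    obtain ⟨y, rfl⟩ : ∃ y, x = y + 1 := ⟨x - 1, by omega⟩
    rw [Finset.sum_range_succ, if_pos rfl]
    have : ∑ i ∈ range y, (if i + 1 = y + 1 then 0 else if i + 1 < y + 1 then S i - S (i + 1)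
        else S (i + 1) - S i) = ∑ i ∈ range y, (S i - S (i + 1)) := by
      refine Finset.sum_congr rfl fun i hi' => ?_
      rw [mem_range] at hi'
      rw [if_neg (by omega), if_pos (by omega)]
    rw [this, Finset.sum_range_sub']
    simp
  | succ M hM ih =>
    rw [Finset.sum_range_succ, ih, if_neg (by omega), if_neg (by omega)]; ring

lemma cutOp_eq {L : ℕ} {q : ℝ} (hq : 0 < q) {x : ℕ} (hx : 1 ≤ x) (hxL : x < L)
    (f : Cfg L → ℝ) (σ : Cfg L) :
    cutOp q x f σ = (∑ i : Fin (L - 1), if (i : ℕ) + 1 = x then 0 else pairR q i f σ)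
      - fld q * (sp σ 0 - sp σ (x - 1) + sp σ (L - 1) - sp σ x) * f σ := by
  rw [← sum_telescope (sp σ) hx (by omega : x ≤ L - 1),
    ← Fin.sum_univ_eq_sum_range (fun i => if i + 1 = x then 0 else if i + 1 < x then
      sp σ i - sp σ (i + 1) else sp σ (i + 1) - sp σ i), Finset.mul_sum, Finset.sum_mul,
    ← Finset.sum_sub_distrib]
  unfold cutOp
  refine Finset.sum_congr rfl fun i _ => ?_
  by_cases h : (i : ℕ) + 1 = x
  · simp [h]
  by_cases h2 : (i : ℕ) + 1 < x
  · simp only [h, h2, if_false, if_true, decide_true, bondOp_true hq]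
  · simp only [h, h2, if_false, decide_false, bondOp_false hq]; ring

/-- Cutting the chain: `H^{++} = A(Δ) + H^{+-}_{[1,x]} + H^{-+}_{[x+1,L]}` up to a term on the two
sites next to the cut. -/
lemma hamR_eq {L : ℕ} {q : ℝ} (hq : 0 < q) {x : ℕ} (hx : 1 ≤ x) (hxL : x < L)
    (f : Cfg L → ℝ) (σ : Cfg L) :
    hamR q f σ = fld q * f σ + cutOp q x f σ + cutBond q x f σ := by
  rw [cutOp_eq hq hx hxL]
  unfold hamR cutBond
  have : ∑ i : Fin (L - 1), pairR q i f σ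
      = (∑ i : Fin (L - 1), if (i : ℕ) + 1 = x then 0 else pairR q i f σ)
        + ∑ i : Fin (L - 1), if (i : ℕ) + 1 = x then pairR q i f σ else 0 := by
    rw [← Finset.sum_add_distrib]
    refine Finset.sum_congr rfl fun i _ => ?_
    split_ifs <;> ring
  rw [this]; ring

lemma cutBond_of_down {L : ℕ} (q : ℝ) {x : ℕ} (hx : 1 ≤ x) (f : Cfg L → ℝ) {σ : Cfg L}
    (h1 : dn σ (x - 1) = 1) (h2 : dn σ x = 1) : cutBond q x f σ = 0 := by
  unfold cutBond
  have : ∑ i : Fin (L - 1), (if (i : ℕ) + 1 = x then pairR q i f σ else 0) = 0 := by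
    refine Finset.sum_eq_zero fun i _ => ?_
    split_ifs with h
    · unfold pairR
      rw [if_neg]
      have e1 := dn_val σ (lo i)
      have e2 := dn_val σ (hi i)
      rw [lo_val, show (i : ℕ) = x - 1 by omega, h1] at e1
      rw [hi_val, h, h2] at e2
      have key : ∀ a : Fin 2, 1 = (if a = 1 then 1 else 0) → a = 1 := by decide
      rw [key _ e1, key _ e2]; simp
    · rfl
  rw [this]; unfold sp; rw [h1, h2]; push_cast; ring

/-- The number of bonds with different spins. -/
def walls {L : ℕ} (σ : Cfg L) : ℝ := ∑ i : Fin (L - 1), if σ (lo i) ≠ σ (hi i) then 1 else 0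

lemma sum_wall_hop {L : ℕ} (i : Fin (L - 1)) (f : Cfg L → ℝ) :
    ∑ σ : Cfg L, (if σ (lo i) ≠ σ (hi i) then f (hop i σ) else 0)
      = ∑ σ : Cfg L, (if σ (lo i) ≠ σ (hi i) then f σ else 0) := by
  rw [← sum_hop i]
  refine Finset.sum_congr rfl fun σ _ => ?_
  simp only [hop_lo, hop_hi, hop_hop, ne_comm]

lemma pairR_lower {L : ℕ} {q : ℝ} (hq : 0 < q) (i : Fin (L - 1)) (f : Cfg L → ℝ) :
    (1 / 2 - cpl q) * ∑ σ : Cfg L, (if σ (lo i) ≠ σ (hi i) then f σ ^ 2 else 0)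
      ≤ ∑ σ, f σ * pairR q i f σ := by
  have hc := cpl_pos hq
  have h1 : ∑ σ : Cfg L, ((1 / 2 - cpl q / 2) * (if σ (lo i) ≠ σ (hi i) then f σ ^ 2 else 0)
      - cpl q / 2 * (if σ (lo i) ≠ σ (hi i) then f (hop i σ) ^ 2 else 0))
      ≤ ∑ σ, f σ * pairR q i f σ := by
    refine Finset.sum_le_sum fun σ _ => ?_
    unfold pairR
    split_ifs
    · nlinarith [mul_nonneg hc.le (sq_nonneg (f σ - f (hop i σ)))]
    · simp
  rw [Finset.sum_sub_distrib, ← Finset.mul_sum, ← Finset.mul_sum,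
    sum_wall_hop i (fun σ => f σ ^ 2)] at h1
  linarith

lemma sp_le {L : ℕ} (σ : Cfg L) (j : ℕ) : sp σ j ≤ 1 / 2 := by
  unfold sp
  have : (0 : ℝ) ≤ dn σ j := by positivity
  linarith

lemma le_sp {L : ℕ} (σ : Cfg L) (j : ℕ) : -(1 / 2) ≤ sp σ j := by
  unfold sp
  have : (dn σ j : ℝ) ≤ 1 := by exact_mod_cast dn_le_one σ j
  linarith

lemma sum_mul_walls {L : ℕ} (f : Cfg L → ℝ) :
    ∑ i : Fin (L - 1), ∑ σ : Cfg L, (if σ (lo i) ≠ σ (hi i) then f σ else 0)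
      = ∑ σ, walls σ * f σ := by
  rw [Finset.sum_comm]
  refine Finset.sum_congr rfl fun σ _ => ?_
  unfold walls
  rw [Finset.sum_mul]
  refine Finset.sum_congr rfl fun i _ => ?_
  split_ifs <;> simp

/-- Every domain wall costs at least `(1 - Δ⁻¹) / 2`. -/
lemma hamR_lower {L : ℕ} {q : ℝ} (hq0 : 0 < q) (hq1 : q < 1) (f : Cfg L → ℝ) :
    ∑ σ, ((1 / 2 - cpl q) * walls σ - fld q) * f σ ^ 2 ≤ ∑ σ, f σ * hamR q f σ := by
  have hA := fld_nonneg hq0 hq1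
  have h1 := Finset.sum_le_sum fun i (_ : i ∈ (Finset.univ : Finset (Fin (L - 1)))) =>
    pairR_lower hq0 i f
  rw [← Finset.mul_sum, sum_mul_walls (fun σ => f σ ^ 2)] at h1
  have h2 : ∑ σ, f σ * hamR q f σ = ∑ i : Fin (L - 1), ∑ σ, f σ * pairR q i f σ
      - ∑ σ, fld q * (sp σ 0 + sp σ (L - 1)) * f σ ^ 2 := by
    rw [Finset.sum_comm, ← Finset.sum_sub_distrib]
    refine Finset.sum_congr rfl fun σ _ => ?_
    rw [← Finset.mul_sum]; unfold hamR; ring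
  have h3 : ∑ σ, fld q * (sp σ 0 + sp σ (L - 1)) * f σ ^ 2 ≤ ∑ σ : Cfg L, fld q * f σ ^ 2 := by
    refine Finset.sum_le_sum fun σ _ => ?_
    have := sp_le σ 0
    have := sp_le σ (L - 1)
    refine mul_le_mul_of_nonneg_right ?_ (sq_nonneg _)
    nlinarith
  have h4 : ∑ σ, ((1 / 2 - cpl q) * walls σ - fld q) * f σ ^ 2
      = (1 / 2 - cpl q) * ∑ σ, walls σ * f σ ^ 2 - ∑ σ, fld q * f σ ^ 2 := by
    rw [Finset.mul_sum, ← Finset.sum_sub_distrib]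
    exact Finset.sum_congr rfl fun σ _ => by ring
  rw [h4, h2]; linarith

/-- The energy of an amplitude supported on configurations with both sites next to the cut down. -/
lemma hamR_of_down {L : ℕ} {q : ℝ} (hq : 0 < q) {x : ℕ} (hx : 1 ≤ x) (hxL : x < L)
    (f : Cfg L → ℝ) (hf : ∀ σ, f σ ≠ 0 → dn σ (x - 1) = 1 ∧ dn σ x = 1) :
    ∑ σ, f σ * hamR q f σ = fld q * ∑ σ, f σ ^ 2 + ∑ σ, f σ * cutOp q x f σ := by
  rw [Finset.mul_sum, ← Finset.sum_add_distrib]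
  refine Finset.sum_congr rfl fun σ _ => ?_
  by_cases h : f σ = 0
  · simp [h]
  · rw [hamR_eq hq hx hxL, cutBond_of_down q hx f (hf σ h).1 (hf σ h).2]; ring

/-! ### A Poincaré inequality for kernel elements -/

/-- Elements of the kernel of the cut Hamiltonian have few domain walls away from the cut. -/
lemma kernel_walls {L : ℕ} {q : ℝ} (hq0 : 0 < q) (hq1 : q < 1) {x : ℕ} (hx : 1 ≤ x)
    (hxL : x < L) {e : Cfg L → ℝ} (he : ∀ σ, cutOp q x e σ = 0) :
    (1 / 2 - cpl q) * ∑ i : Fin (L - 1), (if (i : ℕ) + 1 = x then 0 else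
      ∑ σ : Cfg L, (if σ (lo i) ≠ σ (hi i) then e σ ^ 2 else 0)) ≤ ∑ σ, e σ ^ 2 := by
  have hA := fld_nonneg hq0 hq1
  have hA2 := fld_le_half hq0
  have h1 : (1 / 2 - cpl q) * ∑ i : Fin (L - 1), (if (i : ℕ) + 1 = x then 0 else
      ∑ σ : Cfg L, (if σ (lo i) ≠ σ (hi i) then e σ ^ 2 else 0))
      ≤ ∑ i : Fin (L - 1), (if (i : ℕ) + 1 = x then 0 else ∑ σ, e σ * pairR q i e σ) := by
    rw [Finset.mul_sum]
    refine Finset.sum_le_sum fun i _ => ?_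
    split_ifs
    · simp
    · exact pairR_lower hq0 i e
  have h2 : ∑ i : Fin (L - 1), (if (i : ℕ) + 1 = x then 0 else ∑ σ, e σ * pairR q i e σ)
      = ∑ σ, e σ * ∑ i : Fin (L - 1), (if (i : ℕ) + 1 = x then 0 else pairR q i e σ) := by
    simp only [Finset.mul_sum]
    rw [Finset.sum_comm]
    refine Finset.sum_congr rfl fun i _ => ?_
    split_ifs <;> simp
  have h3 : ∑ σ, e σ * ∑ i : Fin (L - 1), (if (i : ℕ) + 1 = x then 0 else pairR q i e σ)
      ≤ ∑ σ, e σ ^ 2 := by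
    refine Finset.sum_le_sum fun σ _ => ?_
    have h := he σ
    rw [cutOp_eq hq0 hx hxL] at h
    rw [sub_eq_zero.1 h]
    have b : fld q * (sp σ 0 - sp σ (x - 1) + sp σ (L - 1) - sp σ x) ≤ 1 := by
      have := sp_le σ 0
      have := sp_le σ (L - 1)
      have := le_sp σ (x - 1)
      have := le_sp σ x
      nlinarith
    nlinarith [mul_le_mul_of_nonneg_right b (sq_nonneg (e σ))]
  linarith

/-- The ground state representation of the form of the cut Hamiltonian, as a bound. -/
lemma kernel_dirichlet {L : ℕ} {q : ℝ} (hq0 : 0 < q) (hq1 : q < 1) {x : ℕ} (hx : 1 ≤ x)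
    (hxL : x < L) {e : Cfg L → ℝ} (he : ∀ σ, cutOp q x e σ = 0) (χ : Cfg L → ℝ) {δ : ℝ}
    (hδ : ∀ i σ, (χ σ - χ (hop i σ)) ^ 2 ≤ δ) :
    (1 - 2 * cpl q) * ∑ σ, (e σ * χ σ) * cutOp q x (fun τ => e τ * χ τ) σ
      ≤ δ / 2 * ∑ σ, e σ ^ 2 := by
  have hc := cpl_pos hq0
  have hc2 := cpl_lt_half hq0 hq1
  have hw := kernel_walls hq0 hq1 hx hxL he
  set W := ∑ i : Fin (L - 1), (if (i : ℕ) + 1 = x then 0 else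
      ∑ σ : Cfg L, (if σ (lo i) ≠ σ (hi i) then e σ ^ 2 else 0)) with hW
  have hW0 : 0 ≤ W := by
    refine Finset.sum_nonneg fun i _ => ?_
    split_ifs
    · rfl
    · refine Finset.sum_nonneg fun σ _ => ?_
      split_ifs <;> positivity
  have e0 : ∀ i : Fin (L - 1), (i : ℕ) + 1 ≠ x → ∀ σ : Cfg L, σ (lo i) ≠ σ (hi i) →
      rate q (decide ((i : ℕ) + 1 < x)) i σ * e σ = e (hop i σ) := by
    intro i hi' σ h
    have b0 := bondOp_eq_zero_of_cutOp hq0 he i hi' σ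
    unfold bondOp at b0
    rw [if_pos h] at b0
    exact sub_eq_zero.1 ((mul_eq_zero.1 b0).resolve_left hc.ne')
  -- Symmetrising the sum over a bond turns `e χ T (e χ)` into a squared gradient.
  have hb : ∀ i : Fin (L - 1), (i : ℕ) + 1 ≠ x →
      ∑ σ, (e σ * χ σ) * bondOp q (decide ((i : ℕ) + 1 < x)) i (fun τ => e τ * χ τ) σ
      ≤ cpl q / 2 * (δ * ∑ σ : Cfg L, (if σ (lo i) ≠ σ (hi i) then e σ ^ 2 else 0)) := by
    intro i hi'
    have t1 : ∀ σ, (e σ * χ σ) * bondOp q (decide ((i : ℕ) + 1 < x)) i (fun τ => e τ * χ τ) σ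
        = if σ (lo i) ≠ σ (hi i) then cpl q * (e σ * e (hop i σ) * χ σ * (χ σ - χ (hop i σ)))
          else 0 := by
      intro σ
      unfold bondOp
      split_ifs with h
      · have := e0 i hi' σ h
        linear_combination (e σ * χ σ ^ 2 * cpl q) * this
      · simp
    have t2 := sum_wall_hop i
      (fun σ => cpl q * (e σ * e (hop i σ) * χ σ * (χ σ - χ (hop i σ))))
    simp only [hop_hop] at t2
    simp only [t1]
    have t3 : ∑ σ : Cfg L, ((if σ (lo i) ≠ σ (hi i) then
          cpl q * (e σ * e (hop i σ) * χ σ * (χ σ - χ (hop i σ))) else 0)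
        + (if σ (lo i) ≠ σ (hi i) then
          cpl q * (e (hop i σ) * e σ * χ (hop i σ) * (χ (hop i σ) - χ σ)) else 0))
        ≤ ∑ σ : Cfg L, cpl q * δ / 2 * ((if σ (lo i) ≠ σ (hi i) then e σ ^ 2 else 0)
          + (if σ (lo i) ≠ σ (hi i) then e (hop i σ) ^ 2 else 0)) := by
      refine Finset.sum_le_sum fun σ _ => ?_
      split_ifs
      · have h1 := hδ i σ
        have h2 : e σ * e (hop i σ) ≤ (e σ ^ 2 + e (hop i σ) ^ 2) / 2 := by
          nlinarith [sq_nonneg (e σ - e (hop i σ))]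
        have h3 : e σ * e (hop i σ) * (χ σ - χ (hop i σ)) ^ 2
            ≤ (e σ ^ 2 + e (hop i σ) ^ 2) / 2 * δ :=
          (mul_le_mul_of_nonneg_right h2 (sq_nonneg _)).trans
            (mul_le_mul_of_nonneg_left h1 (by positivity))
        nlinarith [mul_le_mul_of_nonneg_left h3 hc.le]
      · simp
    rw [Finset.sum_add_distrib, t2, ← Finset.mul_sum, Finset.sum_add_distrib,
      sum_wall_hop i (fun σ => e σ ^ 2)] at t3
    linarith
  have hsum : ∑ σ, (e σ * χ σ) * cutOp q x (fun τ => e τ * χ τ) σ ≤ cpl q / 2 * (δ * W) := by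
    simp only [cutOp, Finset.mul_sum (s := (Finset.univ : Finset (Fin (L - 1))))]
    rw [Finset.sum_comm, hW, Finset.mul_sum, Finset.mul_sum]
    refine Finset.sum_le_sum fun i _ => ?_
    split_ifs with h
    · simp
    · exact hb i h
  have hγ := gap_pos hq0 hq1
  by_cases hδ0 : 0 ≤ δ
  · calc _ ≤ (1 - 2 * cpl q) * (cpl q / 2 * (δ * W)) := mul_le_mul_of_nonneg_left hsum hγ.le
      _ = cpl q * δ * ((1 / 2 - cpl q) * W) := by ring
      _ ≤ cpl q * δ * ∑ σ, e σ ^ 2 := mul_le_mul_of_nonneg_left hw (by positivity)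
      _ ≤ _ := by
        refine mul_le_mul_of_nonneg_right ?_ (Finset.sum_nonneg fun _ _ => sq_nonneg _)
        nlinarith
  · exfalso
    exact hδ0 ((sq_nonneg _).trans (hδ ⟨x - 1, by omega⟩ fun _ => 0))

/-- The droplet state with cut at `x`, as a real amplitude. -/
def xi {L : ℕ} (q : ℝ) (m n x : ℕ) (σ : Cfg L) : ℝ :=
  gs q x σ * if cnt x σ = m ∧ cnt L σ = n then 1 else 0

lemma cutOp_xi {L : ℕ} {q : ℝ} (hq : 0 < q) (m n x : ℕ) (σ : Cfg L) :
    cutOp q x (xi q m n x) σ = 0 :=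
  cutOp_gs_mul hq x (fun σ => if cnt x σ = m ∧ cnt L σ = n then 1 else 0)
    (fun i hi' σ => by simp only [cnt_hop x i hi', cnt_hop_total]) σ

lemma xi_eq_zero {L : ℕ} {q : ℝ} {m n x : ℕ} {σ : Cfg L} (h : ¬ (cnt x σ = m ∧ cnt L σ = n)) :
    xi q m n x σ = 0 := by unfold xi; rw [if_neg h, mul_zero]

/-- On the configurations with the given numbers of down spins, kernel elements are multiples of
the droplet state. -/
lemma kernel_eq_xi {L : ℕ} {q : ℝ} (hq : 0 < q) {x : ℕ} {e : Cfg L → ℝ}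
    (he : ∀ σ, cutOp q x e σ = 0) (m n : ℕ) :
    ∃ μ : ℝ, ∀ σ : Cfg L, cnt x σ = m → cnt L σ = n → e σ = μ * xi q m n x σ := by
  by_cases h : ∃ τ : Cfg L, cnt x τ = m ∧ cnt L τ = n
  · obtain ⟨τ, h1, h2⟩ := h
    refine ⟨e τ / gs q x τ, fun σ h3 h4 => ?_⟩
    have := kernel_proportional hq he σ τ (h3.trans h1.symm) (h4.trans h2.symm)
    have p := (gs_pos hq x τ).ne'
    unfold xi
    rw [if_pos ⟨h3, h4⟩]
    field_simp
    linarith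
  · exact ⟨0, fun σ h3 h4 => (h ⟨σ, h3, h4⟩).elim⟩

/-- A function with small gradient has small variance in a droplet state: multiplied by the droplet
state and centred, it is orthogonal to the kernel of the cut Hamiltonian, whose gap bounds it by the
Dirichlet form in `kernel_dirichlet`. -/
lemma xi_poincare {L : ℕ} {q : ℝ} (hq0 : 0 < q) (hq1 : q < 1) {x : ℕ} (hx : 1 ≤ x)
    (hxL : x < L) (m n : ℕ) (χ : Cfg L → ℝ) (h0 : ∀ σ, 0 ≤ χ σ) (h1 : ∀ σ, χ σ ≤ 1) {δ : ℝ}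
    (hδ : ∀ i σ, (χ σ - χ (hop i σ)) ^ 2 ≤ δ) :
    ∃ c : ℝ, 0 ≤ c ∧ c ≤ 1 ∧ (1 - 2 * cpl q) ^ 2 * ∑ σ, xi q m n x σ ^ 2 * (χ σ - c) ^ 2
      ≤ δ / 2 * ∑ σ : Cfg L, xi q m n x σ ^ 2 := by
  have hγ := gap_pos hq0 hq1
  set Z := ∑ σ : Cfg L, xi q m n x σ ^ 2 with hZ
  have hZ0 : 0 ≤ Z := Finset.sum_nonneg fun _ _ => sq_nonneg _
  set N := ∑ σ : Cfg L, xi q m n x σ ^ 2 * χ σ with hN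
  have hN0 : 0 ≤ N := Finset.sum_nonneg fun σ _ => mul_nonneg (sq_nonneg _) (h0 σ)
  have hNZ : N ≤ Z := Finset.sum_le_sum fun σ _ => by nlinarith [sq_nonneg (xi q m n x σ), h1 σ]
  refine ⟨N / Z, div_nonneg hN0 hZ0, div_le_one_of_le₀ hNZ hZ0, ?_⟩
  have hcZ : N / Z * Z = N := by
    by_cases h : Z = 0
    · rw [h]; rw [h] at hNZ; simp; linarith
    · field_simp
  set c := N / Z with hc
  let w : Cfg L → ℝ := fun σ => xi q m n x σ * χ σ + (-c) * xi q m n x σ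
  have hTw : ∀ σ, cutOp q x w σ = cutOp q x (fun τ => xi q m n x τ * χ τ) σ := by
    intro σ
    have := cutOp_linear q x (fun τ => xi q m n x τ * χ τ) (xi q m n x) (-c) σ
    rw [cutOp_xi hq0, mul_zero, add_zero] at this
    exact this
  obtain ⟨e, he, he2, hgap⟩ := cutOp_gap hq0 hγ x w
  have hw0 : ∑ σ, xi q m n x σ * w σ = 0 := by
    have : ∑ σ, xi q m n x σ * w σ = N - c * Z := by
      rw [hN, hZ, Finset.mul_sum, ← Finset.sum_sub_distrib]
      exact Finset.sum_congr rfl fun σ _ => by simp only [w]; ring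
    rw [this, hcZ, sub_self]
  have hew : ∑ σ, e σ * w σ = 0 := by
    obtain ⟨μ, hμ⟩ := kernel_eq_xi hq0 he m n
    have : ∑ σ, e σ * w σ = μ * ∑ σ, xi q m n x σ * w σ := by
      rw [Finset.mul_sum]
      refine Finset.sum_congr rfl fun σ _ => ?_
      by_cases h : cnt x σ = m ∧ cnt L σ = n
      · rw [hμ σ h.1 h.2]; ring
      · simp only [w, xi_eq_zero h]; ring
    rw [this, hw0, mul_zero]
  rw [hew] at he2
  rw [he2, sub_zero] at hgap
  have hform : ∑ σ, w σ * cutOp q x w σ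
      = ∑ σ, (xi q m n x σ * χ σ) * cutOp q x (fun τ => xi q m n x τ * χ τ) σ := by
    have h2 : ∑ σ, xi q m n x σ * cutOp q x (fun τ => xi q m n x τ * χ τ) σ = 0 := by
      rw [cutOp_symm]; simp [cutOp_xi hq0]
    have : ∑ σ, w σ * cutOp q x w σ
        = ∑ σ, (xi q m n x σ * χ σ) * cutOp q x (fun τ => xi q m n x τ * χ τ) σ
          + (-c) * ∑ σ, xi q m n x σ * cutOp q x (fun τ => xi q m n x τ * χ τ) σ := by
      rw [Finset.mul_sum, ← Finset.sum_add_distrib]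
      refine Finset.sum_congr rfl fun σ _ => ?_
      rw [hTw]; simp only [w]; ring
    rw [this, h2, mul_zero, add_zero]
  have hd := kernel_dirichlet hq0 hq1 hx hxL (cutOp_xi hq0 m n x) χ hδ
  rw [← hform] at hd
  have hww : ∑ σ, w σ ^ 2 = ∑ σ, xi q m n x σ ^ 2 * (χ σ - c) ^ 2 :=
    Finset.sum_congr rfl fun σ _ => by simp only [w]; ring
  rw [hww] at hgap
  calc _ = (1 - 2 * cpl q) * ((1 - 2 * cpl q) * ∑ σ, xi q m n x σ ^ 2 * (χ σ - c) ^ 2) := by ring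
    _ ≤ _ := (mul_le_mul_of_nonneg_left hgap hγ.le).trans hd

/-! ### Localisation of the droplet states -/

/-- If the cut could be moved by `j` sites to the right, there are `j` up spins next to it. Each of
them costs a factor, by `kernel_mass_right`. -/
lemma xi_mass_right {L : ℕ} {q : ℝ} (hq0 : 0 < q) (hq1 : q < 1) {m n x : ℕ} (hmn : m ≤ n)
    (j : ℕ) (hj : x + j ≤ L) :
    ∑ σ : Cfg L with cnt (x + j) σ = m, xi q m n x σ ^ 2
      ≤ (q ^ (2 * (n - m))) ^ j * ∑ σ : Cfg L, xi q m n x σ ^ 2 := by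
  induction j with
  | zero =>
    rw [pow_zero, one_mul]
    exact Finset.sum_le_sum_of_subset_of_nonneg (Finset.filter_subset _ _) fun _ _ _ => sq_nonneg _
  | succ j ih =>
    have step : ∑ σ : Cfg L with cnt (x + (j + 1)) σ = m, xi q m n x σ ^ 2
        = ∑ σ : Cfg L with (cnt (x + (j + 1)) σ = m ∧ cnt x σ = m ∧ cnt L σ = n),
          xi q m n x σ ^ 2 := by
      rw [Finset.sum_filter, Finset.sum_filter]
      refine Finset.sum_congr rfl fun σ _ => ?_
      by_cases h : cnt x σ = m ∧ cnt L σ = n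
      · simp [h]
      · simp [xi_eq_zero h]
    have key := kernel_mass_right (L := L) hq0 hq1 (x := x) (y := x) (r := n - m) le_rfl (by omega)
      (cutOp_xi hq0 m n x)
      (fun σ => cnt (x + (j + 1)) σ = m ∧ cnt x σ = m ∧ cnt L σ = n)
      (fun σ => cnt (x + j) σ = m) (by
        rintro σ ⟨h1, h2, h3⟩
        have h0 : dn σ x = 0 := by
          have a := cnt_succ x σ
          have b := cnt_mono (show x + 1 ≤ x + (j + 1) by omega) σ
          omega
        refine ⟨h0, by omega, ?_⟩
        rw [cnt_delR_of_ge (by omega) h0 (by omega)]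
        exact h1)
    rw [step]
    refine key.trans ?_
    rw [pow_succ', mul_assoc]
    exact mul_le_mul_of_nonneg_left (ih (by omega)) (by positivity)

/-- The mirror image of `xi_mass_right`. -/
lemma xi_mass_left {L : ℕ} {q : ℝ} (hq0 : 0 < q) (hq1 : q < 1) {m n x : ℕ} (hx : x ≤ L)
    (j : ℕ) (hj : j ≤ x) :
    ∑ σ : Cfg L with cnt (x - j) σ = m, xi q m n x σ ^ 2
      ≤ (q ^ (2 * m)) ^ j * ∑ σ : Cfg L, xi q m n x σ ^ 2 := by
  induction j with
  | zero =>
    rw [pow_zero, one_mul]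
    exact Finset.sum_le_sum_of_subset_of_nonneg (Finset.filter_subset _ _) fun _ _ _ => sq_nonneg _
  | succ j ih =>
    have step : ∑ σ : Cfg L with cnt (x - (j + 1)) σ = m, xi q m n x σ ^ 2
        = ∑ σ : Cfg L with (cnt (x - (j + 1)) σ = m ∧ cnt x σ = m ∧ cnt L σ = n),
          xi q m n x σ ^ 2 := by
      rw [Finset.sum_filter, Finset.sum_filter]
      refine Finset.sum_congr rfl fun σ _ => ?_
      by_cases h : cnt x σ = m ∧ cnt L σ = n
      · simp [h]
      · simp [xi_eq_zero h]
    have key := kernel_mass_left (L := L) hq0 hq1 (x := x) (y := x - 1) (r := m) (by omega)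
      (by omega) (cutOp_xi hq0 m n x)
      (fun σ => cnt (x - (j + 1)) σ = m ∧ cnt x σ = m ∧ cnt L σ = n)
      (fun σ => cnt (x - j) σ = m) (by
        rintro σ ⟨h1, h2, h3⟩
        have a := cnt_succ (x - 1) σ
        rw [Nat.sub_add_cancel (by omega)] at a
        have b := cnt_mono (show x - (j + 1) ≤ x - 1 by omega) σ
        have h0 : dn σ (x - 1) = 0 := by omega
        refine ⟨h0, by omega, ?_⟩
        have := cnt_delL_of_le (y := x - 1) (by omega) σ (z := x - (j + 1)) (by omega)
        rw [show x - (j + 1) + 1 = x - j by omega] at this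
        rw [this]
        exact h1)
    rw [step]
    refine key.trans ?_
    rw [pow_succ', mul_assoc]
    exact mul_le_mul_of_nonneg_left (ih (by omega)) (by positivity)

/-- The number of cuts with exactly `m` down spins on their left. -/
def mult {L : ℕ} (m : ℕ) (σ : Cfg L) : ℕ := ((range (L + 1)).filter fun y => cnt y σ = m).card

lemma mult_pos {L : ℕ} {m x : ℕ} {σ : Cfg L} (hx : x ≤ L) (h : cnt x σ = m) : 1 ≤ mult m σ :=
  Finset.card_pos.2 ⟨x, by simp [h]; omega⟩

lemma geom_sum_le {s : ℝ} (h0 : 0 ≤ s) (h1 : s < 1) (k : ℕ) :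
    ∑ j ∈ range k, s ^ (j + 1) ≤ s / (1 - s) := by
  have e : ∑ j ∈ range k, s ^ (j + 1) = s * ∑ j ∈ range k, s ^ j := by
    rw [Finset.mul_sum]; exact Finset.sum_congr rfl fun j _ => pow_succ' _ _
  have g := geom_sum_mul s k
  have hp : 0 ≤ s ^ k := by positivity
  have h2 : 0 < 1 - s := by linarith
  rw [e, le_div_iff₀ h2]
  nlinarith

/-- Droplet states are concentrated where the cut is determined by the configuration. -/
lemma xi_mult {L : ℕ} {q : ℝ} (hq0 : 0 < q) (hq1 : q < 1) {m n x : ℕ} (hm : 1 ≤ m)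
    (hmn : 2 * m ≤ n) (hx : x ≤ L) :
    ∑ σ : Cfg L, ((mult m σ : ℝ) - 1) * xi q m n x σ ^ 2
      ≤ 2 / (1 - q ^ 2) * q ^ (2 * m) * ∑ σ : Cfg L, xi q m n x σ ^ 2 := by
  set Z := ∑ σ : Cfg L, xi q m n x σ ^ 2 with hZ
  have hZ0 : 0 ≤ Z := Finset.sum_nonneg fun _ _ => sq_nonneg _
  have hq2 : q ^ (2 * m) ≤ q ^ 2 := pow_le_pow_of_le_one hq0.le hq1.le (by omega)
  have hq21 : q ^ 2 < 1 := by nlinarith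
  -- `mult - 1` counts the other cuts with `m` down spins on their left.
  have h1 : ∑ σ : Cfg L, ((mult m σ : ℝ) - 1) * xi q m n x σ ^ 2
      ≤ ∑ j ∈ range (L - x), ∑ σ : Cfg L with cnt (x + (j + 1)) σ = m, xi q m n x σ ^ 2
        + ∑ j ∈ range x, ∑ σ : Cfg L with cnt (x - (j + 1)) σ = m, xi q m n x σ ^ 2 := by
    simp only [Finset.sum_filter]
    rw [Finset.sum_comm, Finset.sum_comm (s := range x), ← Finset.sum_add_distrib]
    refine Finset.sum_le_sum fun σ _ => ?_
    by_cases h : cnt x σ = m ∧ cnt L σ = n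
    swap
    · simp [xi_eq_zero h]
    have e1 : ∀ (s : Finset ℕ) (p : ℕ → Prop) [DecidablePred p],
        ∑ j ∈ s, (if p j then xi q m n x σ ^ 2 else 0)
          = ((s.filter p).card : ℝ) * xi q m n x σ ^ 2 := by
      intro s p _
      rw [← Finset.sum_filter, Finset.sum_const, nsmul_eq_mul]
    rw [e1, e1, ← add_mul]
    refine mul_le_mul_of_nonneg_right ?_ (sq_nonneg _)
    have hsub : (range (L + 1)).filter (fun y => cnt y σ = m)
        ⊆ insert x (((range (L - x)).filter (fun j => cnt (x + (j + 1)) σ = m)).image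
            (fun j => x + (j + 1))
          ∪ ((range x).filter (fun j => cnt (x - (j + 1)) σ = m)).image
            (fun j => x - (j + 1))) := by
      intro y hy
      simp only [mem_filter, mem_range, mem_insert, mem_union, mem_image] at hy ⊢
      rcases lt_trichotomy y x with h1 | h1 | h1
      · right; right
        have : x - (x - y - 1 + 1) = y := by omega
        exact ⟨x - y - 1, ⟨by omega, by rw [this]; exact hy.2⟩, this⟩
      · left; exact h1
      · right; left
        have : x + (y - x - 1 + 1) = y := by omega
        exact ⟨y - x - 1, ⟨by omega, by rw [this]; exact hy.2⟩, this⟩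
    have hc := (Finset.card_le_card hsub).trans (Finset.card_insert_le _ _)
    have hc2 := hc.trans (Nat.add_le_add_right
      ((Finset.card_union_le _ _).trans (Nat.add_le_add Finset.card_image_le
        Finset.card_image_le)) 1)
    have h4 := (Nat.cast_le (α := ℝ)).2 hc2
    push_cast at h4
    unfold mult
    linarith
  have s1 : ∑ j ∈ range (L - x), ∑ σ : Cfg L with cnt (x + (j + 1)) σ = m, xi q m n x σ ^ 2
      ≤ q ^ (2 * m) / (1 - q ^ (2 * m)) * Z := by
    calc _ ≤ ∑ j ∈ range (L - x), (q ^ (2 * m)) ^ (j + 1) * Z := by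
          refine Finset.sum_le_sum fun j hj => ?_
          rw [mem_range] at hj
          refine (xi_mass_right hq0 hq1 (by omega) (j + 1) (by omega)).trans ?_
          refine mul_le_mul_of_nonneg_right ?_ hZ0
          exact pow_le_pow_left₀ (by positivity)
            (pow_le_pow_of_le_one hq0.le hq1.le (by omega)) _
      _ ≤ _ := by
          rw [← Finset.sum_mul]
          exact mul_le_mul_of_nonneg_right (geom_sum_le (by positivity) (by linarith) _) hZ0
  have s2 : ∑ j ∈ range x, ∑ σ : Cfg L with cnt (x - (j + 1)) σ = m, xi q m n x σ ^ 2
      ≤ q ^ (2 * m) / (1 - q ^ (2 * m)) * Z := by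
    calc _ ≤ ∑ j ∈ range x, (q ^ (2 * m)) ^ (j + 1) * Z := by
          refine Finset.sum_le_sum fun j hj => ?_
          rw [mem_range] at hj
          exact xi_mass_left hq0 hq1 hx (j + 1) (by omega)
      _ ≤ _ := by
          rw [← Finset.sum_mul]
          exact mul_le_mul_of_nonneg_right (geom_sum_le (by positivity) (by linarith) _) hZ0
  have s3 : q ^ (2 * m) / (1 - q ^ (2 * m)) ≤ q ^ (2 * m) / (1 - q ^ 2) :=
    div_le_div_of_nonneg_left (by positivity) (by linarith) (by linarith)
  have s4 := mul_le_mul_of_nonneg_right s3 hZ0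
  have : 2 / (1 - q ^ 2) * q ^ (2 * m) * Z = 2 * (q ^ (2 * m) / (1 - q ^ 2) * Z) := by ring
  rw [this]; linarith

/-! ### Intervals of down spins -/

/-- The `r` sites on either side of the cut at `x` exist and are all down. -/
def Full {L : ℕ} (r x : ℕ) (σ : Cfg L) : Prop :=
  r ≤ x ∧ x + r ≤ L ∧ ∀ i ∈ Finset.Ico (x - r) (x + r), dn σ i = 1

instance {L : ℕ} (r x : ℕ) (σ : Cfg L) : Decidable (Full r x σ) := by
  unfold Full; infer_instance

/-- The largest `r` such that the `r` sites on either side of the cut at `x` are down. -/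
def rad {L : ℕ} (x : ℕ) (σ : Cfg L) : ℕ := Nat.findGreatest (fun r => Full r x σ) L

/-- The largest value of `rad` at the cuts with exactly `m` down spins on their left. -/
def radMed {L : ℕ} (m : ℕ) (σ : Cfg L) : ℕ :=
  ((range (L + 1)).filter fun y => cnt y σ = m).sup fun y => rad y σ

/-- The largest value of `rad` at any cut. -/
def radMax {L : ℕ} (σ : Cfg L) : ℕ := (range (L + 1)).sup fun y => rad y σ

lemma Full.le_rad {L r x : ℕ} {σ : Cfg L} (h : Full r x σ) : r ≤ rad x σ := by
  obtain ⟨h1, h2, -⟩ := id h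
  exact Nat.le_findGreatest (by omega) h

lemma full_of_le_rad {L r x : ℕ} {σ : Cfg L} (h0 : 1 ≤ r) (h : r ≤ rad x σ) : Full r x σ := by
  have h' : Full (rad x σ) x σ :=
    Nat.findGreatest_of_ne_zero (P := fun r => Full r x σ) rfl (by omega)
  obtain ⟨h1, h2, h3⟩ := h'
  refine ⟨by omega, by omega, fun i hi' => h3 i ?_⟩
  rw [Finset.mem_Ico] at hi' ⊢
  omega

lemma dn_of_rad_pos {L x : ℕ} {σ : Cfg L} (h : 1 ≤ rad x σ) :
    1 ≤ x ∧ x < L ∧ dn σ (x - 1) = 1 ∧ dn σ x = 1 := by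
  obtain ⟨h1, h2, h3⟩ := full_of_le_rad le_rfl h
  exact ⟨h1, by omega, h3 _ (by rw [mem_Ico]; omega), h3 _ (by rw [mem_Ico]; omega)⟩

lemma eq_of_dn_eq {L : ℕ} {σ : Cfg L} {i j : Fin L} (h : dn σ i = dn σ j) : σ i = σ j := by
  rw [dn_val, dn_val] at h
  have key : ∀ a b : Fin 2, (if a = 1 then 1 else 0) = (if b = 1 then 1 else 0) → a = b := by
    decide
  exact key _ _ h

lemma dn_hop_of_ne {L : ℕ} (i : Fin (L - 1)) (σ : Cfg L) (j : ℕ) (h1 : j ≠ i)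
    (h2 : j ≠ i + 1) : dn (hop i σ) j = dn σ j := by
  by_cases h : j < L
  · have a := dn_val (hop i σ) ⟨j, h⟩
    have b := dn_val σ ⟨j, h⟩
    rw [hop_of_ne i σ ⟨j, h⟩ (fun e => h1 (congrArg Fin.val e))
      (fun e => h2 (congrArg Fin.val e))] at a
    exact a.trans b.symm
  · rw [dn_of_le _ (by omega), dn_of_le _ (by omega)]

lemma dn_hop_lo {L : ℕ} (i : Fin (L - 1)) (σ : Cfg L) : dn (hop i σ) i = dn σ (i + 1) := by
  have a := dn_val (hop i σ) (lo i)
  have b := dn_val σ (hi i)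
  rw [hop_lo] at a
  exact a.trans b.symm

lemma dn_hop_hi {L : ℕ} (i : Fin (L - 1)) (σ : Cfg L) : dn (hop i σ) (i + 1) = dn σ i := by
  have a := dn_val (hop i σ) (hi i)
  have b := dn_val σ (lo i)
  rw [hop_hi] at a
  exact a.trans b.symm

lemma full_hop {L r x : ℕ} {σ : Cfg L} (i : Fin (L - 1)) (h : Full (r + 1) x σ) :
    Full r x (hop i σ) := by
  obtain ⟨h1, h2, h3⟩ := h
  refine ⟨by omega, by omega, fun j hj => ?_⟩
  rw [mem_Ico] at hj
  by_cases e1 : j = i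
  · subst e1; rw [dn_hop_lo]; exact h3 _ (by rw [mem_Ico]; omega)
  by_cases e2 : j = i + 1
  · subst e2; rw [dn_hop_hi]; exact h3 _ (by rw [mem_Ico]; omega)
  rw [dn_hop_of_ne i σ j e1 e2]; exact h3 _ (by rw [mem_Ico]; omega)

lemma rad_hop {L : ℕ} (x : ℕ) (i : Fin (L - 1)) (σ : Cfg L) :
    rad x σ ≤ rad x (hop i σ) + 1 := by
  by_cases h : rad x σ = 0
  · omega
  have := full_of_le_rad (by omega) (le_refl (rad x σ))
  rw [show rad x σ = rad x σ - 1 + 1 by omega] at this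
  have := (full_hop i this).le_rad
  omega

/-- An exchange that moves a spin across the cut at `x` needs an up spin next to the cut. -/
lemma cnt_hop_of_rad {L : ℕ} {x : ℕ} (i : Fin (L - 1)) {σ : Cfg L} (h : 1 ≤ rad x σ) :
    cnt x (hop i σ) = cnt x σ := by
  by_cases hx : (i : ℕ) + 1 = x
  · obtain ⟨h1, h2, h3, h4⟩ := dn_of_rad_pos h
    have : σ (lo i) = σ (hi i) := by
      apply eq_of_dn_eq
      rw [lo_val, hi_val, hx, h4, show (i : ℕ) = x - 1 by omega, h3]
    rw [hop_eq_self this]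
  · exact cnt_hop x i hx σ

lemma radMed_hop {L : ℕ} (m : ℕ) (i : Fin (L - 1)) (σ : Cfg L) :
    radMed m σ ≤ radMed m (hop i σ) + 1 := by
  unfold radMed
  refine Finset.sup_le fun y hy => ?_
  rw [mem_filter] at hy
  by_cases h : rad y σ = 0
  · omega
  have h1 := rad_hop y i σ
  have h2 : rad y (hop i σ) ≤ _ := Finset.le_sup (f := fun y => rad y (hop i σ))
    (s := (range (L + 1)).filter fun y => cnt y (hop i σ) = m)
    (by rw [mem_filter, cnt_hop_of_rad i (by omega)]; exact hy)
  omega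

lemma radMax_hop {L : ℕ} (i : Fin (L - 1)) (σ : Cfg L) : radMax σ ≤ radMax (hop i σ) + 1 := by
  unfold radMax
  refine Finset.sup_le fun y hy => ?_
  have h1 := rad_hop y i σ
  have h2 : rad y (hop i σ) ≤ _ := Finset.le_sup (f := fun y => rad y (hop i σ)) hy
  omega

/-! ### The partition of unity -/

/-- Unnormalised weights. The index `some x` selects configurations with a long interval of down
spins around the cut at `x`; if the cut does not divide the down spins at `m`, the weight is
suppressed when there is such an interval around a cut that does. The index `none` selects
configurations without long intervals of down spins. Truncated subtraction is intended. -/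
def wgt {L : ℕ} (R m : ℕ) (o : Option (Fin (L + 1))) (σ : Cfg L) : ℕ :=
  match o with
  | none => 4 * R - radMax σ
  | some x => if cnt x σ = m then rad x σ - R else min (3 * R - radMed m σ) (rad x σ - R)

lemma rad_pos_of_wgt {L R m : ℕ} {x : Fin (L + 1)} {σ : Cfg L} (h : wgt R m (some x) σ ≠ 0) :
    R + 1 ≤ rad x σ := by
  unfold wgt at h
  simp only at h
  split_ifs at h <;> omega

/-- The weights change by at most one under an exchange. Where the weight is nonzero the exchange
does not move a spin across the cut, so that the case distinction in `wgt` does not interfere. -/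
lemma wgt_hop {L : ℕ} (R m : ℕ) (o : Option (Fin (L + 1))) (i : Fin (L - 1)) (σ : Cfg L) :
    wgt R m o σ ≤ wgt R m o (hop i σ) + 1 := by
  match o with
  | none =>
    have := radMax_hop i (hop i σ)
    rw [hop_hop] at this
    simp only [wgt]; omega
  | some x =>
    by_cases h : wgt R m (some x) σ = 0
    · omega
    have h1 := rad_pos_of_wgt h
    have h2 := cnt_hop_of_rad i (show 1 ≤ rad x σ by omega)
    have h3 := rad_hop x i σ
    have h4 := radMed_hop m i (hop i σ)
    rw [hop_hop] at h4
    simp only [wgt, h2]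
    split_ifs <;> omega

/-- The sum of the squares of the weights. -/
def wgtSq {L : ℕ} (R m : ℕ) (σ : Cfg L) : ℝ :=
  ∑ o : Option (Fin (L + 1)), (wgt R m o σ : ℝ) ^ 2

/-- Some weight is at least `R`: a window of half-length `2 R` at a cut dividing the down spins at
`m`, a window of this half-length at another cut, or the absence of both. -/
lemma wgtSq_ge {L R m : ℕ} (hR : 1 ≤ R) (σ : Cfg L) : (R : ℝ) ^ 2 ≤ wgtSq R m σ := by
  suffices h : ∃ o : Option (Fin (L + 1)), R ≤ wgt R m o σ by
    obtain ⟨o, ho⟩ := h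
    have : (R : ℝ) ^ 2 ≤ (wgt R m o σ : ℝ) ^ 2 := by
      have : (R : ℝ) ≤ wgt R m o σ := by exact_mod_cast ho
      exact pow_le_pow_left₀ (by positivity) this 2
    exact this.trans (Finset.single_le_sum (f := fun o => (wgt R m o σ : ℝ) ^ 2)
      (fun _ _ => sq_nonneg _) (Finset.mem_univ o))
  by_cases h1 : 2 * R ≤ radMed m σ
  · unfold radMed at h1
    rw [Finset.le_sup_iff (by simp; omega)] at h1
    obtain ⟨y, hy, hr⟩ := h1
    rw [mem_filter, mem_range] at hy
    refine ⟨some ⟨y, hy.1⟩, ?_⟩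
    simp only [wgt, hy.2, if_true]; omega
  by_cases h2 : 2 * R ≤ radMax σ
  · unfold radMax at h2
    rw [Finset.le_sup_iff (by simp; omega)] at h2
    obtain ⟨y, hy, hr⟩ := h2
    rw [mem_range] at hy
    refine ⟨some ⟨y, hy⟩, ?_⟩
    simp only [wgt]
    split_ifs <;> omega
  · exact ⟨none, by simp only [wgt]; omega⟩

lemma wgtSq_pos {L R m : ℕ} (hR : 1 ≤ R) (σ : Cfg L) : 0 < wgtSq R m σ := by
  have : (0 : ℝ) < (R : ℝ) ^ 2 := by positivity
  exact this.trans_le (wgtSq_ge hR σ)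

lemma sum_dn {L : ℕ} (σ : Cfg L) : ∑ x : Fin (L + 1), dn σ x = cnt L σ := by
  rw [Fin.sum_univ_eq_sum_range (fun x => dn σ x), ← cnt_eq_sum, cnt_succ_total]

/-- Only cuts with a down spin to their right have a nonzero weight. Each of the two configurations
has `cnt L σ` of them. -/
lemma wgt_gradient {L : ℕ} (R m : ℕ) (i : Fin (L - 1)) (σ : Cfg L) :
    ∑ o : Option (Fin (L + 1)), ((wgt R m o σ : ℝ) - wgt R m o (hop i σ)) ^ 2
      ≤ 2 * cnt L σ + 1 := by
  have h1 : ∀ o : Option (Fin (L + 1)), ((wgt R m o σ : ℝ) - wgt R m o (hop i σ)) ^ 2 ≤ 1 := by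
    intro o
    have a : (wgt R m o σ : ℝ) ≤ wgt R m o (hop i σ) + 1 := by exact_mod_cast wgt_hop R m o i σ
    have b : (wgt R m o (hop i σ) : ℝ) ≤ wgt R m o σ + 1 := by
      have := wgt_hop R m o i (hop i σ)
      rw [hop_hop] at this
      exact_mod_cast this
    nlinarith
  have h2 : ∀ x : Fin (L + 1), ((wgt R m (some x) σ : ℝ) - wgt R m (some x) (hop i σ)) ^ 2
      ≤ dn σ x + dn (hop i σ) x := by
    intro x
    by_cases ha : wgt R m (some x) σ = 0
    · by_cases hb : wgt R m (some x) (hop i σ) = 0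
      · rw [ha, hb]; simp; positivity
      · have := (dn_of_rad_pos (show 1 ≤ rad x (hop i σ) by
          have := rad_pos_of_wgt hb; omega)).2.2.2
        rw [this]
        have := h1 (some x)
        have : (0 : ℝ) ≤ dn σ x := by positivity
        push_cast; linarith
    · have := (dn_of_rad_pos (show 1 ≤ rad x σ by
          have := rad_pos_of_wgt ha; omega)).2.2.2
      rw [this]
      have := h1 (some x)
      have : (0 : ℝ) ≤ dn (hop i σ) x := by positivity
      push_cast; linarith
  rw [Fintype.sum_option]
  have h3 := Finset.sum_le_sum fun x (_ : x ∈ (Finset.univ : Finset (Fin (L + 1)))) => h2 x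
  rw [Finset.sum_add_distrib, ← Nat.cast_sum, ← Nat.cast_sum, sum_dn, sum_dn, cnt_hop_total] at h3
  linarith [h1 none]

/-- The partition of unity on the configurations with `n` down spins. -/
def chi {L : ℕ} (R m n : ℕ) (o : Option (Fin (L + 1))) (σ : Cfg L) : ℝ :=
  if cnt L σ = n then wgt R m o σ / √(wgtSq R m σ) else 0

lemma chi_nonneg {L : ℕ} (R m n : ℕ) (o : Option (Fin (L + 1))) (σ : Cfg L) :
    0 ≤ chi R m n o σ := by
  unfold chi; split_ifs <;> positivity

lemma sum_chi_sq {L R m n : ℕ} (hR : 1 ≤ R) {σ : Cfg L} (h : cnt L σ = n) :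
    ∑ o, chi R m n o σ ^ 2 = 1 := by
  have hp := wgtSq_pos (m := m) hR σ
  simp only [chi, h, if_true, div_pow, Real.sq_sqrt hp.le]
  rw [← Finset.sum_div]
  exact div_self hp.ne'

lemma chi_le_one {L R m n : ℕ} (hR : 1 ≤ R) (o : Option (Fin (L + 1))) (σ : Cfg L) :
    chi R m n o σ ≤ 1 := by
  by_cases h : cnt L σ = n
  · have h1 := sum_chi_sq (R := R) (m := m) hR h
    have h2 : chi R m n o σ ^ 2 ≤ _ := Finset.single_le_sum (f := fun o => chi R m n o σ ^ 2)
      (fun _ _ => sq_nonneg _) (Finset.mem_univ o)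
    rw [h1] at h2
    nlinarith [chi_nonneg R m n o σ]
  · simp [chi, h]

/-- The overlap of the partition of unity at neighbouring configurations is almost one. Normalising
the weights does not increase their gradient: for positive `s`, `t` and vectors of these lengths,
`2 (s t - ⟨u, v⟩) = |u - v|² - (s - t)²`. -/
lemma one_sub_overlap_le {L R m n : ℕ} (hR : 1 ≤ R) (i : Fin (L - 1)) {σ : Cfg L}
    (h : cnt L σ = n) :
    1 - ∑ o, chi R m n o σ * chi R m n o (hop i σ) ≤ (2 * n + 1) / R ^ 2 / 2 := by
  have hh : cnt L (hop i σ) = n := (cnt_hop_total i σ).trans h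
  have hp := wgtSq_pos (m := m) hR σ
  have hp' := wgtSq_pos (m := m) hR (hop i σ)
  have hg := wgt_gradient R m i σ
  rw [h] at hg
  set s := √(wgtSq R m σ) with hs
  set t := √(wgtSq R m (hop i σ)) with ht
  have hs0 : 0 < s := Real.sqrt_pos.2 hp
  have ht0 : 0 < t := Real.sqrt_pos.2 hp'
  have hss : s ^ 2 = wgtSq R m σ := Real.sq_sqrt hp.le
  have htt : t ^ 2 = wgtSq R m (hop i σ) := Real.sq_sqrt hp'.le
  have hR0 : (0 : ℝ) < R := by exact_mod_cast hR
  have hsR : (R : ℝ) ≤ s := Real.le_sqrt_of_sq_le (wgtSq_ge hR σ)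
  have htR : (R : ℝ) ≤ t := Real.le_sqrt_of_sq_le (wgtSq_ge hR (hop i σ))
  set I := ∑ o : Option (Fin (L + 1)), (wgt R m o σ : ℝ) * wgt R m o (hop i σ) with hI
  have e1 : ∑ o, chi R m n o σ * chi R m n o (hop i σ) = I / (s * t) := by
    rw [hI, Finset.sum_div]
    refine Finset.sum_congr rfl fun o _ => ?_
    simp only [chi, h, hh, if_true]
    rw [div_mul_div_comm]
  have e2 : ∑ o : Option (Fin (L + 1)), ((wgt R m o σ : ℝ) - wgt R m o (hop i σ)) ^ 2
      = s ^ 2 + t ^ 2 - 2 * I := by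
    rw [hss, htt, wgtSq, wgtSq, hI, Finset.mul_sum, ← Finset.sum_add_distrib,
      ← Finset.sum_sub_distrib]
    exact Finset.sum_congr rfl fun o _ => by ring
  rw [e2] at hg
  have hst : (R : ℝ) ^ 2 ≤ s * t := by rw [sq]; exact mul_le_mul hsR htR hR0.le hs0.le
  have e3 : 1 - I / (s * t) = (2 * (s * t) - 2 * I) / (s * t) / 2 := by
    field_simp
  rw [e1, e3]
  refine div_le_div_of_nonneg_right ?_ (by norm_num)
  calc _ ≤ (2 * (n : ℝ) + 1) / (s * t) := by
        refine div_le_div_of_nonneg_right ?_ (by positivity)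
        nlinarith [sq_nonneg (s - t)]
    _ ≤ _ := div_le_div_of_nonneg_left (by positivity) (by positivity) hst

lemma sum_chi_sub_sq {L R m n : ℕ} (hR : 1 ≤ R) (i : Fin (L - 1)) {σ : Cfg L}
    (h : cnt L σ = n) :
    ∑ o, (chi R m n o σ - chi R m n o (hop i σ)) ^ 2
      = 2 * (1 - ∑ o, chi R m n o σ * chi R m n o (hop i σ)) := by
  have h1 := sum_chi_sq (R := R) (m := m) hR h
  have h2 := sum_chi_sq (R := R) (m := m) hR ((cnt_hop_total i σ).trans h)
  have : ∑ o, (chi R m n o σ - chi R m n o (hop i σ)) ^ 2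
      = ∑ o, chi R m n o σ ^ 2 + ∑ o, chi R m n o (hop i σ) ^ 2
        - 2 * ∑ o, chi R m n o σ * chi R m n o (hop i σ) := by
    rw [Finset.mul_sum, ← Finset.sum_add_distrib, ← Finset.sum_sub_distrib]
    exact Finset.sum_congr rfl fun o _ => by ring
  rw [this, h1, h2]; ring

lemma chi_hop {L R m n : ℕ} (hR : 1 ≤ R) (o : Option (Fin (L + 1))) (i : Fin (L - 1))
    (σ : Cfg L) : (chi R m n o σ - chi R m n o (hop i σ)) ^ 2 ≤ (2 * n + 1) / R ^ 2 := by
  by_cases h : cnt L σ = n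
  · have h1 := sum_chi_sub_sq (R := R) (m := m) hR i h
    have h2 := one_sub_overlap_le (m := m) hR i h
    have h3 : (chi R m n o σ - chi R m n o (hop i σ)) ^ 2 ≤ _ :=
      Finset.single_le_sum (f := fun o => (chi R m n o σ - chi R m n o (hop i σ)) ^ 2)
        (fun _ _ => sq_nonneg _) (Finset.mem_univ o)
    linarith
  · have h' : ¬ cnt L (hop i σ) = n := by rw [cnt_hop_total]; exact h
    rw [chi, chi, if_neg h, if_neg h', sub_self, sq, mul_zero]
    positivity

/-! ### Configurations without a long interval of down spins have many walls -/

/-- Without a long interval of down spins, there is an up spin within distance `8 R` to the right of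
each down spin. An up spin beyond the end of the chain counts. -/
lemma exists_run_end {L R : ℕ} {σ : Cfg L} (h : radMax σ < 4 * R) {p : ℕ}
    (hp : p < L) (hd : dn σ p = 1) :
    ∃ e, p ≤ e ∧ e < p + 8 * R ∧ e < L ∧ dn σ e = 1 ∧ dn σ (e + 1) = 0 := by
  have hex : ∃ j, p < j ∧ j < p + 8 * R + 1 ∧ dn σ j = 0 := by
    by_cases hL : L < p + 8 * R
    · exact ⟨L, hp, by omega, dn_of_le σ le_rfl⟩
    by_contra! hcon
    have hf : Full (4 * R) (p + 4 * R) σ := by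
      refine ⟨by omega, by omega, fun i hi' => ?_⟩
      rw [mem_Ico] at hi'
      by_cases hip : i = p
      · rw [hip]; exact hd
      · have := hcon i (by omega) (by omega)
        have := dn_le_one σ i
        omega
    have h1 : rad (p + 4 * R) σ ≤ radMax σ := Finset.le_sup (f := fun y => rad y σ)
      (by rw [mem_range]; omega)
    have := hf.le_rad
    omega
  classical
  obtain ⟨h1, h2, h3⟩ := Nat.find_spec hex
  set j := Nat.find hex with hj
  refine ⟨j - 1, by omega, by omega, ?_, ?_, by rwa [Nat.sub_add_cancel (by omega)]⟩
  all_goals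
    have hd1 : dn σ (j - 1) = 1 := by
      by_cases hip : j - 1 = p
      · rw [hip]; exact hd
      · have := Nat.find_min hex (m := j - 1) (by omega)
        have := dn_le_one σ (j - 1)
        have : ¬ dn σ (j - 1) = 0 := fun h0 => by
          apply Nat.find_min hex (m := j - 1) (by omega)
          exact ⟨by omega, by omega, h0⟩
        omega
  · by_contra hcon
    rw [dn_of_le σ (by omega)] at hd1
    omega
  · exact hd1

/-- Each down spin is within `8 R` sites of the end of its run, and the runs end at walls or at the
end of the chain. -/
lemma cnt_le_walls {L R : ℕ} {σ : Cfg L} (h : radMax σ < 4 * R) :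
    (cnt L σ : ℝ) ≤ 8 * R * (walls σ + 1) := by
  set E := (range L).filter fun e => dn σ e = 1 ∧ dn σ (e + 1) = 0 with hE
  have h1 : cnt L σ ≤ E.card * (8 * R) := by
    have e1 : cnt L σ = ((range L).filter fun p => dn σ p = 1).card := by
      rw [cnt_eq_sum, Finset.card_filter]
      refine Finset.sum_congr rfl fun j _ => ?_
      have := dn_le_one σ j
      split_ifs <;> omega
    rw [e1]
    have hsub : ((range L).filter fun p => dn σ p = 1)
        ⊆ E.biUnion fun e => Finset.Ico (e + 1 - 8 * R) (e + 1) := by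
      intro p hp
      rw [mem_filter, mem_range] at hp
      obtain ⟨e, a1, a2, a3, a4, a5⟩ := exists_run_end h hp.1 hp.2
      rw [mem_biUnion]
      exact ⟨e, by simp [hE, a3, a4, a5], by rw [mem_Ico]; omega⟩
    refine (Finset.card_le_card hsub).trans ?_
    refine Finset.card_biUnion_le_card_mul _ _ _ fun e _ => ?_
    rw [Nat.card_Ico]; omega
  have h2 : (E.card : ℝ) ≤ walls σ + 1 := by
    have e2 : walls σ = ((Finset.univ.filter fun i : Fin (L - 1) =>
        σ (lo i) ≠ σ (hi i)).card : ℝ) := by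
      unfold walls; rw [Finset.card_filter]; push_cast; rfl
    have hsub : E ⊆ insert (L - 1) ((Finset.univ.filter fun i : Fin (L - 1) =>
        σ (lo i) ≠ σ (hi i)).image (fun i : Fin (L - 1) => (i : ℕ))) := by
      intro e he
      rw [hE, mem_filter, mem_range] at he
      rw [mem_insert, mem_image]
      by_cases hl : e = L - 1
      · left; exact hl
      · right
        refine ⟨⟨e, by omega⟩, ?_, rfl⟩
        simp only [mem_filter, mem_univ, true_and]
        intro heq
        have a := dn_val σ (lo ⟨e, by omega⟩)
        have b := dn_val σ (hi ⟨e, by omega⟩)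
        rw [lo_val] at a
        rw [hi_val] at b
        rw [heq, ← b] at a
        simp only at a
        omega
    have := (Finset.card_le_card hsub).trans ((Finset.card_insert_le _ _).trans
      (Nat.add_le_add_right Finset.card_image_le 1))
    rw [e2]
    exact_mod_cast this
  have h3 : (cnt L σ : ℝ) ≤ E.card * (8 * R) := by exact_mod_cast h1
  calc _ ≤ _ := h3
    _ ≤ (walls σ + 1) * (8 * R) := mul_le_mul_of_nonneg_right h2 (by positivity)
    _ = _ := by ring

/-! ### Holes far from the ends of the droplet -/

/-- If the down spins have no hole with at least `R` of them behind it, seen from the cut at `x`,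
then the middle of the down spins lies in a long interval of down spins. -/
lemma exists_hole {L R m n x : ℕ} (hm1 : 4 * R ≤ m) (hm2 : m + 4 * R ≤ n)
    (hx : x ≤ L) {σ : Cfg L} (hn : cnt L σ = n) (hk1 : R ≤ cnt x σ) (hk2 : cnt x σ + R ≤ n)
    (hr : radMed m σ < 3 * R) :
    (∃ j < n, x + j < L ∧ dn σ (x + j) = 0 ∧ cnt (x + j) σ + R ≤ n) ∨
      (∃ j < n, j < x ∧ dn σ (x - 1 - j) = 0 ∧ R ≤ cnt (x - 1 - j) σ) := by
  by_contra! hcon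
  obtain ⟨hcr, hcl⟩ := hcon
  set k := cnt x σ with hk
  -- Without such holes, all sites from the cut up to the last `R` down spins on either side are
  -- down.
  have right : ∀ s, k + R + s ≤ n → x + s ≤ L ∧ cnt (x + s) σ = k + s := by
    intro s
    induction s with
    | zero => intro _; exact ⟨hx, rfl⟩
    | succ s ih =>
      intro hs
      obtain ⟨i1, i2⟩ := ih (by omega)
      have hlt : x + s < L := by
        rcases Nat.lt_or_ge (x + s) L with h | h
        · exact h
        · have : x + s = L := by omega
          rw [this, hn] at i2; omega
      have hd : dn σ (x + s) = 1 := by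
        have := dn_le_one σ (x + s)
        by_contra h
        have := hcr s (by omega) hlt (by omega)
        omega
      exact ⟨hlt, by rw [← add_assoc, cnt_succ, i2, hd]; omega⟩
  have left : ∀ s, s + R ≤ k → s ≤ x ∧ cnt (x - s) σ = k - s := by
    intro s
    induction s with
    | zero => intro _; exact ⟨by omega, rfl⟩
    | succ s ih =>
      intro hs
      obtain ⟨i1, i2⟩ := ih (by omega)
      have hlt : s < x := by
        rcases Nat.lt_or_ge s x with h | h
        · exact h
        · have : x - s = 0 := by omega
          rw [this, cnt_zero] at i2; omega
      have hc := cnt_succ (x - 1 - s) σ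
      rw [show x - 1 - s + 1 = x - s by omega, i2] at hc
      have hkn : k ≤ n := by rw [hk, ← hn]; exact cnt_le_total x σ
      have hd : dn σ (x - 1 - s) = 1 := by
        have := dn_le_one σ (x - 1 - s)
        by_contra h
        have := hcl s (by omega) hlt (by omega)
        omega
      refine ⟨hlt, ?_⟩
      rw [show x - (s + 1) = x - 1 - s by omega]; omega
  -- The cut that divides the down spins at `m` then lies in a window of half-length `3 R`.
  have hsr := right (m + 3 * R - k) (by omega)
  have hsl := left (k + 3 * R - m) (by omega)
  have hcm : cnt (x + m - k) σ = m := by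
    rcases Nat.le_total k m with h | h
    · have := (right (m - k) (by omega)).2
      rw [show x + m - k = x + (m - k) by omega, this]; omega
    · have := left (k - m) (by omega)
      rw [show x + m - k = x - (k - m) by omega, this.2]; omega
  have hf : Full (3 * R) (x + m - k) σ := by
    refine ⟨by omega, by omega, fun i hi' => ?_⟩
    rw [mem_Ico] at hi'
    rcases Nat.lt_or_ge i x with h | h
    · have a := (left (x - i) (by omega)).2
      have b := (left (x - i - 1) (by omega)).2
      have c := cnt_succ i σ
      rw [show x - (x - i) = i by omega] at a
      rw [show x - (x - i - 1) = i + 1 by omega] at b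
      omega
    · have a := (right (i - x) (by omega)).2
      have b := (right (i - x + 1) (by omega)).2
      have c := cnt_succ i σ
      rw [show x + (i - x) = i by omega] at a
      rw [show x + (i - x + 1) = i + 1 by omega] at b
      omega
  have h1 : rad (x + m - k) σ ≤ radMed m σ := by
    unfold radMed
    refine Finset.le_sup (f := fun y => rad y σ) ?_
    rw [mem_filter, mem_range]
    exact ⟨by have := hf.2.1; omega, hcm⟩
  have := hf.le_rad
  omega

lemma cnt_of_full {L r x : ℕ} {σ : Cfg L} (h : Full r x σ) :
    r ≤ cnt x σ ∧ cnt x σ + r ≤ cnt L σ := by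
  obtain ⟨h1, h2, h3⟩ := h
  have a : ∀ s ≤ r, s ≤ cnt x σ - cnt (x - s) σ := by
    intro s hs
    induction s with
    | zero => omega
    | succ s ih =>
      have c := cnt_succ (x - (s + 1)) σ
      rw [show x - (s + 1) + 1 = x - s by omega, h3 _ (by rw [mem_Ico]; omega)] at c
      have := ih (by omega)
      have := cnt_mono (show x - s ≤ x by omega) σ
      omega
  have b : ∀ s ≤ r, cnt (x + s) σ = cnt x σ + s := by
    intro s hs
    induction s with
    | zero => rfl
    | succ s ih =>
      rw [← add_assoc, cnt_succ, ih (by omega), h3 _ (by rw [mem_Ico]; omega)]; omega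
  have := a r le_rfl
  have := b r le_rfl
  have := cnt_le_total (x + r) σ
  omega

/-! ### Localising the energy -/

/-- The energy of `f` is, up to the gradient of the partition of unity, the sum of the energies of
its localised pieces. -/
lemma ims_localisation {L n : ℕ} {q : ℝ} (hq : 0 < q) {ι : Type*} [Fintype ι]
    (χ : ι → Cfg L → ℝ) {η : ℝ} (hη : 0 ≤ η)
    (h1 : ∀ σ, cnt L σ = n → ∑ o, χ o σ ^ 2 = 1)
    (h2 : ∀ (i : Fin (L - 1)) (σ : Cfg L), cnt L σ = n →
      0 ≤ 1 - ∑ o, χ o σ * χ o (hop i σ) ∧ 1 - ∑ o, χ o σ * χ o (hop i σ) ≤ η)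
    (f : Cfg L → ℝ) (hf : ∀ σ, cnt L σ ≠ n → f σ = 0) :
    ∑ o, ∑ σ, (χ o σ * f σ) * hamR q (fun τ => χ o τ * f τ) σ
      ≤ ∑ σ, f σ * hamR q f σ + cpl q * η * ∑ σ, walls σ * f σ ^ 2 := by
  have hc := cpl_pos hq
  -- The diagonal terms are not changed, as the squares of the cutoffs sum to `1`; the exchange
  -- terms change by the defect of the overlap.
  have pt : ∀ σ, ∑ o, (χ o σ * f σ) * hamR q (fun τ => χ o τ * f τ) σ
      = f σ * hamR q f σ + cpl q * ∑ i : Fin (L - 1), (if σ (lo i) ≠ σ (hi i) then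
        f σ * f (hop i σ) * (1 - ∑ o, χ o σ * χ o (hop i σ)) else 0) := by
    intro σ
    by_cases hσ : cnt L σ = n
    swap
    · simp [hf σ hσ]
    have e1 : ∀ i : Fin (L - 1), ∑ o, (χ o σ * f σ) * pairR q i (fun τ => χ o τ * f τ) σ
        = f σ * pairR q i f σ + cpl q * (if σ (lo i) ≠ σ (hi i) then
        f σ * f (hop i σ) * (1 - ∑ o, χ o σ * χ o (hop i σ)) else 0) := by
      intro i
      unfold pairR
      split_ifs
      · have : ∀ o, χ o σ * f σ * (χ o σ * f σ / 2 - cpl q * (χ o (hop i σ) * f (hop i σ)))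
            = f σ ^ 2 / 2 * χ o σ ^ 2
              - cpl q * f σ * f (hop i σ) * (χ o σ * χ o (hop i σ)) := fun o => by ring
        simp only [this]
        rw [Finset.sum_sub_distrib, ← Finset.mul_sum, ← Finset.mul_sum, h1 σ hσ]
        ring
      · simp
    have e2 : ∀ o, (χ o σ * f σ) * hamR q (fun τ => χ o τ * f τ) σ
        = ∑ i : Fin (L - 1), (χ o σ * f σ) * pairR q i (fun τ => χ o τ * f τ) σ
          - fld q * (sp σ 0 + sp σ (L - 1)) * f σ ^ 2 * χ o σ ^ 2 := by
      intro o
      unfold hamR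
      rw [← Finset.mul_sum]; ring
    simp only [e2]
    rw [Finset.sum_sub_distrib, ← Finset.mul_sum, h1 σ hσ, Finset.sum_comm]
    simp only [e1]
    unfold hamR
    rw [Finset.sum_add_distrib, ← Finset.mul_sum, ← Finset.mul_sum]
    ring
  rw [Finset.sum_comm]
  simp only [pt]
  rw [Finset.sum_add_distrib, ← Finset.mul_sum]
  have key : ∑ σ, ∑ i : Fin (L - 1), (if σ (lo i) ≠ σ (hi i) then
        f σ * f (hop i σ) * (1 - ∑ o, χ o σ * χ o (hop i σ)) else 0)
      ≤ η * ∑ σ, walls σ * f σ ^ 2 := by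
    calc _ ≤ ∑ σ : Cfg L, ∑ i : Fin (L - 1),
          (η / 2 * (if σ (lo i) ≠ σ (hi i) then f σ ^ 2 else 0)
            + η / 2 * (if σ (lo i) ≠ σ (hi i) then f (hop i σ) ^ 2 else 0)) := by
          refine Finset.sum_le_sum fun σ _ => Finset.sum_le_sum fun i _ => ?_
          split_ifs
          · by_cases hσ : cnt L σ = n
            · obtain ⟨a, b⟩ := h2 i σ hσ
              have : f σ * f (hop i σ) ≤ (f σ ^ 2 + f (hop i σ) ^ 2) / 2 := by
                nlinarith [sq_nonneg (f σ - f (hop i σ))]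
              have := (mul_le_mul_of_nonneg_right this a).trans
                (mul_le_mul_of_nonneg_left b (by positivity))
              linarith
            · rw [hf σ hσ]
              have : 0 ≤ η / 2 * f (hop i σ) ^ 2 := by positivity
              simp only [zero_mul]
              nlinarith
          · simp
      _ = _ := by
          rw [Finset.sum_comm]
          simp only [Finset.sum_add_distrib, ← Finset.mul_sum,
            sum_wall_hop _ (fun σ => f σ ^ 2)]
          rw [sum_mul_walls (fun σ => f σ ^ 2)]; ring
  have := mul_le_mul_of_nonneg_left key hc.le
  linarith

/-! ### The piece of the kernel element seen by a localised state -/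

/-- Configurations selected by the partition of unity at a cut that does not divide the down spins
at `m` carry little of the mass of a kernel element. -/
lemma kernel_mass_off {L R m n : ℕ} {q : ℝ} (hq0 : 0 < q) (hq1 : q < 1) (hm1 : 4 * R ≤ m)
    (hm2 : m + 4 * R ≤ n) (x : Fin (L + 1)) {e : Cfg L → ℝ} (he : ∀ σ, cutOp q x e σ = 0) :
    ∑ σ with (cnt x σ ≠ m ∧ cnt L σ = n ∧ wgt R m (some x) σ ≠ 0), e σ ^ 2
      ≤ 2 * n * q ^ (2 * R) * ∑ σ, e σ ^ 2 := by
  set E := ∑ σ, e σ ^ 2 with hE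
  have hE0 : 0 ≤ E := Finset.sum_nonneg fun _ _ => sq_nonneg _
  have hxL : (x : ℕ) ≤ L := by omega
  have right : ∀ j : ℕ, ∑ σ with (x + j < L ∧ dn σ (x + j) = 0 ∧ cnt (x + j) σ + R ≤ n ∧
      cnt L σ = n), e σ ^ 2 ≤ q ^ (2 * R) * E := by
    intro j
    by_cases hj : (x : ℕ) + j < L
    · have := kernel_mass_right hq0 hq1 (x := x) (y := x + j) (r := R) (by omega) hj he
        (fun σ => x + j < L ∧ dn σ (x + j) = 0 ∧ cnt (x + j) σ + R ≤ n ∧ cnt L σ = n)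
        (fun _ => True) (by rintro σ ⟨-, a, b, c⟩; exact ⟨a, by omega, trivial⟩)
      simpa using this
    · rw [Finset.sum_eq_zero]
      · positivity
      · intro σ hσ
        rw [mem_filter] at hσ
        exact (hj hσ.2.1).elim
  have left : ∀ j : ℕ, ∑ σ with (j < (x : ℕ) ∧ dn σ (x - 1 - j) = 0 ∧ R ≤ cnt (x - 1 - j) σ),
      e σ ^ 2 ≤ q ^ (2 * R) * E := by
    intro j
    by_cases hj : j < (x : ℕ)
    · have := kernel_mass_left hq0 hq1 (x := x) (y := x - 1 - j) (r := R) (by omega) (by omega) he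
        (fun σ => j < (x : ℕ) ∧ dn σ (x - 1 - j) = 0 ∧ R ≤ cnt (x - 1 - j) σ)
        (fun _ => True) (by rintro σ ⟨-, a, b⟩; exact ⟨a, b, trivial⟩)
      simpa using this
    · rw [Finset.sum_eq_zero]
      · positivity
      · intro σ hσ
        rw [mem_filter] at hσ
        exact (hj hσ.2.1).elim
  calc _ ≤ ∑ j ∈ range n, ∑ σ with (x + j < L ∧ dn σ (x + j) = 0 ∧ cnt (x + j) σ + R ≤ n ∧
          cnt L σ = n), e σ ^ 2
        + ∑ j ∈ range n, ∑ σ with (j < (x : ℕ) ∧ dn σ (x - 1 - j) = 0 ∧ R ≤ cnt (x - 1 - j) σ),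
          e σ ^ 2 := by
        simp only [Finset.sum_filter]
        rw [Finset.sum_comm (s := range n), Finset.sum_comm (s := range n),
          ← Finset.sum_add_distrib]
        refine Finset.sum_le_sum fun σ _ => ?_
        have n1 : ∀ p : ℕ → Prop, ∀ [DecidablePred p], ∀ j ∈ range n,
            0 ≤ if p j then e σ ^ 2 else 0 := by
          intro p _ j _; split_ifs <;> positivity
        split_ifs with h
        · obtain ⟨h1, h2, h3⟩ := h
          have hrad := rad_pos_of_wgt h3
          have hf := cnt_of_full (full_of_le_rad (by omega) hrad)
          have hrm : radMed m σ < 3 * R := by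
            simp only [wgt, h1, if_false] at h3; omega
          rcases exists_hole hm1 hm2 hxL h2 (by omega) (by omega) hrm with
            ⟨j, j1, j2, j3, j4⟩ | ⟨j, j1, j2, j3, j4⟩
          · have := Finset.single_le_sum (n1 fun j => x + j < L ∧ dn σ (x + j) = 0 ∧
              cnt (x + j) σ + R ≤ n ∧ cnt L σ = n) (mem_range.2 j1)
            simp only [j2, j3, j4, h2, and_self, if_true] at this
            have := Finset.sum_nonneg (n1 fun j => j < (x : ℕ) ∧ dn σ (x - 1 - j) = 0 ∧
              R ≤ cnt (x - 1 - j) σ)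
            simp only [h2, and_true] at *
            linarith
          · have := Finset.single_le_sum (n1 fun j => j < (x : ℕ) ∧ dn σ (x - 1 - j) = 0 ∧
              R ≤ cnt (x - 1 - j) σ) (mem_range.2 j1)
            simp only [j2, j3, j4, and_self, if_true] at this
            have := Finset.sum_nonneg (n1 fun j => x + j < L ∧ dn σ (x + j) = 0 ∧
              cnt (x + j) σ + R ≤ n ∧ cnt L σ = n)
            linarith
        · exact add_nonneg (Finset.sum_nonneg (n1 _)) (Finset.sum_nonneg (n1 _))
    _ ≤ ∑ _j ∈ range n, q ^ (2 * R) * E + ∑ _j ∈ range n, q ^ (2 * R) * E :=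
        add_le_add (Finset.sum_le_sum fun j _ => right j) (Finset.sum_le_sum fun j _ => left j)
    _ = _ := by rw [Finset.sum_const, card_range, nsmul_eq_mul]; ring

/-- The relative error caused by localisation and by the width of the ends of the droplet. -/
def locErr (q : ℝ) (R m n : ℕ) : ℝ :=
  (2 * n + 1) / R ^ 2 / 2 / (1 - 2 * cpl q) ^ 2 + 2 / (1 - q ^ 2) * q ^ (2 * m)

lemma le_two_mul_of_sq_le {E Y Y' a b : ℝ} (hE : 0 ≤ E) (hab : 0 ≤ a + b) (hY : E = Y + Y')
    (h : Y ^ 2 ≤ E * a) (h' : Y' ^ 2 ≤ E * b) : E ≤ 2 * (a + b) := by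
  rcases hE.eq_or_lt with hz | hpos
  · rw [← hz]; linarith
  · refine le_of_mul_le_mul_left ?_ hpos
    have : E * E = (Y + Y') ^ 2 := by rw [← hY]; ring
    rw [this]
    nlinarith [sq_nonneg (Y - Y')]

lemma locErr_nonneg {q : ℝ} (hq0 : 0 < q) (hq1 : q < 1) (R m n : ℕ) : 0 ≤ locErr q R m n := by
  have : 0 < 1 - q ^ 2 := by nlinarith
  have := gap_pos hq0 hq1
  unfold locErr; positivity

/-- On the configurations with `m` down spins to the left of the cut, orthogonality to the droplet
state allows to subtract a constant from the cutoff function. -/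
lemma overlap_on {L R m n : ℕ} {q : ℝ} (hq0 : 0 < q) (hq1 : q < 1) (hR : 1 ≤ R)
    (hm1 : 1 ≤ m) (hm3 : 2 * m ≤ n) (x : Fin (L + 1))
    (hx : 1 ≤ (x : ℕ)) (hxL : (x : ℕ) < L) (f : Cfg L → ℝ)
    (hf : ∀ σ, cnt L σ ≠ n → f σ = 0) (hxi : ∑ σ, xi q m n x σ * f σ = 0) {e : Cfg L → ℝ}
    (he : ∀ σ, cutOp q x e σ = 0) :
    (∑ σ, if cnt x σ = m then e σ * (chi R m n (some x) σ * f σ) else 0) ^ 2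
      ≤ (∑ σ, e σ ^ 2) * (locErr q R m n
        * ∑ σ, (if cnt x σ = m then f σ ^ 2 / mult m σ else 0)) := by
  have hγ := gap_pos hq0 hq1
  set χ := chi R m n (some x) with hχ
  have hχ0 := chi_nonneg R m n (some x)
  have hχ1 := chi_le_one (m := m) (n := n) hR (some x)
  set F := ∑ σ : Cfg L, (if cnt x σ = m then f σ ^ 2 / mult m σ else 0) with hF
  set E := ∑ σ, e σ ^ 2 with hE
  have hF0 : 0 ≤ F := Finset.sum_nonneg fun σ _ => by split_ifs <;> positivity
  set Y1 := ∑ σ, (if cnt x σ = m then e σ * (χ σ * f σ) else 0) with hY1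
  obtain ⟨μ, hμ⟩ := kernel_eq_xi hq0 he m n
  obtain ⟨c, hc0, hc1, hP⟩ := xi_poincare hq0 hq1 hx hxL m n χ hχ0 hχ1
    (chi_hop hR (some x))
  set Z := ∑ σ : Cfg L, xi q m n x σ ^ 2 with hZ
  have hZ0 : 0 ≤ Z := Finset.sum_nonneg fun _ _ => sq_nonneg _
  have e1 : Y1 = μ * ∑ σ, xi q m n x σ * (χ σ - c) * f σ := by
    have : ∑ σ, xi q m n x σ * (χ σ - c) * f σ = ∑ σ, xi q m n x σ * (χ σ * f σ) := by
      have : ∀ σ, xi q m n x σ * (χ σ - c) * f σ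
          = xi q m n x σ * (χ σ * f σ) - c * (xi q m n x σ * f σ) := fun σ => by ring
      simp only [this]
      rw [Finset.sum_sub_distrib, ← Finset.mul_sum, hxi, mul_zero, sub_zero]
    rw [this, hY1, Finset.mul_sum]
    refine Finset.sum_congr rfl fun σ _ => ?_
    by_cases hn : cnt L σ = n
    · split_ifs with h
      · rw [hμ σ h hn]; ring
      · rw [xi_eq_zero (fun h' => h h'.1)]; ring
    · rw [hf σ hn]; simp
  -- Cauchy–Schwarz with the weight `mult`, so that the sum over all cuts of `f ^ 2 / mult` is
  -- bounded by the norm of `f`.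
  have e2 : (∑ σ, xi q m n x σ * (χ σ - c) * f σ) ^ 2
      ≤ (∑ σ, xi q m n x σ ^ 2 * (χ σ - c) ^ 2 * mult m σ) * F := by
    refine Finset.sum_sq_le_sum_mul_sum_of_sq_le_mul _ (fun σ _ => by positivity)
      (fun σ _ => by split_ifs <;> positivity) (fun σ _ => le_of_eq ?_)
    split_ifs with h
    · have h1 : (1 : ℝ) ≤ mult m σ := by exact_mod_cast mult_pos (by omega) h
      field_simp
    · rw [xi_eq_zero (fun h' => h h'.1)]; ring
  have e3 : ∑ σ : Cfg L, xi q m n x σ ^ 2 * (χ σ - c) ^ 2 * mult m σ ≤ locErr q R m n * Z := by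
    have a1 : ∑ σ, xi q m n x σ ^ 2 * (χ σ - c) ^ 2 * mult m σ
        ≤ ∑ σ, xi q m n x σ ^ 2 * (χ σ - c) ^ 2
          + ∑ σ : Cfg L, ((mult m σ : ℝ) - 1) * xi q m n x σ ^ 2 := by
      rw [← Finset.sum_add_distrib]
      refine Finset.sum_le_sum fun σ _ => ?_
      by_cases h : cnt x σ = m ∧ cnt L σ = n
      · have h1 : (1 : ℝ) ≤ mult m σ := by exact_mod_cast mult_pos (by omega) h.1
        have h2 : (χ σ - c) ^ 2 ≤ 1 := by nlinarith [hχ0 σ, hχ1 σ]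
        nlinarith [mul_le_mul_of_nonneg_left h2 (mul_nonneg (sub_nonneg.2 h1)
          (sq_nonneg (xi q m n x σ)))]
      · rw [xi_eq_zero h]; simp
    have a2 : ∑ σ, xi q m n x σ ^ 2 * (χ σ - c) ^ 2
        ≤ (2 * n + 1) / R ^ 2 / 2 / (1 - 2 * cpl q) ^ 2 * Z := by
      rw [div_mul_eq_mul_div, le_div_iff₀ (by positivity)]
      linarith
    have a3 := xi_mult hq0 hq1 (L := L) (m := m) (n := n) (x := x) (by omega) hm3 hxL.le
    unfold locErr
    rw [add_mul]; linarith
  have e4 : μ ^ 2 * Z ≤ E := by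
    rw [hZ, Finset.mul_sum]
    refine Finset.sum_le_sum fun σ _ => ?_
    by_cases h : cnt x σ = m ∧ cnt L σ = n
    · rw [hμ σ h.1 h.2, mul_pow]
    · rw [xi_eq_zero h]; simp; positivity
  have hs0 := locErr_nonneg hq0 hq1 R m n
  rw [e1, mul_pow]
  calc _ ≤ μ ^ 2 * ((locErr q R m n * Z) * F) :=
        mul_le_mul_of_nonneg_left (e2.trans (mul_le_mul_of_nonneg_right e3 hF0)) (sq_nonneg _)
    _ = (μ ^ 2 * Z) * (locErr q R m n * F) := by ring
    _ ≤ _ := mul_le_mul_of_nonneg_right e4 (mul_nonneg hs0 hF0)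

/-- On the other configurations, the overlap of the kernel element with the localised state is small
because the kernel element is. -/
lemma overlap_off {L R m n : ℕ} {q : ℝ} (hq0 : 0 < q) (hq1 : q < 1) (hR : 1 ≤ R)
    (hm1 : 4 * R ≤ m) (hm2 : m + 4 * R ≤ n) (x : Fin (L + 1)) (f : Cfg L → ℝ)
    (hf : ∀ σ, cnt L σ ≠ n → f σ = 0) {e : Cfg L → ℝ} (he : ∀ σ, cutOp q x e σ = 0) :
    (∑ σ, if cnt x σ ≠ m then e σ * (chi R m n (some x) σ * f σ) else 0) ^ 2
      ≤ (∑ σ, e σ ^ 2) * (2 * n * q ^ (2 * R) * ∑ σ, dn σ x * f σ ^ 2) := by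
  set χ := chi R m n (some x) with hχ
  have hχ0 := chi_nonneg R m n (some x)
  have hχ1 := chi_le_one (m := m) (n := n) hR (some x)
  set G := ∑ σ, dn σ x * f σ ^ 2 with hG
  set E := ∑ σ, e σ ^ 2 with hE
  set Y2 := ∑ σ, (if cnt x σ ≠ m then e σ * (χ σ * f σ) else 0) with hY2
  have a1 : Y2 ^ 2 ≤ (∑ σ with (cnt x σ ≠ m ∧ cnt L σ = n ∧ wgt R m (some x) σ ≠ 0), e σ ^ 2)
      * ∑ σ, (if cnt x σ ≠ m then (χ σ * f σ) ^ 2 else 0) := by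
    rw [Finset.sum_filter]
    refine Finset.sum_sq_le_sum_mul_sum_of_sq_le_mul _ (fun σ _ => by split_ifs <;> positivity)
      (fun σ _ => by split_ifs <;> positivity) (fun σ _ => le_of_eq ?_)
    by_cases h1 : cnt x σ = m
    · simp [h1]
    by_cases h2 : cnt L σ = n
    · by_cases h3 : wgt R m (some x) σ = 0
      · have : χ σ = 0 := by simp [hχ, chi, h3]
        simp [this]
      · simp only [h1, h2, h3, ne_eq, not_false_eq_true, and_self, if_true]; ring
    · simp [hf σ h2]
  have a2 : ∑ σ, (if cnt x σ ≠ m then (χ σ * f σ) ^ 2 else 0) ≤ G := by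
    refine Finset.sum_le_sum fun σ _ => ?_
    have hnn : (0 : ℝ) ≤ dn σ x * f σ ^ 2 := by positivity
    split_ifs
    · by_cases h3 : wgt R m (some x) σ = 0
      · have : χ σ = 0 := by simp [hχ, chi, h3]
        rw [this]; simpa using hnn
      · have hd := (dn_of_rad_pos (show 1 ≤ rad x σ by
          have := rad_pos_of_wgt h3; omega)).2.2.2
        rw [hd, mul_pow]
        push_cast
        refine mul_le_mul_of_nonneg_right ?_ (sq_nonneg _)
        nlinarith [hχ0 σ, hχ1 σ]
    · exact hnn
  have a3 := kernel_mass_off hq0 hq1 hm1 hm2 x he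
  refine a1.trans ((mul_le_mul a3 a2 (Finset.sum_nonneg fun σ _ => by split_ifs <;> positivity)
    (by positivity)).trans (le_of_eq ?_))
  ring

/-- The component of a localised state in the kernel of the cut Hamiltonian is small. -/
lemma kernel_overlap {L R m n : ℕ} {q : ℝ} (hq0 : 0 < q) (hq1 : q < 1) (hR : 1 ≤ R)
    (hm1 : 4 * R ≤ m) (hm2 : m + 4 * R ≤ n) (hm3 : 2 * m ≤ n) (x : Fin (L + 1))
    (hx : 1 ≤ (x : ℕ)) (hxL : (x : ℕ) < L) (f : Cfg L → ℝ)
    (hf : ∀ σ, cnt L σ ≠ n → f σ = 0) (hxi : ∑ σ, xi q m n x σ * f σ = 0) {e : Cfg L → ℝ}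
    (he : ∀ σ, cutOp q x e σ = 0)
    (hee : ∑ σ, e σ ^ 2 = ∑ σ, e σ * (chi R m n (some x) σ * f σ)) :
    ∑ σ, e σ ^ 2 ≤ 2 * (locErr q R m n * ∑ σ, (if cnt x σ = m then f σ ^ 2 / mult m σ else 0)
      + 2 * n * q ^ (2 * R) * ∑ σ, dn σ x * f σ ^ 2) := by
  have hY : ∑ σ, e σ ^ 2
      = (∑ σ, if cnt x σ = m then e σ * (chi R m n (some x) σ * f σ) else 0)
        + ∑ σ, if cnt x σ ≠ m then e σ * (chi R m n (some x) σ * f σ) else 0 := by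
    rw [hee, ← Finset.sum_add_distrib]
    refine Finset.sum_congr rfl fun σ _ => ?_
    by_cases h : cnt x σ = m <;> simp [h]
  have hF0 : 0 ≤ ∑ σ : Cfg L, (if cnt x σ = m then f σ ^ 2 / mult m σ else 0) :=
    Finset.sum_nonneg fun σ _ => by split_ifs <;> positivity
  have hs0 := locErr_nonneg hq0 hq1 R m n
  exact le_two_mul_of_sq_le (Finset.sum_nonneg fun _ _ => sq_nonneg _) (by positivity) hY
    (overlap_on hq0 hq1 hR (by omega) hm3 x hx hxL f hf hxi he)
    (overlap_off hq0 hq1 hR hm1 hm2 x f hf he)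

/-- The energy of the piece of `f` localised at the cut `x`. -/
lemma energy_cut {L R m n : ℕ} {q : ℝ} (hq0 : 0 < q) (hq1 : q < 1) (hR : 1 ≤ R)
    (hm1 : 4 * R ≤ m) (hm2 : m + 4 * R ≤ n) (hm3 : 2 * m ≤ n) (x : Fin (L + 1))
    (f : Cfg L → ℝ) (hf : ∀ σ, cnt L σ ≠ n → f σ = 0) (hxi : ∑ σ, xi q m n x σ * f σ = 0) :
    (fld q + (1 - 2 * cpl q)) * ∑ σ, (chi R m n (some x) σ * f σ) ^ 2
      - 2 * (locErr q R m n * ∑ σ, (if cnt x σ = m then f σ ^ 2 / mult m σ else 0)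
      + 2 * n * q ^ (2 * R) * ∑ σ, dn σ x * f σ ^ 2)
      ≤ ∑ σ, (chi R m n (some x) σ * f σ) * hamR q (fun τ => chi R m n (some x) τ * f τ) σ := by
  have hγ := gap_pos hq0 hq1
  have hc := cpl_pos hq0
  set B := 2 * (locErr q R m n * ∑ σ, (if cnt x σ = m then f σ ^ 2 / mult m σ else 0)
      + 2 * n * q ^ (2 * R) * ∑ σ, dn σ x * f σ ^ 2) with hB
  have hB0 : 0 ≤ B := by
    have hs0 := locErr_nonneg hq0 hq1 R m n
    have hF0 : 0 ≤ ∑ σ : Cfg L, (if cnt x σ = m then f σ ^ 2 / mult m σ else 0) :=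
      Finset.sum_nonneg fun σ _ => by split_ifs <;> positivity
    positivity
  by_cases hx : 1 ≤ (x : ℕ) ∧ (x : ℕ) < L
  -- The localised state lives on configurations with both sites next to the cut down, where the
  -- Hamiltonian is `A(Δ)` plus the cut Hamiltonian.
  · obtain ⟨e, h1, h2, h3⟩ := cutOp_gap hq0 hγ x (fun τ => chi R m n (some x) τ * f τ)
    have h4 := kernel_overlap hq0 hq1 hR hm1 hm2 hm3 x hx.1 hx.2 f hf hxi h1 h2
    rw [← hB] at h4
    rw [hamR_of_down hq0 hx.1 hx.2]
    · have hE0 : 0 ≤ ∑ σ, e σ ^ 2 := Finset.sum_nonneg fun _ _ => sq_nonneg _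
      nlinarith
    · intro σ hσ
      have : wgt R m (some x) σ ≠ 0 := by
        intro h0; apply hσ; simp [chi, h0]
      have := dn_of_rad_pos (show 1 ≤ rad x σ by have := rad_pos_of_wgt this; omega)
      exact ⟨this.2.2.1, this.2.2.2⟩
  · have : ∀ σ, chi R m n (some x) σ = 0 := by
      intro σ
      by_cases h0 : wgt R m (some x) σ = 0
      · simp [chi, h0]
      · have := dn_of_rad_pos (show 1 ≤ rad x σ by have := rad_pos_of_wgt h0; omega)
        exact (hx ⟨this.1, this.2.1⟩).elim
    simp only [this, zero_mul, Finset.sum_const_zero]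
    rw [zero_pow two_ne_zero]
    simp only [Finset.sum_const_zero]
    linarith

/-- The energy of the piece of `f` without long intervals of down spins. -/
lemma energy_none {L R m n w : ℕ} {q : ℝ} (hq0 : 0 < q) (hq1 : q < 1) (hR : 1 ≤ R)
    (hw : 2 * fld q + (1 - 2 * cpl q) ≤ (1 / 2 - cpl q) * w) (hRn : 8 * R * (w + 1) ≤ n)
    (f : Cfg L → ℝ) :
    (fld q + (1 - 2 * cpl q)) * ∑ σ, (chi R m n none σ * f σ) ^ 2
      ≤ ∑ σ, (chi R m n none σ * f σ) * hamR q (fun τ => chi R m n none τ * f τ) σ := by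
  refine le_trans ?_ (hamR_lower hq0 hq1 (fun τ => chi R m n none τ * f τ))
  rw [Finset.mul_sum]
  refine Finset.sum_le_sum fun σ _ => ?_
  by_cases h : chi R m n none σ = 0
  · simp [h]
  refine mul_le_mul_of_nonneg_right ?_ (sq_nonneg _)
  have hn : cnt L σ = n := by
    by_contra hn; exact h (by simp [chi, hn])
  have hg : radMax σ < 4 * R := by
    by_contra hg
    apply h
    have : wgt R m none σ = 0 := by simp only [wgt]; omega
    simp [chi, this]
  have h1 := cnt_le_walls hg
  rw [hn] at h1
  have h2 : (8 : ℝ) * R * (w + 1) ≤ n := by exact_mod_cast hRn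
  have hR0 : (0 : ℝ) < 8 * R := by
    have : (0 : ℝ) < R := by exact_mod_cast hR
    linarith
  have h3 : (w : ℝ) + 1 ≤ walls σ + 1 := le_of_mul_le_mul_left (h2.trans h1) hR0
  have h4 : 0 < 1 / 2 - cpl q := by linarith [cpl_lt_half hq0 hq1]
  nlinarith

/-- The spectral gap above the droplet states, for real amplitudes. -/
lemma energy_lower {L R m n w : ℕ} {q : ℝ} (hq0 : 0 < q) (hq1 : q < 1) (hR : 1 ≤ R)
    (hm1 : 4 * R ≤ m) (hm2 : m + 4 * R ≤ n) (hm3 : 2 * m ≤ n)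
    (hw : 2 * fld q + (1 - 2 * cpl q) ≤ (1 / 2 - cpl q) * w) (hRn : 8 * R * (w + 1) ≤ n)
    (f : Cfg L → ℝ) (hf : ∀ σ, cnt L σ ≠ n → f σ = 0)
    (hxi : ∀ x : ℕ, x ≤ L → ∑ σ, xi q m n x σ * f σ = 0) :
    (fld q + (1 - 2 * cpl q) - ((2 * n + 1) / R ^ 2 / (1 - 2 * cpl q) + 2 * locErr q R m n
      + 4 * n ^ 2 * q ^ (2 * R))) * ∑ σ, f σ ^ 2 ≤ ∑ σ, f σ * hamR q f σ := by
  have hγ := gap_pos hq0 hq1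
  have hc := cpl_pos hq0
  have hc2 := cpl_lt_half hq0 hq1
  have hA := fld_nonneg hq0 hq1
  have hA2 := fld_le_half hq0
  set δ : ℝ := (2 * n + 1) / R ^ 2 with hδ
  have hδ0 : 0 ≤ δ := by positivity
  have hs0 := locErr_nonneg hq0 hq1 R m n
  set N := ∑ σ, f σ ^ 2 with hN
  have hN0 : 0 ≤ N := Finset.sum_nonneg fun _ _ => sq_nonneg _
  set H := ∑ σ, f σ * hamR q f σ with hH
  set W := ∑ σ, walls σ * f σ ^ 2 with hW
  by_cases hcase : (fld q + (1 - 2 * cpl q)) * N ≤ H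
  · have : 0 ≤ (δ / (1 - 2 * cpl q) + 2 * locErr q R m n + 4 * n ^ 2 * q ^ (2 * R)) * N := by
      positivity
    linarith
  push Not at hcase
  -- The localisation error is bounded by the number of walls, hence by the energy, which may be
  -- assumed not to exceed `A(Δ) + γ`.
  have hWb : δ / 2 * cpl q * W ≤ δ / (1 - 2 * cpl q) * N := by
    have h1 := hamR_lower hq0 hq1 f
    have h2 : ∑ σ, ((1 / 2 - cpl q) * walls σ - fld q) * f σ ^ 2
        = (1 / 2 - cpl q) * W - fld q * N := by
      rw [hW, hN, Finset.mul_sum, Finset.mul_sum, ← Finset.sum_sub_distrib]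
      exact Finset.sum_congr rfl fun σ _ => by ring
    rw [h2, ← hH] at h1
    have h3 : (1 - 2 * cpl q) * W ≤ 4 * N := by nlinarith
    rw [div_mul_eq_mul_div δ (1 - 2 * cpl q), le_div_iff₀ hγ]
    have h4 := mul_le_mul_of_nonneg_left h3 (by positivity : 0 ≤ δ / 2 * cpl q)
    have h5 : δ / 2 * cpl q * (4 * N) ≤ δ * N := by nlinarith [mul_nonneg hδ0 hN0]
    linarith
  have hims := ims_localisation (n := n) hq0 (chi (L := L) R m n) (η := δ / 2) (by positivity)
    (fun σ h => sum_chi_sq hR h)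
    (fun i σ h => ⟨by
      have := sum_chi_sub_sq (R := R) (m := m) hR i h
      have : 0 ≤ ∑ o, (chi R m n o σ - chi R m n o (hop i σ)) ^ 2 :=
        Finset.sum_nonneg fun _ _ => sq_nonneg _
      linarith, one_sub_overlap_le hR i h⟩) f hf
  rw [← hH, ← hW, Fintype.sum_option] at hims
  have hx := Finset.sum_le_sum fun x (_ : x ∈ (Finset.univ : Finset (Fin (L + 1)))) =>
    energy_cut hq0 hq1 hR hm1 hm2 hm3 x f hf (hxi x (by omega))
  have hnone := energy_none (m := m) hq0 hq1 hR hw hRn f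
  have hsum : ∑ σ, (chi R m n none σ * f σ) ^ 2
      + ∑ x : Fin (L + 1), ∑ σ, (chi R m n (some x) σ * f σ) ^ 2 = N := by
    rw [← Fintype.sum_option (fun o => ∑ σ, (chi R m n o σ * f σ) ^ 2), Finset.sum_comm, hN]
    refine Finset.sum_congr rfl fun σ _ => ?_
    by_cases h : cnt L σ = n
    · simp only [mul_pow]
      rw [← Finset.sum_mul, sum_chi_sq hR h, one_mul]
    · simp [hf σ h]
  have hF : ∑ x : Fin (L + 1), ∑ σ : Cfg L, (if cnt x σ = m then f σ ^ 2 / mult m σ else 0)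
      ≤ N := by
    rw [Finset.sum_comm]
    refine Finset.sum_le_sum fun σ _ => ?_
    rw [Fin.sum_univ_eq_sum_range (fun x => if cnt x σ = m then f σ ^ 2 / mult m σ else 0),
      ← Finset.sum_filter, Finset.sum_const, nsmul_eq_mul]
    change (mult m σ : ℝ) * (f σ ^ 2 / mult m σ) ≤ f σ ^ 2
    by_cases h0 : (mult m σ : ℝ) = 0
    · rw [h0]; simp; positivity
    · field_simp; rfl
  -- A configuration with `n` down spins is seen by `n` cuts with a down spin to their right.
  have hG : ∑ x : Fin (L + 1), ∑ σ : Cfg L, (dn σ x : ℝ) * f σ ^ 2 = n * N := by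
    rw [Finset.sum_comm, hN, Finset.mul_sum]
    refine Finset.sum_congr rfl fun σ _ => ?_
    rw [← Finset.sum_mul, ← Nat.cast_sum, sum_dn]
    by_cases h : cnt L σ = n
    · rw [h]
    · simp [hf σ h]
  rw [Finset.sum_sub_distrib, ← Finset.mul_sum, ← Finset.mul_sum, Finset.sum_add_distrib,
    ← Finset.mul_sum, ← Finset.mul_sum, hG] at hx
  have hF' := mul_le_mul_of_nonneg_left hF hs0
  have hsum' : (fld q + (1 - 2 * cpl q)) * ∑ σ, (chi R m n none σ * f σ) ^ 2
      + (fld q + (1 - 2 * cpl q)) * ∑ x : Fin (L + 1), ∑ σ, (chi R m n (some x) σ * f σ) ^ 2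
      = (fld q + (1 - 2 * cpl q)) * N := by rw [← mul_add, hsum]
  nlinarith

/-! ### Droplet states are approximate eigenvectors -/

/-- Each wall is next to a down spin, and each down spin is next to at most two walls. -/
lemma walls_le {L : ℕ} (σ : Cfg L) : walls σ ≤ 2 * cnt L σ := by
  have h1 : walls σ ≤ ∑ i : Fin (L - 1), ((dn σ i : ℝ) + dn σ (i + 1)) := by
    unfold walls
    refine Finset.sum_le_sum fun i _ => ?_
    split_ifs with h
    · by_contra! hcon
      have : dn σ i + dn σ (i + 1) < 1 := by exact_mod_cast hcon
      exact h (eq_of_dn_eq (by rw [lo_val, hi_val]; omega))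
    · positivity
  have h2 : ∑ i : Fin (L - 1), (dn σ i + dn σ (i + 1)) ≤ 2 * cnt L σ := by
    rw [Finset.sum_add_distrib, Fin.sum_univ_eq_sum_range (fun i => dn σ i),
      Fin.sum_univ_eq_sum_range (fun i => dn σ (i + 1))]
    have a : ∑ i ∈ range (L - 1), dn σ i ≤ cnt L σ := by
      rw [← cnt_eq_sum]; exact cnt_mono (by omega) σ
    have b : ∑ i ∈ range (L - 1), dn σ (i + 1) ≤ cnt L σ := by
      have := Finset.sum_range_succ' (fun i => dn σ i) (L - 1)
      rw [← cnt_eq_sum] at this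
      have := cnt_le_total (L - 1 + 1) σ
      omega
    omega
  refine h1.trans ?_
  exact_mod_cast h2

/-- A crude bound on the Hamiltonian in the sector with `n` down spins. -/
lemma hamR_sector_bound {L n : ℕ} {q : ℝ} (hq0 : 0 < q) (hq1 : q < 1) (f : Cfg L → ℝ)
    (hf : ∀ σ, cnt L σ ≠ n → f σ = 0) :
    ∑ σ, (hamR q f σ - fld q * f σ) ^ 2 ≤ 4 * (n + 2) ^ 2 * ∑ σ, f σ ^ 2 := by
  have hc := cpl_pos hq0
  have hc2 := cpl_lt_half hq0 hq1
  have hA := fld_nonneg hq0 hq1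
  have hA2 := fld_le_half hq0
  have pt : ∀ σ, (hamR q f σ - fld q * f σ) ^ 2 ≤ 2 * (n + 2) ^ 2 * f σ ^ 2
      + n * ∑ i : Fin (L - 1), (if σ (lo i) ≠ σ (hi i) then f (hop i σ) ^ 2 else 0) := by
    intro σ
    by_cases hσ : cnt L σ = n
    swap
    · have z : hamR q f σ = 0 := by
        unfold hamR
        rw [hf σ hσ, mul_zero, sub_zero]
        refine Finset.sum_eq_zero fun i _ => ?_
        unfold pairR
        rw [hf σ hσ, hf (hop i σ) (by rw [cnt_hop_total]; exact hσ)]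
        simp
      rw [z, hf σ hσ]
      have : 0 ≤ (n : ℝ) * ∑ i : Fin (L - 1),
          (if σ (lo i) ≠ σ (hi i) then f (hop i σ) ^ 2 else 0) :=
        mul_nonneg (by positivity) (Finset.sum_nonneg fun i _ => by split_ifs <;> positivity)
      simpa using this
    have hW := walls_le σ
    rw [hσ] at hW
    have hW0 : 0 ≤ walls σ := Finset.sum_nonneg fun i _ => by split_ifs <;> norm_num
    set S := ∑ i : Fin (L - 1), (if σ (lo i) ≠ σ (hi i) then f (hop i σ) else 0) with hS
    set Q := ∑ i : Fin (L - 1), (if σ (lo i) ≠ σ (hi i) then f (hop i σ) ^ 2 else 0) with hQ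
    have hQ0 : 0 ≤ Q := Finset.sum_nonneg fun i _ => by split_ifs <;> positivity
    have e : hamR q f σ - fld q * f σ
        = (walls σ / 2 - fld q * (sp σ 0 + sp σ (L - 1)) - fld q) * f σ - cpl q * S := by
      have : ∑ i : Fin (L - 1), pairR q i f σ = walls σ / 2 * f σ - cpl q * S := by
        rw [walls, hS, Finset.mul_sum, div_mul_eq_mul_div, Finset.sum_mul, Finset.sum_div,
          ← Finset.sum_sub_distrib]
        refine Finset.sum_congr rfl fun i _ => ?_
        unfold pairR
        split_ifs <;> ring
      unfold hamR
      rw [this]; ring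
    have hSQ : S ^ 2 ≤ 2 * n * Q := by
      refine le_trans ?_ (mul_le_mul_of_nonneg_right hW hQ0)
      refine Finset.sum_sq_le_sum_mul_sum_of_sq_le_mul _ (fun i _ => by split_ifs <;> norm_num)
        (fun i _ => by split_ifs <;> positivity) (fun i _ => le_of_eq ?_)
      split_ifs <;> simp
    have hD : (walls σ / 2 - fld q * (sp σ 0 + sp σ (L - 1)) - fld q) ^ 2 ≤ ((n : ℝ) + 2) ^ 2 := by
      have := sp_le σ 0
      have := sp_le σ (L - 1)
      have := le_sp σ 0
      have := le_sp σ (L - 1)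
      apply sq_le_sq'
      · nlinarith
      · nlinarith
    set D := walls σ / 2 - fld q * (sp σ 0 + sp σ (L - 1)) - fld q
    rw [e]
    have h1 : (D * f σ - cpl q * S) ^ 2 ≤ 2 * (D ^ 2 * f σ ^ 2) + 2 * (cpl q ^ 2 * S ^ 2) := by
      nlinarith [sq_nonneg (D * f σ + cpl q * S)]
    have h2 : D ^ 2 * f σ ^ 2 ≤ ((n : ℝ) + 2) ^ 2 * f σ ^ 2 :=
      mul_le_mul_of_nonneg_right hD (sq_nonneg _)
    have h3 : cpl q ^ 2 * S ^ 2 ≤ 1 / 4 * (2 * n * Q) :=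
      mul_le_mul (by nlinarith) hSQ (sq_nonneg _) (by norm_num)
    linarith
  have h1 := Finset.sum_le_sum fun σ (_ : σ ∈ (Finset.univ : Finset (Cfg L))) => pt σ
  have h2 : ∑ σ : Cfg L, ∑ i : Fin (L - 1), (if σ (lo i) ≠ σ (hi i) then f (hop i σ) ^ 2 else 0)
      ≤ 2 * n * ∑ σ, f σ ^ 2 := by
    rw [Finset.sum_comm]
    simp only [sum_wall_hop _ (fun σ => f σ ^ 2)]
    rw [sum_mul_walls (fun σ => f σ ^ 2), Finset.mul_sum]
    refine Finset.sum_le_sum fun σ _ => ?_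
    by_cases hσ : cnt L σ = n
    · have := walls_le σ
      rw [hσ] at this
      exact mul_le_mul_of_nonneg_right this (sq_nonneg _)
    · simp [hf σ hσ]
  rw [Finset.sum_add_distrib, ← Finset.mul_sum, ← Finset.mul_sum] at h1
  have hN0 : 0 ≤ ∑ σ, f σ ^ 2 := Finset.sum_nonneg fun _ _ => sq_nonneg _
  have hn : (0 : ℝ) ≤ n := by positivity
  have h3 := mul_le_mul_of_nonneg_left h2 hn
  nlinarith [mul_nonneg hn hN0, mul_nonneg (mul_nonneg hn hn) hN0]

/-- Cauchy–Schwarz for a sum with at most `k` nonzero terms. -/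
lemma sum_mul_sq_le {s : Finset ℕ} (α v : ℕ → ℝ) (k : ℝ)
    (hk : ((s.filter fun x => v x ≠ 0).card : ℝ) ≤ k) :
    (∑ x ∈ s, |α x| * |v x|) ^ 2 ≤ k * ∑ x ∈ s, α x ^ 2 * v x ^ 2 := by
  have h1 : ∑ x ∈ s, |α x| * |v x| = ∑ x ∈ s.filter fun x => v x ≠ 0, |α x| * |v x| := by
    rw [Finset.sum_filter]
    refine Finset.sum_congr rfl fun x _ => ?_
    by_cases h : v x = 0 <;> simp [h]
  have h2 : ∑ x ∈ s.filter (fun x => v x ≠ 0), (|α x| * |v x|) ^ 2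
      ≤ ∑ x ∈ s, α x ^ 2 * v x ^ 2 := by
    refine (Finset.sum_le_sum_of_subset_of_nonneg (Finset.filter_subset _ _)
      fun _ _ _ => sq_nonneg _).trans (le_of_eq ?_)
    exact Finset.sum_congr rfl fun x _ => by rw [mul_pow, sq_abs, sq_abs]
  rw [h1]
  refine sq_sum_le_card_mul_sum_sq.trans ?_
  exact mul_le_mul hk h2 (Finset.sum_nonneg fun _ _ => sq_nonneg _)
    ((Nat.cast_nonneg _).trans hk)

/-- The droplet amplitude at configurations with an up spin next to the cut. -/
def edgeA {L : ℕ} (q : ℝ) (m n x : ℕ) (σ : Cfg L) : ℝ :=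
  if dn σ (x - 1) = 1 ∧ dn σ x = 1 then 0 else xi q m n x σ

/-- The droplet amplitude at configurations obtained by an exchange across the cut. -/
def edgeB {L : ℕ} (q : ℝ) (m n x : ℕ) (σ : Cfg L) : ℝ :=
  ∑ i : Fin (L - 1), if (i : ℕ) + 1 = x ∧ σ (lo i) ≠ σ (hi i) then xi q m n x (hop i σ) else 0

lemma xi_eq_zero_of_cut {L : ℕ} {q : ℝ} {m n x : ℕ} (hm : 1 ≤ m) (hmn : m < n)
    (h : ¬ (1 ≤ x ∧ x < L)) (σ : Cfg L) : xi q m n x σ = 0 := by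
  apply xi_eq_zero
  rintro ⟨h1, h2⟩
  rcases Nat.lt_or_ge x 1 with h3 | h3
  · rw [show x = 0 by omega, cnt_zero] at h1; omega
  · have := cnt_mono (show L ≤ x by omega) σ
    omega

lemma xi_nonneg {L : ℕ} {q : ℝ} (hq : 0 < q) (m n x : ℕ) (σ : Cfg L) : 0 ≤ xi q m n x σ := by
  have := gs_pos hq x σ
  unfold xi; split_ifs <;> simp [this.le]

lemma edgeB_eq {L : ℕ} (q : ℝ) (m n : ℕ) (i : Fin (L - 1)) (σ : Cfg L) :
    edgeB q m n (i + 1) σ = if σ (lo i) ≠ σ (hi i) then xi q m n (i + 1) (hop i σ) else 0 := by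
  unfold edgeB
  rw [Finset.sum_eq_single i]
  · simp
  · intro j _ hj
    rw [if_neg]
    rintro ⟨h, -⟩
    exact hj (Fin.ext (by omega))
  · simp

/-- Applied to a droplet state, `H^{++} - A(Δ)` only acts on the two sites next to the
cut, and vanishes on
configurations with both sites next to the cut down. -/
lemma hamR_xi_bound {L : ℕ} {q : ℝ} (hq0 : 0 < q) (hq1 : q < 1) {m n x : ℕ} (hm : 1 ≤ m)
    (hmn : m < n) (σ : Cfg L) :
    |hamR q (xi q m n x) σ - fld q * xi q m n x σ| ≤ |edgeA q m n x σ| + |edgeB q m n x σ| / 2 := by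
  have hc := cpl_pos hq0
  have hc2 := cpl_lt_half hq0 hq1
  have hA := fld_nonneg hq0 hq1
  have hA2 := fld_le_half hq0
  by_cases hx : 1 ≤ x ∧ x < L
  swap
  · have h0 : (xi q m n x : Cfg L → ℝ) = fun _ => 0 := by
      funext τ; exact xi_eq_zero_of_cut hm hmn hx τ
    have z : hamR q (xi q m n x) σ - fld q * xi q m n x σ = 0 := by
      rw [h0]; simp [hamR, pairR]
    rw [z, abs_zero]; positivity
  obtain ⟨i, rfl⟩ : ∃ i : Fin (L - 1), x = i + 1 := ⟨⟨x - 1, by omega⟩, by simp; omega⟩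
  have e : hamR q (xi q m n (i + 1)) σ - fld q * xi q m n (i + 1) σ
      = cutBond q (i + 1) (xi q m n (i + 1)) σ := by
    rw [hamR_eq hq0 hx.1 hx.2, cutOp_xi hq0]; ring
  rw [e]
  by_cases hd : dn σ i = 1 ∧ dn σ (i + 1) = 1
  · rw [cutBond_of_down q hx.1 _ (by simpa using hd.1) hd.2, abs_zero]; positivity
  have hEA : edgeA q m n (i + 1) σ = xi q m n (i + 1) σ := by
    unfold edgeA; rw [if_neg]; simpa using hd
  have e2 : cutBond q (i + 1) (xi q m n (i + 1)) σ = pairR q i (xi q m n (i + 1)) σ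
      - fld q * (sp σ i + sp σ (i + 1)) * xi q m n (i + 1) σ - fld q * xi q m n (i + 1) σ := by
    unfold cutBond
    rw [Finset.sum_eq_single i]
    · simp
    · intro j _ hj
      rw [if_neg]
      intro h
      exact hj (Fin.ext (by omega))
    · simp
  rw [e2, hEA, edgeB_eq]
  have p1 := xi_nonneg hq0 m n (i + 1) σ
  have p2 := xi_nonneg hq0 m n (i + 1) (hop i σ)
  have hle := dn_le_one σ i
  have hle2 := dn_le_one σ (i + 1)
  rw [abs_of_nonneg p1]
  by_cases hw : σ (lo i) = σ (hi i)
  · have hdd : dn σ i = dn σ (i + 1) := by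
      have a := dn_val σ (lo i)
      have b := dn_val σ (hi i)
      rw [hw, ← b] at a
      exact a
    have z1 : dn σ i = 0 := by omega
    have z2 : dn σ (i + 1) = 0 := by omega
    rw [if_neg (by simpa using hw), pairR, if_neg (by simpa using hw), sp, sp, z1, z2]
    rw [abs_le]
    constructor <;> simp <;> nlinarith
  · have hdd : dn σ i + dn σ (i + 1) = 1 := by
      by_contra h
      apply hw
      apply eq_of_dn_eq
      rw [lo_val, hi_val]
      omega
    have hsp : sp σ i + sp σ (i + 1) = 0 := by
      have : (dn σ i : ℝ) + dn σ (i + 1) = 1 := by exact_mod_cast hdd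
      unfold sp; linarith
    rw [if_pos hw, pairR, if_pos hw, hsp, abs_of_nonneg p2, abs_le]
    constructor <;> nlinarith [mul_nonneg hA p1, mul_nonneg hc.le p2]

lemma card_dn_cnt_le_one {L : ℕ} (s : Finset ℕ) (k : ℕ) (σ : Cfg L) :
    (s.filter fun y => dn σ y = 1 ∧ cnt y σ = k).card ≤ 1 := by
  rw [Finset.card_le_one]
  intro a ha b hb
  rw [mem_filter] at ha hb
  rcases lt_trichotomy a b with h | h | h
  · have h1 := cnt_succ a σ
    have h2 := cnt_mono (show a + 1 ≤ b from h) σ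
    omega
  · exact h
  · have h1 := cnt_succ b σ
    have h2 := cnt_mono (show b + 1 ≤ a from h) σ
    omega

/-- If a site next to the cut is up, the cut can be moved across it. -/
lemma edgeA_sq {L : ℕ} {q : ℝ} {m n x : ℕ} (hm : 1 ≤ m) (hmn : m < n) (σ : Cfg L) :
    edgeA q m n x σ ^ 2 ≤ ((mult m σ : ℝ) - 1) * xi q m n x σ ^ 2 := by
  by_cases h : cnt x σ = m ∧ cnt L σ = n
  swap
  · simp [edgeA, xi_eq_zero h]
  unfold edgeA
  have hx : 1 ≤ x ∧ x < L := by
    by_contra hx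
    rcases Nat.lt_or_ge x 1 with h3 | h3
    · rw [show x = 0 by omega, cnt_zero] at h; omega
    · have := cnt_mono (show L ≤ x by omega) σ
      omega
  split_ifs with hd
  · have : (1 : ℝ) ≤ mult m σ := by exact_mod_cast mult_pos hx.2.le h.1
    have : 0 ≤ (mult m σ : ℝ) - 1 := by linarith
    rw [zero_pow two_ne_zero]; positivity
  · have h2 : 2 ≤ mult m σ := by
      unfold mult
      have hx1 : x ∈ (range (L + 1)).filter fun y => cnt y σ = m := by
        rw [mem_filter, mem_range]; exact ⟨by omega, h.1⟩
      have l1 := dn_le_one σ x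
      have l2 := dn_le_one σ (x - 1)
      by_cases h0 : dn σ x = 0
      · have hx2 : x + 1 ∈ (range (L + 1)).filter fun y => cnt y σ = m := by
          rw [mem_filter, mem_range, cnt_succ]; exact ⟨by omega, by omega⟩
        exact Finset.one_lt_card.2 ⟨x, hx1, x + 1, hx2, by omega⟩
      · have hx2 : x - 1 ∈ (range (L + 1)).filter fun y => cnt y σ = m := by
          have := cnt_succ (x - 1) σ
          rw [Nat.sub_add_cancel hx.1] at this
          rw [mem_filter, mem_range]; exact ⟨by omega, by omega⟩
        exact Finset.one_lt_card.2 ⟨x, hx1, x - 1, hx2, by omega⟩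
    have h3 : (2 : ℝ) ≤ mult m σ := by exact_mod_cast h2
    nlinarith [sq_nonneg (xi q m n x σ)]

/-- At most two cuts `x` contribute at a configuration: the exchange moves a down spin across the
cut, and the number `m` of down spins on the left of the cut determines which one. -/
lemma edgeB_card {L : ℕ} {q : ℝ} {m n : ℕ} (σ : Cfg L) :
    (((range (L + 1)).filter fun x => edgeB q m n x σ ≠ 0).card : ℝ) ≤ 2 := by
  have hsub : (range (L + 1)).filter (fun x => edgeB q m n x σ ≠ 0)
      ⊆ ((range (L + 1)).filter fun y => dn σ y = 1 ∧ cnt y σ = m).image (fun y => y + 1)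
        ∪ (range (L + 1)).filter fun y => dn σ y = 1 ∧ cnt y σ = m - 1 := by
    intro x hx
    rw [mem_filter, mem_range] at hx
    rw [mem_union, mem_image]
    simp only [mem_filter, mem_range]
    obtain ⟨i, -, hi'⟩ := Finset.exists_ne_zero_of_sum_ne_zero hx.2
    rw [ne_eq, ite_eq_right_iff, Classical.not_imp] at hi'
    obtain ⟨⟨rfl, hw⟩, hne⟩ := hi'
    have hc : cnt (i + 1) (hop i σ) = m := by
      by_contra h; exact hne (xi_eq_zero fun h' => h h'.1)
    rw [cnt_succ, cnt_hop i i (by omega), dn_hop_lo] at hc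
    have hdd : dn σ i + dn σ (i + 1) = 1 := by
      have l1 := dn_le_one σ i
      have l2 := dn_le_one σ (i + 1)
      by_contra h
      apply hw
      apply eq_of_dn_eq
      rw [lo_val, hi_val]
      omega
    have l3 := cnt_succ i σ
    by_cases h0 : dn σ i = 1
    · left; exact ⟨i, ⟨by omega, h0, by omega⟩, rfl⟩
    · right; exact ⟨by omega, by omega, by omega⟩
  have h1 := (Finset.card_le_card hsub).trans ((Finset.card_union_le _ _).trans
    (Nat.add_le_add (Finset.card_image_le.trans (card_dn_cnt_le_one _ m σ))
      (card_dn_cnt_le_one _ (m - 1) σ)))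
  exact_mod_cast h1

lemma edgeB_sq {L : ℕ} {q : ℝ} (m n x : ℕ) :
    ∑ σ : Cfg L, edgeB q m n x σ ^ 2 ≤ ∑ σ : Cfg L, edgeA q m n x σ ^ 2 := by
  by_cases hx : ∃ i : Fin (L - 1), x = i + 1
  · obtain ⟨i, rfl⟩ := hx
    simp only [edgeB_eq]
    have := sum_wall_hop i (fun σ => xi q m n (i + 1) σ ^ 2)
    simp only [ite_pow, zero_pow two_ne_zero, this]
    refine Finset.sum_le_sum fun σ _ => ?_
    split_ifs with h
    · unfold edgeA
      rw [if_neg]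
      rintro ⟨h1, h2⟩
      apply h
      apply eq_of_dn_eq
      rw [lo_val, hi_val, h2]
      simpa using h1
    · positivity
  · have : ∀ σ : Cfg L, edgeB q m n x σ = 0 := by
      intro σ
      unfold edgeB
      refine Finset.sum_eq_zero fun i _ => ?_
      rw [if_neg]
      rintro ⟨h, -⟩
      exact hx ⟨i, h.symm⟩
    simp only [this, zero_pow two_ne_zero, Finset.sum_const_zero]
    positivity

lemma hamR_sum {L : ℕ} (q : ℝ) (s : Finset ℕ) (α : ℕ → ℝ) (v : ℕ → Cfg L → ℝ) (σ : Cfg L) :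
    hamR q (fun τ => ∑ x ∈ s, α x * v x τ) σ = ∑ x ∈ s, α x * hamR q (v x) σ := by
  have h1 : ∀ i : Fin (L - 1), pairR q i (fun τ => ∑ x ∈ s, α x * v x τ) σ
      = ∑ x ∈ s, α x * pairR q i (v x) σ := by
    intro i
    unfold pairR
    split_ifs
    · rw [Finset.sum_div, Finset.mul_sum, ← Finset.sum_sub_distrib]
      exact Finset.sum_congr rfl fun x _ => by ring
    · simp
  unfold hamR
  simp only [h1]
  rw [Finset.sum_comm, Finset.mul_sum, ← Finset.sum_sub_distrib]
  refine Finset.sum_congr rfl fun x _ => ?_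
  rw [← Finset.mul_sum]; ring

/-- On superpositions of droplet states, `H^{++} - A(Δ)` is small. -/
lemma droplet_energy {L m n : ℕ} {q : ℝ} (hq0 : 0 < q) (hq1 : q < 1) (hm : 1 ≤ m)
    (hmn : 2 * m ≤ n) (hθ : 2 / (1 - q ^ 2) * q ^ (2 * m) ≤ 1 / 2) (α : ℕ → ℝ)
    (f : Cfg L → ℝ) (hf : f = fun σ => ∑ x ∈ range (L + 1), α x * xi q m n x σ) :
    ∑ σ, (hamR q f σ - fld q * f σ) ^ 2
      ≤ 10 * (2 / (1 - q ^ 2) * q ^ (2 * m)) * ∑ σ, f σ ^ 2 := by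
  have hθ0 : 0 ≤ 2 / (1 - q ^ 2) * q ^ (2 * m) := by
    have : 0 < 1 - q ^ 2 := by nlinarith
    positivity
  have hmult := fun x (hx : x ∈ range (L + 1)) => xi_mult hq0 hq1 hm hmn
    (show x ≤ L by rw [mem_range] at hx; omega)
  set θ := 2 / (1 - q ^ 2) * q ^ (2 * m) with hθd
  set Z : ℕ → ℝ := fun x => ∑ σ : Cfg L, xi q m n x σ ^ 2 with hZ
  set S := ∑ x ∈ range (L + 1), α x ^ 2 * Z x with hS
  have hmn' : m < n := by omega
  -- Almost orthogonality, by restriction to configurations that determine the cut.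
  have hlow : S / 2 ≤ ∑ σ, f σ ^ 2 := by
    have pt : ∀ σ : Cfg L, ∑ x ∈ range (L + 1), α x ^ 2 * (xi q m n x σ ^ 2
        - ((mult m σ : ℝ) - 1) * xi q m n x σ ^ 2) ≤ f σ ^ 2 := by
      intro σ
      rcases Nat.lt_trichotomy (mult m σ) 1 with h | h | h
      · have : ∀ x ∈ range (L + 1), xi q m n x σ = 0 := by
          intro x hx
          apply xi_eq_zero
          rintro ⟨h1, -⟩
          have := mult_pos (show x ≤ L by rw [mem_range] at hx; omega) h1
          omega
        rw [Finset.sum_eq_zero]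
        · positivity
        · intro x hx; rw [this x hx]; ring
      · obtain ⟨y, hy⟩ := Finset.card_eq_one.1 h
        have hy' : ∀ x, x ∈ range (L + 1) → x ≠ y → xi q m n x σ = 0 := by
          intro x hx hne
          apply xi_eq_zero
          rintro ⟨h1, -⟩
          have : x ∈ ({y} : Finset ℕ) := by rw [← hy, mem_filter]; exact ⟨hx, h1⟩
          exact hne (Finset.mem_singleton.1 this)
        have hyr : y ∈ range (L + 1) := by
          have : y ∈ ({y} : Finset ℕ) := Finset.mem_singleton_self y
          rw [← hy, mem_filter] at this
          exact this.1
        rw [hf]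
        dsimp only
        rw [Finset.sum_eq_single_of_mem y hyr fun x hx hne => by rw [hy' x hx hne]; ring,
          Finset.sum_eq_single_of_mem y hyr fun x hx hne => by rw [hy' x hx hne]; ring, h]
        apply le_of_eq
        push_cast; ring
      · refine (Finset.sum_nonpos fun x _ => ?_).trans (sq_nonneg _)
        have h2 : (2 : ℝ) ≤ mult m σ := by exact_mod_cast h
        nlinarith [mul_nonneg (sq_nonneg (α x)) (sq_nonneg (xi q m n x σ)),
          mul_nonneg (sub_nonneg.2 h2) (mul_nonneg (sq_nonneg (α x)) (sq_nonneg (xi q m n x σ)))]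
    have h1 := Finset.sum_le_sum fun σ (_ : σ ∈ (Finset.univ : Finset (Cfg L))) => pt σ
    rw [Finset.sum_comm] at h1
    refine le_trans ?_ h1
    rw [hS, Finset.sum_div]
    refine Finset.sum_le_sum fun x hx => ?_
    rw [← Finset.mul_sum, Finset.sum_sub_distrib]
    have h2 := hmult x hx
    have h3 : 0 ≤ Z x := Finset.sum_nonneg fun _ _ => sq_nonneg _
    have h4 : Z x / 2 ≤ ∑ σ : Cfg L, xi q m n x σ ^ 2
        - ∑ σ : Cfg L, ((mult m σ : ℝ) - 1) * xi q m n x σ ^ 2 := by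
      have : θ * Z x ≤ 1 / 2 * Z x := mul_le_mul_of_nonneg_right hθ h3
      change Z x / 2 ≤ Z x - _
      linarith
    rw [mul_div_assoc]
    exact mul_le_mul_of_nonneg_left h4 (sq_nonneg _)
  have hA : ∀ x ∈ range (L + 1), ∑ σ : Cfg L, edgeA q m n x σ ^ 2 ≤ θ * Z x := fun x hx =>
    (Finset.sum_le_sum fun σ _ => edgeA_sq hm hmn' σ).trans (hmult x hx)
  -- At a configuration, at most `mult` droplet states and two exchanged ones contribute.
  have up : ∀ σ, (hamR q f σ - fld q * f σ) ^ 2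
      ≤ 2 * (∑ x ∈ range (L + 1), α x ^ 2 * (mult m σ * edgeA q m n x σ ^ 2))
        + ∑ x ∈ range (L + 1), α x ^ 2 * edgeB q m n x σ ^ 2 := by
    intro σ
    have e : hamR q f σ - fld q * f σ = ∑ x ∈ range (L + 1),
        α x * (hamR q (xi q m n x) σ - fld q * xi q m n x σ) := by
      rw [hf, hamR_sum, Finset.mul_sum, ← Finset.sum_sub_distrib]
      exact Finset.sum_congr rfl fun x _ => by ring
    have h1 : |hamR q f σ - fld q * f σ| ≤ ∑ x ∈ range (L + 1), |α x| * |edgeA q m n x σ|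
        + (∑ x ∈ range (L + 1), |α x| * |edgeB q m n x σ|) / 2 := by
      rw [e, Finset.sum_div, ← Finset.sum_add_distrib]
      refine (Finset.abs_sum_le_sum_abs _ _).trans (Finset.sum_le_sum fun x _ => ?_)
      rw [abs_mul]
      have := mul_le_mul_of_nonneg_left (hamR_xi_bound hq0 hq1 (x := x) hm hmn' σ)
        (abs_nonneg (α x))
      linarith
    have h2 := sum_mul_sq_le (s := range (L + 1)) α (fun x => edgeA q m n x σ) (mult m σ) (by
      norm_cast
      apply Finset.card_le_card
      intro x hx
      rw [mem_filter] at hx ⊢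
      refine ⟨hx.1, ?_⟩
      by_contra h
      apply hx.2
      unfold edgeA
      rw [xi_eq_zero fun h' => h h'.1]; simp)
    have h3 := sum_mul_sq_le (s := range (L + 1)) α (fun x => edgeB q m n x σ) 2 (edgeB_card σ)
    set X := ∑ x ∈ range (L + 1), |α x| * |edgeA q m n x σ|
    set Y := ∑ x ∈ range (L + 1), |α x| * |edgeB q m n x σ|
    have h4 : ∑ x ∈ range (L + 1), α x ^ 2 * (mult m σ * edgeA q m n x σ ^ 2)
        = mult m σ * ∑ x ∈ range (L + 1), α x ^ 2 * edgeA q m n x σ ^ 2 := by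
      rw [Finset.mul_sum]; exact Finset.sum_congr rfl fun x _ => by ring
    rw [h4]
    have h5 : (hamR q f σ - fld q * f σ) ^ 2 ≤ (X + Y / 2) ^ 2 := by
      rw [← sq_abs]; exact pow_le_pow_left₀ (abs_nonneg _) h1 2
    nlinarith [sq_nonneg (X - Y / 2)]
  have hsum := Finset.sum_le_sum fun σ (_ : σ ∈ (Finset.univ : Finset (Cfg L))) => up σ
  rw [Finset.sum_add_distrib, ← Finset.mul_sum, Finset.sum_comm,
    Finset.sum_comm (t := range (L + 1))] at hsum
  have b1 : ∑ x ∈ range (L + 1), ∑ σ : Cfg L, α x ^ 2 * (mult m σ * edgeA q m n x σ ^ 2)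
      ≤ 2 * θ * S := by
    rw [hS, Finset.mul_sum]
    refine Finset.sum_le_sum fun x hx => ?_
    rw [← Finset.mul_sum]
    have : ∑ σ : Cfg L, (mult m σ : ℝ) * edgeA q m n x σ ^ 2 ≤ 2 * (θ * Z x) := by
      have h1 : ∀ σ : Cfg L, (mult m σ : ℝ) * edgeA q m n x σ ^ 2
          ≤ 2 * (((mult m σ : ℝ) - 1) * xi q m n x σ ^ 2) := by
        intro σ
        have hs := edgeA_sq (q := q) (x := x) hm hmn' σ
        by_cases h0 : edgeA q m n x σ = 0
        · rw [h0] at hs ⊢; linarith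
        · have hxi : edgeA q m n x σ = xi q m n x σ := by
            unfold edgeA at h0 ⊢
            split_ifs at h0 ⊢ with h
            · exact (h0 rfl).elim
            · rfl
          rw [hxi] at hs h0 ⊢
          have hp : 0 < xi q m n x σ ^ 2 := by positivity
          have : 1 ≤ (mult m σ : ℝ) - 1 := by
            by_contra! hcon
            nlinarith
          nlinarith
      have h2 := Finset.sum_le_sum fun σ (_ : σ ∈ (Finset.univ : Finset (Cfg L))) => h1 σ
      rw [← Finset.mul_sum] at h2
      have := hmult x hx
      change _ ≤ θ * Z x at this
      linarith
    have := mul_le_mul_of_nonneg_left this (sq_nonneg (α x))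
    linarith
  have b2 : ∑ x ∈ range (L + 1), ∑ σ : Cfg L, α x ^ 2 * edgeB q m n x σ ^ 2 ≤ θ * S := by
    rw [hS, Finset.mul_sum]
    refine Finset.sum_le_sum fun x hx => ?_
    rw [← Finset.mul_sum]
    have := mul_le_mul_of_nonneg_left ((edgeB_sq (q := q) m n x).trans (hA x hx))
      (sq_nonneg (α x))
    linarith
  have : θ * (S / 2) ≤ θ * ∑ σ, f σ ^ 2 := mul_le_mul_of_nonneg_left hlow hθ0
  linarith

/-! ### The Hamiltonian in the product basis -/

lemma siteOp_mulVec {L : ℕ} (x : Fin L) (M : Matrix (Fin 2) (Fin 2) ℂ) (v : Cfg L → ℂ)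
    (σ : Cfg L) :
    (siteOp x M).mulVec v σ = ∑ a, M (σ x) a * v (Function.update σ x a) := by
  rw [Matrix.mulVec, dotProduct]
  symm
  refine Fintype.sum_of_injective (fun a => Function.update σ x a) ?_ _ _ ?_ ?_
  · exact Function.update_injective σ x
  · intro τ hτ
    have : ¬ ∀ y, y ≠ x → σ y = τ y := by
      intro h
      refine hτ ⟨τ x, ?_⟩
      funext y
      by_cases hy : y = x
      · subst hy; simp
      · simp [hy, h y hy]
    simp [siteOp, this]
  · intro a
    have : ∀ y, y ≠ x → σ y = Function.update σ x a y := by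
      intro y hy; simp [hy]
    simp only [siteOp, Matrix.of_apply, if_pos this, Function.update_self]

lemma siteOp_mul_mulVec {L : ℕ} {x y : Fin L} (hxy : x ≠ y) (M N : Matrix (Fin 2) (Fin 2) ℂ)
    (v : Cfg L → ℂ) (σ : Cfg L) :
    (siteOp x M * siteOp y N).mulVec v σ
      = ∑ a, ∑ b, M (σ x) a * N (σ y) b * v (Function.update (Function.update σ x a) y b) := by
  rw [← Matrix.mulVec_mulVec, siteOp_mulVec]
  refine sum_congr rfl fun a _ => ?_
  rw [siteOp_mulVec, mul_sum]
  refine sum_congr rfl fun b _ => ?_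
  rw [Function.update_of_ne hxy.symm]
  ring

lemma update_lo_hi {L : ℕ} (i : Fin (L - 1)) (σ : Cfg L) :
    Function.update (Function.update σ (lo i) (σ (hi i))) (hi i) (σ (lo i)) = hop i σ := by
  funext j
  by_cases h2 : j = hi i
  · subst h2; simp
  · by_cases h1 : j = lo i
    · subst h1; simp [h2]
    · simp [h1, h2, hop_of_ne i σ j h1 h2]

/-- The pair interaction vanishes on equal spins, and exchanges opposite ones. -/
lemma pairOp_mulVec {L : ℕ} (Δ : ℝ) (i : Fin (L - 1)) (v : Cfg L → ℂ) (σ : Cfg L) :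
    (pairOp Δ (lo i) (hi i)).mulVec v σ
      = if σ (lo i) ≠ σ (hi i) then v σ / 2 - ((Δ⁻¹ : ℝ) : ℂ) / 2 * v (hop i σ) else 0 := by
  have hu : Function.update (Function.update σ (lo i) (σ (lo i))) (hi i) (σ (hi i)) = σ := by
    simp
  have hh := update_lo_hi i σ
  have key : ∀ M N, (siteOp (lo i) M * siteOp (hi i) N).mulVec v σ = _ :=
    fun M N => siteOp_mul_mulVec (lo_ne_hi i) M N v σ
  have hI2 : Complex.I ^ 2 = -1 := Complex.I_sq
  rw [pairOp]
  simp only [Matrix.sub_mulVec, Matrix.smul_mulVec, Matrix.add_mulVec, Pi.sub_apply, Pi.add_apply,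
    Pi.smul_apply, key, Matrix.one_mulVec, smul_eq_mul, Fin.sum_univ_two]
  -- Flipping two equal spins has amplitude zero: the terms of `S¹ S¹` and `S² S²` cancel.
  generalize σ (lo i) = a at *
  generalize σ (hi i) = b at *
  fin_cases a <;> fin_cases b <;>
    simp [spin1, spin2, spin3] at hu hh ⊢ <;> (try rw [hu]) <;> (try rw [hh]) <;> ring_nf <;>
    (try rw [hI2]; ring)

lemma siteOp_spin3_mulVec {L : ℕ} (x : Fin L) (v : Cfg L → ℂ) (σ : Cfg L) :
    (siteOp x spin3).mulVec v σ = (sp σ x : ℂ) * v σ := by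
  rw [siteOp_mulVec, Fin.sum_univ_two]
  have hu : v (Function.update σ x (σ x)) = v σ := by simp
  rw [sp, dn_val]
  generalize σ x = a at *
  fin_cases a <;> simp [spin3] at hu ⊢ <;> rw [hu] <;> ring

lemma inv_anisotropy {Δ q : ℝ} (hΔq : Δ = (q + q⁻¹) / 2) : Δ⁻¹ = 2 * cpl q := by
  rw [hΔq, cpl, inv_div, div_eq_mul_inv]

lemma fieldA_eq {Δ q : ℝ} (hq0 : 0 < q) (hq1 : q < 1) (hΔq : Δ = (q + q⁻¹) / 2) :
    fieldA Δ = fld q := by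
  have hinv : 1 < q⁻¹ := (one_lt_inv₀ hq0).2 hq1
  have hs : 1 - (Δ ^ 2)⁻¹ = (cpl q * (q⁻¹ - q)) ^ 2 := by
    rw [← inv_pow, inv_anisotropy hΔq, cpl]
    field_simp
    ring
  rw [fieldA, hs, Real.sqrt_sq (mul_nonneg (cpl_pos hq0).le (by linarith)), fld]
  ring

/-- The Hamiltonian has real matrix elements, so it acts separately on real and imaginary parts. -/
lemma ham_apply {Δ q : ℝ} (hq0 : 0 < q) (hq1 : q < 1) (hΔq : Δ = (q + q⁻¹) / 2) {L : ℕ}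
    (hL : 0 < L) (v : State L) (σ : Cfg L) :
    (ham Δ 1 1 L hL v) σ
      = ⟨hamR q (fun τ => (v τ).re) σ, hamR q (fun τ => (v τ).im) σ⟩ := by
  have h0 : (ham Δ 1 1 L hL v) σ = (hamMatrix Δ 1 1 L hL).mulVec (fun τ => v τ) σ := rfl
  have h1 : (hamMatrix Δ 1 1 L hL).mulVec (fun τ => v τ) σ
      = ∑ i : Fin (L - 1), (pairOp Δ (lo i) (hi i)).mulVec (fun τ => v τ) σ
        - (fieldA Δ : ℂ) * ((sp σ 0 + sp σ (L - 1) : ℝ) * v σ) := by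
    have e0 := siteOp_spin3_mulVec (⟨0, hL⟩ : Fin L) (fun τ => v τ) σ
    have e1 := siteOp_spin3_mulVec (⟨L - 1, by omega⟩ : Fin L) (fun τ => v τ) σ
    rw [hamMatrix, Matrix.sub_mulVec, Matrix.sum_mulVec, Matrix.smul_mulVec, Matrix.add_mulVec]
    simp only [Pi.sub_apply, Finset.sum_apply, Pi.smul_apply, Pi.add_apply, Complex.ofReal_one,
      one_smul, smul_eq_mul, e0, e1]
    push_cast
    rw [add_mul]
    rfl
  rw [h0, h1, fieldA_eq hq0 hq1 hΔq]
  simp only [pairOp_mulVec, inv_anisotropy hΔq]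
  apply Complex.ext
  · simp only [hamR, Complex.sub_re, Complex.re_sum, Complex.re_ofReal_mul]
    congr 1
    · refine sum_congr rfl fun i _ => ?_
      rw [pairR]
      split_ifs <;> simp
    · ring
  · simp only [hamR, Complex.sub_im, Complex.im_sum, Complex.im_ofReal_mul]
    congr 1
    · refine sum_congr rfl fun i _ => ?_
      rw [pairR]
      split_ifs <;> simp
    · ring

/-! ### Sectors and droplet states in the product basis -/

lemma ite_mem_filter_down {L : ℕ} (σ : Cfg L) :
    (fun i => if i ∈ univ.filter (fun j => σ j = 1) then (1 : Fin 2) else 0) = σ := by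
  funext j
  rcases Fin.exists_fin_two.1 ⟨σ j, rfl⟩ with h | h <;> simp [h]

lemma downState_apply {L : ℕ} (X : Finset (Fin L)) (σ : Cfg L) :
    downState X σ = if X = univ.filter (fun j => σ j = 1) then 1 else 0 := by
  have hiff : σ = (fun i => if i ∈ X then (1 : Fin 2) else 0)
      ↔ X = univ.filter (fun j => σ j = 1) := by
    constructor
    · intro h; ext j; rw [h]; simp
    · rintro rfl
      exact (ite_mem_filter_down σ).symm
  rw [downState, PiLp.single_apply]
  simp only [hiff]

lemma cnt_eq_card {L : ℕ} (σ : Cfg L) : cnt L σ = (univ.filter (fun j => σ j = 1)).card := by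
  unfold cnt
  rw [card_filter]
  refine sum_congr rfl fun j _ => ?_
  simp

/-- A superposition of the product states with `k` down spins, evaluated at a configuration. -/
lemma sum_downState_apply {L : ℕ} (k : ℕ) (c : Finset (Fin L) → ℂ) (σ : Cfg L) :
    (∑ X ∈ (univ : Finset (Fin L)).powersetCard k, c X • downState X : State L) σ
      = if cnt L σ = k then c (univ.filter (fun j => σ j = 1)) else 0 := by
  rw [cnt_eq_card]
  simp only [WithLp.ofLp_sum, Finset.sum_apply, PiLp.smul_apply, downState_apply, smul_eq_mul,
    mul_ite, mul_one, mul_zero]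
  rw [Finset.sum_ite_eq']
  simp [mem_powersetCard]

lemma mem_sector {L n : ℕ} {v : State L} :
    v ∈ sector L n ↔ ∀ σ, cnt L σ ≠ n → v σ = 0 := by
  constructor
  · intro h σ hσ
    induction h using Submodule.span_induction with
    | mem v hv =>
      obtain ⟨X, hX, rfl⟩ := hv
      rw [downState_apply, if_neg]
      rintro rfl
      exact hσ (by rw [cnt_eq_card, hX])
    | zero => rfl
    | add v w _ _ hv hw => simp [hv, hw]
    | smul a v _ hv => simp [hv]
  · intro h
    have hv : v = ∑ X ∈ (univ : Finset (Fin L)).powersetCard n,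
        v (fun i => if i ∈ X then 1 else 0) • downState X := by
      ext σ
      rw [sum_downState_apply n (fun X => v (fun i => if i ∈ X then 1 else 0))]
      split_ifs with hσ
      · rw [ite_mem_filter_down]
      · exact h σ hσ
    rw [hv]
    refine Submodule.sum_mem _ fun X hX => Submodule.smul_mem _ _ (Submodule.subset_span ?_)
    exact ⟨X, (mem_powersetCard.1 hX).2, rfl⟩

lemma dn_left {L x : ℕ} (hx : x ≤ L) (σ : Cfg L) {j : ℕ} (hj : j < x) :
    dn (fun i : Fin x => σ ⟨i, by omega⟩) j = dn σ j := by
  simp [dn, hj, hj.trans_le hx]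

lemma dn_right {L x : ℕ} (hx : x ≤ L) (σ : Cfg L) {j : ℕ} (hj : j < L - x) :
    dn (fun i : Fin (L - x) => σ ⟨x + i, by omega⟩) j = dn σ (x + j) := by
  have : x + j < L := by omega
  simp [dn, hj, this]

lemma sum_range_split {M : Type*} [AddCommMonoid M] {L x : ℕ} (hx : x ≤ L) (F : ℕ → M) :
    ∑ j ∈ range L, F j = ∑ j ∈ range x, F j + ∑ j ∈ range (L - x), F (x + j) := by
  rw [← sum_range_add, Nat.add_sub_cancel' hx]

/-- The droplet state has amplitudes `q ^ wt` on the configurations with `⌊n/2⌋` down spins to the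
left of the cut and `n` in total. -/
lemma droplet_apply {q : ℝ} {L n x : ℕ} (hx : x ≤ L) (σ : Cfg L) :
    droplet q L n x hx σ = (xi q (n / 2) n x σ : ℂ) := by
  set l : Cfg x := fun i => σ ⟨i, by omega⟩ with hl
  set r : Cfg (L - x) := fun i => σ ⟨x + i, by omega⟩ with hr
  have e0 : droplet q L n x hx σ
      = kink q x (n / 2) l * antikink q (L - x) ((n + 1) / 2) r := rfl
  have e1 := sum_downState_apply (n / 2)
    (fun X : Finset (Fin x) => ((q ^ (∑ i ∈ X, (x - (i : ℕ))) : ℝ) : ℂ)) l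
  have e2 := sum_downState_apply ((n + 1) / 2)
    (fun X : Finset (Fin (L - x)) => ((q ^ (∑ i ∈ X, ((i : ℕ) + 1)) : ℝ) : ℂ)) r
  have cl : cnt x l = cnt x σ := by
    rw [cnt_eq_sum, cnt_eq_sum]
    exact sum_congr rfl fun j hj => dn_left hx σ (mem_range.1 hj)
  have cr : cnt L σ = cnt x σ + cnt (L - x) r := by
    rw [cnt_eq_sum L, sum_range_split hx, cnt_eq_sum x, cnt_eq_sum]
    congr 1
    exact sum_congr rfl fun j hj => (dn_right hx σ (mem_range.1 hj)).symm
  have hw : wt x σ = ∑ i ∈ univ.filter (fun j => l j = 1), (x - (i : ℕ))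
      + ∑ i ∈ univ.filter (fun j => r j = 1), ((i : ℕ) + 1) := by
    rw [wt_eq_sum, sum_range_split hx]
    congr 1
    · rw [sum_filter, ← Fin.sum_univ_eq_sum_range (fun j => depth x j * dn σ j)]
      refine sum_congr rfl fun j _ => ?_
      rw [← dn_left hx σ j.2, dn_val, depth, if_pos j.2]
      simp [hl]
    · rw [sum_filter, ← Fin.sum_univ_eq_sum_range (fun j => depth x (x + j) * dn σ (x + j))]
      refine sum_congr rfl fun j _ => ?_
      rw [← dn_right hx σ j.2, dn_val, depth, if_neg (by omega)]
      simp [hr]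
  rw [e0, kink, antikink, e1, e2, xi, gs, hw, cl]
  have hn : (cnt x σ = n / 2 ∧ cnt L σ = n)
      ↔ (cnt x σ = n / 2 ∧ cnt (L - x) r = (n + 1) / 2) := by omega
  simp only [hn]
  by_cases h1 : cnt x σ = n / 2 <;> by_cases h2 : cnt (L - x) r = (n + 1) / 2 <;>
    simp [h1, h2, pow_add]

/-- For a cut outside the range in the definition of `dropletSpace`, there is no configuration with
the prescribed numbers of down spins on the two sides. -/
lemma droplet_mem {q : ℝ} {L n x : ℕ} (hx : x ≤ L) : droplet q L n x hx ∈ dropletSpace q L n := by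
  by_cases h : n / 2 ≤ x ∧ x + (n + 1) / 2 ≤ L
  · exact Submodule.subset_span ⟨x, hx, h.1, h.2, rfl⟩
  · have : droplet q L n x hx = 0 := by
      ext σ
      rw [droplet_apply, xi_eq_zero]
      · simp
      · rintro ⟨h1, h2⟩
        have a1 : cnt x σ ≤ x := by
          rw [cnt_eq_sum]
          exact (sum_le_card_nsmul _ _ 1 fun j _ => dn_le_one σ j).trans (by simp)
        have a2 : cnt L σ ≤ cnt x σ + (L - x) := by
          rw [cnt_eq_sum L, cnt_eq_sum x, sum_range_split hx]
          exact Nat.add_le_add_left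
            ((sum_le_card_nsmul _ _ 1 fun j _ => dn_le_one σ _).trans (by simp)) _
        omega
    rw [this]
    exact Submodule.zero_mem _

lemma exists_of_mem_dropletSpace {q : ℝ} {L n : ℕ} {v : State L} (hv : v ∈ dropletSpace q L n) :
    ∃ α : ℕ → ℂ, ∀ σ, v σ = ∑ x ∈ range (L + 1), α x * (xi q (n / 2) n x σ : ℂ) := by
  induction hv using Submodule.span_induction with
  | mem v hv =>
    obtain ⟨x, hx, -, -, rfl⟩ := hv
    refine ⟨fun y => if y = x then 1 else 0, fun σ => ?_⟩
    rw [droplet_apply]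
    simp only [ite_mul, one_mul, zero_mul]
    rw [sum_ite_eq', if_pos (mem_range.2 (by omega))]
  | zero => exact ⟨0, by simp⟩
  | add v w _ _ hv hw =>
    obtain ⟨α, hα⟩ := hv
    obtain ⟨β, hβ⟩ := hw
    exact ⟨α + β, fun σ => by simp [hα, hβ, add_mul, sum_add_distrib]⟩
  | smul a v _ hv =>
    obtain ⟨α, hα⟩ := hv
    exact ⟨fun x => a * α x, fun σ => by simp [hα, mul_sum, mul_assoc]⟩

lemma dropletSpace_le_sector (q : ℝ) (L n : ℕ) : dropletSpace q L n ≤ sector L n := by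
  intro v hv
  rw [mem_sector]
  intro σ hσ
  obtain ⟨α, hα⟩ := exists_of_mem_dropletSpace hv
  rw [hα]
  refine sum_eq_zero fun x _ => ?_
  rw [xi_eq_zero fun h => hσ h.2]
  simp

/-! ### Real and imaginary parts -/

lemma norm_sq_eq_re_im {L : ℕ} (v : State L) :
    ‖v‖ ^ 2 = ∑ σ, (v σ).re ^ 2 + ∑ σ, (v σ).im ^ 2 := by
  rw [EuclideanSpace.norm_sq_eq, ← sum_add_distrib]
  refine sum_congr rfl fun σ _ => ?_
  rw [Complex.sq_norm, Complex.normSq_apply]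
  ring

lemma re_inner_eq {L : ℕ} (v w : State L) :
    (inner ℂ v w).re = ∑ σ, (v σ).re * (w σ).re + ∑ σ, (v σ).im * (w σ).im := by
  rw [PiLp.inner_apply, Complex.re_sum, ← sum_add_distrib]
  refine sum_congr rfl fun σ _ => ?_
  simp [Complex.mul_re]
  ring

lemma sum_xi_mul_eq_zero {q : ℝ} {L n : ℕ} {v : State L}
    (hv : ∀ w ∈ dropletSpace q L n, inner ℂ w v = 0) {x : ℕ} (hx : x ≤ L) :
    (∑ σ, xi q (n / 2) n x σ * (v σ).re = 0) ∧ ∑ σ, xi q (n / 2) n x σ * (v σ).im = 0 := by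
  have h := hv _ (droplet_mem (q := q) (n := n) hx)
  rw [PiLp.inner_apply] at h
  simp only [droplet_apply] at h
  have h1 : ∑ σ, (xi q (n / 2) n x σ : ℂ) * v σ = 0 := by
    rw [← h]
    refine sum_congr rfl fun σ _ => ?_
    simp [mul_comm]
  constructor
  · have := congrArg Complex.re h1
    simpa using this
  · have := congrArg Complex.im h1
    simpa using this

lemma sum_mul_pairR_comm {L : ℕ} (q : ℝ) (i : Fin (L - 1)) (f g : Cfg L → ℝ) :
    ∑ σ, g σ * pairR q i f σ = ∑ σ, pairR q i g σ * f σ := by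
  have h := sum_hop i (fun σ => if σ (lo i) ≠ σ (hi i) then g σ * f (hop i σ) else 0)
  simp only [hop_lo, hop_hi, hop_hop] at h
  have e1 : ∀ σ, g σ * pairR q i f σ = (if σ (lo i) ≠ σ (hi i) then g σ * f σ / 2 else 0)
      - cpl q * (if σ (lo i) ≠ σ (hi i) then g σ * f (hop i σ) else 0) := by
    intro σ; unfold pairR; split_ifs <;> ring
  have e2 : ∀ σ, pairR q i g σ * f σ = (if σ (lo i) ≠ σ (hi i) then g σ * f σ / 2 else 0)
      - cpl q * (if σ (hi i) ≠ σ (lo i) then g (hop i σ) * f σ else 0) := by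
    intro σ
    unfold pairR
    by_cases hσ : σ (lo i) = σ (hi i)
    · simp [hσ]
    · rw [if_pos hσ, if_pos hσ, if_pos (Ne.symm hσ)]; ring
  simp only [e1, e2, sum_sub_distrib, ← mul_sum, h]

lemma sum_mul_hamR_comm {L : ℕ} (q : ℝ) (f g : Cfg L → ℝ) :
    ∑ σ, g σ * hamR q f σ = ∑ σ, hamR q g σ * f σ := by
  have e1 : ∀ f g : Cfg L → ℝ, ∑ σ, g σ * hamR q f σ
      = ∑ i : Fin (L - 1), ∑ σ, g σ * pairR q i f σ
        - ∑ σ, fld q * (sp σ 0 + sp σ (L - 1)) * f σ * g σ := by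
    intro f g
    rw [sum_comm, ← sum_sub_distrib]
    refine sum_congr rfl fun σ _ => ?_
    rw [hamR, ← mul_sum]
    ring
  have e2 : ∑ σ, hamR q g σ * f σ = ∑ σ, f σ * hamR q g σ :=
    sum_congr rfl fun _ _ => mul_comm _ _
  rw [e2, e1, e1]
  congr 1
  · refine sum_congr rfl fun i _ => ?_
    rw [sum_mul_pairR_comm]
    exact sum_congr rfl fun _ _ => mul_comm _ _
  · exact sum_congr rfl fun _ _ => by ring

lemma hamR_of_sector {L n : ℕ} {q : ℝ} {f : Cfg L → ℝ} (hf : ∀ σ, cnt L σ ≠ n → f σ = 0)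
    {σ : Cfg L} (hσ : cnt L σ ≠ n) : hamR q f σ = 0 := by
  have h1 : ∀ i, pairR q i f σ = 0 := by
    intro i
    rw [pairR, hf σ hσ, hf (hop i σ) (by rwa [cnt_hop_total])]
    simp
  simp [hamR, h1, hf σ hσ]

/-! ### Operator inequalities from energy estimates -/

lemma inner_ham_comm {Δ q : ℝ} (hq0 : 0 < q) (hq1 : q < 1) (hΔq : Δ = (q + q⁻¹) / 2) {L : ℕ}
    (hL : 0 < L) (v w : State L) :
    inner ℂ (ham Δ 1 1 L hL v) w = inner ℂ v (ham Δ 1 1 L hL w) := by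
  have hre : ∀ v w : State L,
      (inner ℂ (ham Δ 1 1 L hL v) w).re = (inner ℂ v (ham Δ 1 1 L hL w)).re := by
    intro v w
    simp only [re_inner_eq, ham_apply hq0 hq1 hΔq hL]
    rw [sum_mul_hamR_comm, sum_mul_hamR_comm]
  -- the imaginary part of `⟪a, b⟫` is the real part of `⟪I a, b⟫`
  have him : ∀ a b : State L, (inner ℂ a b).im = (inner ℂ (Complex.I • a) b).re := by
    intro a b
    rw [inner_smul_left]
    simp
  apply Complex.ext (hre v w)
  rw [him, him, ← map_smul, hre]

lemma ham_mem_sector {Δ q : ℝ} (hq0 : 0 < q) (hq1 : q < 1) (hΔq : Δ = (q + q⁻¹) / 2) {L n : ℕ}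
    (hL : 0 < L) {v : State L} (hv : v ∈ sector L n) : ham Δ 1 1 L hL v ∈ sector L n := by
  rw [mem_sector] at hv ⊢
  intro σ hσ
  rw [ham_apply hq0 hq1 hΔq, hamR_of_sector (fun τ hτ => by simp [hv τ hτ]) hσ,
    hamR_of_sector (fun τ hτ => by simp [hv τ hτ]) hσ]
  rfl

/-- An operator preserving `S` dominates a combination of the projections onto `K ≤ S` if its
quadratic form does so on `S`. -/
lemma smul_starProjection_add_le {E : Type*} [NormedAddCommGroup E] [InnerProductSpace ℂ E]
    [CompleteSpace E] (S K : Submodule ℂ E) [S.HasOrthogonalProjection]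
    [K.HasOrthogonalProjection] (hKS : K ≤ S) (H : E →L[ℂ] E)
    (hH : ∀ v w, inner ℂ (H v) w = inner ℂ v (H w)) (hS : ∀ v ∈ S, H v ∈ S) (a g : ℝ)
    (h : ∀ k ∈ K, ∀ z ∈ S, (∀ w ∈ K, inner ℂ w z = 0) →
      a * ‖k + z‖ ^ 2 + g * ‖z‖ ^ 2 ≤ (inner ℂ (k + z) (H (k + z))).re) :
    (a : ℂ) • S.starProjection + (g : ℂ) • (S.starProjection - K.starProjection)
      ≤ H * S.starProjection := by
  rw [ContinuousLinearMap.le_def]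
  have hP : ∀ x y : E, inner ℂ (S.starProjection x) y = inner ℂ x (S.starProjection y) :=
    fun x y => S.inner_starProjection_left_eq_right x y
  have hQ : ∀ x y : E, inner ℂ (K.starProjection x) y = inner ℂ x (K.starProjection y) :=
    fun x y => K.inner_starProjection_left_eq_right x y
  have hPS : ∀ y ∈ S, S.starProjection y = y := fun y hy => S.starProjection_eq_self_iff.2 hy
  have hHP : ∀ x y : E,
      inner ℂ (H (S.starProjection x)) y = inner ℂ x (H (S.starProjection y)) := by
    intro x y
    rw [← hPS _ (hS _ (S.starProjection_apply_mem x)), hP, hH, hP,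
      hPS _ (hS _ (S.starProjection_apply_mem y))]
  refine ⟨?_, fun x => ?_⟩
  · intro x y
    simp only [ContinuousLinearMap.coe_coe, sub_apply,
      add_apply, smul_apply,
      mul_apply_eq_comp, inner_sub_left, inner_sub_right, inner_add_left,
      inner_add_right, inner_smul_left, inner_smul_right, Complex.conj_ofReal, hHP, hP, hQ]
  · set y := S.starProjection x with hy
    have hyS : y ∈ S := S.starProjection_apply_mem x
    set k := K.starProjection x with hk
    have hkK : k ∈ K := K.starProjection_apply_mem x
    have hz : ∀ w ∈ K, inner ℂ w (y - k) = 0 := by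
      intro w hw
      have h1 : inner ℂ w y = inner ℂ w x := by rw [hy, ← hP, hPS w (hKS hw)]
      have h2 : inner ℂ w k = inner ℂ w x := by
        rw [hk, ← hQ, K.starProjection_eq_self_iff.2 hw]
      rw [inner_sub_right, h1, h2, sub_self]
    have key := h k hkK (y - k) (S.sub_mem hyS (hKS hkK)) hz
    rw [add_sub_cancel] at key
    have h1 : inner ℂ y x = inner ℂ y y := by rw [← hPS y hyS, hP, hPS y hyS]
    have h2 : inner ℂ k x = inner ℂ k k := by
      conv_lhs => rw [← K.starProjection_eq_self_iff.2 hkK, hQ]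
    have h3 : inner ℂ (H y) x = inner ℂ y (H y) := by
      rw [← hPS _ (hS y hyS), hP, hPS _ (hS y hyS), hH]
    have h4 : (inner ℂ y y).re - (inner ℂ k k).re = ‖y - k‖ ^ 2 := by
      have e1 : inner ℂ k y = inner ℂ k k := by
        have := hz k hkK
        rw [inner_sub_right, sub_eq_zero] at this
        exact this
      have e2 : inner ℂ y k = inner ℂ k k := by
        rw [← inner_conj_symm, e1, inner_conj_symm]
      have e3 : ‖y - k‖ ^ 2 = (inner ℂ (y - k) (y - k)).re :=
        (inner_self_eq_norm_sq (𝕜 := ℂ) _).symm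
      rw [e3, inner_sub_left, inner_sub_right, inner_sub_right, e1, e2]
      simp
    have h5 : ‖y‖ ^ 2 = (inner ℂ y y).re := (inner_self_eq_norm_sq (𝕜 := ℂ) _).symm
    rw [← h4, h5] at key
    rw [ContinuousLinearMap.reApplyInnerSelf_apply]
    simp only [sub_apply, add_apply,
      smul_apply, mul_apply_eq_comp, inner_sub_left, inner_add_left,
      inner_smul_left, Complex.conj_ofReal, ← hy, ← hk, h1, h2, h3]
    simp only [RCLike.re_to_complex, Complex.sub_re, Complex.add_re, Complex.re_ofReal_mul]
    linarith

/-- The quadratic form of an operator that is close to the scalar `a` on `k` and at least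
`a + g` on `z ⊥ k`. -/
lemma le_re_inner_add {E : Type*} [NormedAddCommGroup E] [InnerProductSpace ℂ E] (H : E →L[ℂ] E)
    (hH : ∀ v w, inner ℂ (H v) w = inner ℂ v (H w)) {a b g : ℝ} {k z : E}
    (hk : ‖H k - (a : ℂ) • k‖ ≤ b * ‖k‖) (hb : 0 ≤ b) (hkz : inner ℂ k z = 0)
    (hz : (a + g) * ‖z‖ ^ 2 ≤ (inner ℂ z (H z)).re) :
    (a - 2 * b) * ‖k + z‖ ^ 2 + g * ‖z‖ ^ 2 ≤ (inner ℂ (k + z) (H (k + z))).re := by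
  set d := H k - (a : ℂ) • k with hd
  have hHk : H k = (a : ℂ) • k + d := by rw [hd]; abel
  have hzk : inner ℂ z k = 0 := by rw [← inner_conj_symm, hkz, map_zero]
  have e1 : inner ℂ (k + z) (H (k + z))
      = (a : ℂ) * inner ℂ k k + inner ℂ k d + inner ℂ d z + inner ℂ z d + inner ℂ z (H z) := by
    have : inner ℂ k (H z) = inner ℂ d z := by
      rw [← hH, hHk, inner_add_left, inner_smul_left, hkz]; simp
    rw [map_add, inner_add_left, inner_add_right, inner_add_right, this, hHk, inner_add_right,
      inner_add_right, inner_smul_right, inner_smul_right, hzk]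
    ring
  have hkk : (inner ℂ k k).re = ‖k‖ ^ 2 := inner_self_eq_norm_sq (𝕜 := ℂ) _
  have hn : ‖k + z‖ ^ 2 = ‖k‖ ^ 2 + ‖z‖ ^ 2 := by
    have := norm_add_sq_eq_norm_sq_add_norm_sq_of_inner_eq_zero k z hkz
    nlinarith
  have hre : ∀ x y : E, -(‖x‖ * ‖y‖) ≤ (inner ℂ x y).re := fun x y =>
    (abs_le.1 ((Complex.abs_re_le_norm _).trans (norm_inner_le_norm x y))).1
  have b1 := hre k d
  have b2 := hre d z
  have b3 := hre z d
  have c1 : ‖k‖ * ‖d‖ ≤ b * ‖k‖ ^ 2 := by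
    calc _ ≤ ‖k‖ * (b * ‖k‖) := mul_le_mul_of_nonneg_left hk (norm_nonneg _)
      _ = _ := by ring
  have c2 : ‖d‖ * ‖z‖ ≤ b * (‖k‖ * ‖z‖) := by
    calc _ ≤ b * ‖k‖ * ‖z‖ := mul_le_mul_of_nonneg_right hk (norm_nonneg _)
      _ = _ := by ring
  have c3 : 2 * (b * (‖k‖ * ‖z‖)) ≤ b * (‖k‖ ^ 2 + ‖z‖ ^ 2) := by
    nlinarith [mul_nonneg hb (sq_nonneg (‖k‖ - ‖z‖))]
  have c4 : 0 ≤ b * ‖z‖ ^ 2 := by positivity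
  rw [e1, hn]
  simp only [Complex.add_re, Complex.re_ofReal_mul, hkk]
  nlinarith

lemma norm_ham_sub_le {Δ q : ℝ} (hq0 : 0 < q) (hq1 : q < 1) (hΔq : Δ = (q + q⁻¹) / 2) {L : ℕ}
    (hL : 0 < L) (v : State L) {b : ℝ} (hb : 0 ≤ b)
    (hr : ∑ σ, (hamR q (fun τ => (v τ).re) σ - fld q * (v σ).re) ^ 2 ≤ b * ∑ σ, (v σ).re ^ 2)
    (hi' : ∑ σ, (hamR q (fun τ => (v τ).im) σ - fld q * (v σ).im) ^ 2 ≤ b * ∑ σ, (v σ).im ^ 2) :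
    ‖ham Δ 1 1 L hL v - ((fieldA Δ : ℝ) : ℂ) • v‖ ≤ √b * ‖v‖ := by
  refine abs_le_of_sq_le_sq' ?_ (by positivity) |>.2
  rw [mul_pow, Real.sq_sqrt hb, norm_sq_eq_re_im, norm_sq_eq_re_im, mul_add]
  refine add_le_add (le_of_eq_of_le ?_ hr) (le_of_eq_of_le ?_ hi')
  · refine sum_congr rfl fun σ _ => ?_
    rw [PiLp.sub_apply, PiLp.smul_apply, ham_apply hq0 hq1 hΔq, fieldA_eq hq0 hq1 hΔq]
    simp
  · refine sum_congr rfl fun σ _ => ?_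
    rw [PiLp.sub_apply, PiLp.smul_apply, ham_apply hq0 hq1 hΔq, fieldA_eq hq0 hq1 hΔq]
    simp

lemma norm_ham_sub_le_of_mem_sector {Δ q : ℝ} (hq0 : 0 < q) (hq1 : q < 1)
    (hΔq : Δ = (q + q⁻¹) / 2) {L n : ℕ} (hL : 0 < L) {v : State L} (hv : v ∈ sector L n) :
    ‖ham Δ 1 1 L hL v - ((fieldA Δ : ℝ) : ℂ) • v‖ ≤ 2 * (n + 2) * ‖v‖ := by
  rw [mem_sector] at hv
  have h := norm_ham_sub_le hq0 hq1 hΔq hL v (b := 4 * (n + 2) ^ 2) (by positivity)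
    (hamR_sector_bound hq0 hq1 _ fun σ hσ => by simp [hv σ hσ])
    (hamR_sector_bound hq0 hq1 _ fun σ hσ => by simp [hv σ hσ])
  rwa [show (4 * (n + 2) ^ 2 : ℝ) = (2 * (n + 2)) ^ 2 by ring, Real.sqrt_sq (by positivity)] at h

lemma norm_ham_sub_le_of_mem_dropletSpace {Δ q : ℝ} (hq0 : 0 < q) (hq1 : q < 1)
    (hΔq : Δ = (q + q⁻¹) / 2) {L n : ℕ} (hL : 0 < L) (hn : 1 ≤ n / 2)
    (hθ : 2 / (1 - q ^ 2) * q ^ (2 * (n / 2)) ≤ 1 / 2) {v : State L}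
    (hv : v ∈ dropletSpace q L n) :
    ‖ham Δ 1 1 L hL v - ((fieldA Δ : ℝ) : ℂ) • v‖
      ≤ √(10 * (2 / (1 - q ^ 2) * q ^ (2 * (n / 2)))) * ‖v‖ := by
  obtain ⟨α, hα⟩ := exists_of_mem_dropletSpace hv
  have hq2 : 0 < 1 - q ^ 2 := by nlinarith
  refine norm_ham_sub_le hq0 hq1 hΔq hL v (by positivity) ?_ ?_
  · refine droplet_energy (n := n) hq0 hq1 hn (by omega) hθ (fun x => (α x).re) _ ?_
    funext σ
    rw [hα]
    simp
  · refine droplet_energy (n := n) hq0 hq1 hn (by omega) hθ (fun x => (α x).im) _ ?_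
    funext σ
    rw [hα]
    simp

/-- The Hamiltonian is bounded below by `-A(Δ)`. -/
lemma re_inner_ham_ge {Δ q : ℝ} (hq0 : 0 < q) (hq1 : q < 1) (hΔq : Δ = (q + q⁻¹) / 2) {L : ℕ}
    (hL : 0 < L) (v : State L) : -fld q * ‖v‖ ^ 2 ≤ (inner ℂ v (ham Δ 1 1 L hL v)).re := by
  have h : ∀ f : Cfg L → ℝ, -fld q * ∑ σ, f σ ^ 2 ≤ ∑ σ, f σ * hamR q f σ := by
    intro f
    refine le_trans ?_ (hamR_lower hq0 hq1 f)
    rw [mul_sum]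
    refine sum_le_sum fun σ _ => mul_le_mul_of_nonneg_right ?_ (sq_nonneg _)
    have : 0 ≤ walls σ := sum_nonneg fun i _ => by split_ifs <;> norm_num
    nlinarith [cpl_lt_half hq0 hq1]
  rw [re_inner_eq, norm_sq_eq_re_im, mul_add]
  simp only [ham_apply hq0 hq1 hΔq]
  exact add_le_add (h _) (h _)

/-- The spectral gap above the droplet states, up to an explicit error. -/
lemma re_inner_ham_ge_of_orthogonal {Δ q : ℝ} (hq0 : 0 < q) (hq1 : q < 1)
    (hΔq : Δ = (q + q⁻¹) / 2) {L R n w : ℕ} (hL : 0 < L) (hR : 1 ≤ R) (hm1 : 4 * R ≤ n / 2)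
    (hw : 2 * fld q + (1 - 2 * cpl q) ≤ (1 / 2 - cpl q) * w) (hRn : 8 * R * (w + 1) ≤ n)
    {v : State L} (hv : v ∈ sector L n) (hvK : ∀ u ∈ dropletSpace q L n, inner ℂ u v = 0) :
    (fld q + (1 - 2 * cpl q) - ((2 * n + 1) / R ^ 2 / (1 - 2 * cpl q) + 2 * locErr q R (n / 2) n
      + 4 * n ^ 2 * q ^ (2 * R))) * ‖v‖ ^ 2 ≤ (inner ℂ v (ham Δ 1 1 L hL v)).re := by
  rw [mem_sector] at hv
  have hre := energy_lower hq0 hq1 hR hm1 (by omega) (by omega) hw hRn (fun τ => (v τ).re)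
    (fun σ hσ => by simp [hv σ hσ]) (fun x hx => (sum_xi_mul_eq_zero hvK hx).1)
  have him := energy_lower hq0 hq1 hR hm1 (by omega) (by omega) hw hRn (fun τ => (v τ).im)
    (fun σ hσ => by simp [hv σ hσ]) (fun x hx => (sum_xi_mul_eq_zero hvK hx).2)
  rw [re_inner_eq, norm_sq_eq_re_im, mul_add]
  simp only [ham_apply hq0 hq1 hΔq]
  exact add_le_add hre him

/-! ### The constants -/

/-- The error in the spectral gap of `n` down spins for windows of half-length `R`. -/
def gapErr (q : ℝ) (R n : ℕ) : ℝ :=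
  (2 * n + 1) / R ^ 2 / (1 - 2 * cpl q) + 2 * locErr q R (n / 2) n + 4 * n ^ 2 * q ^ (2 * R)

lemma exists_pow_mul_le (k : ℕ) {r : ℝ} (h0 : 0 ≤ r) (h1 : r < 1) :
    ∃ M : ℝ, 0 ≤ M ∧ ∀ j : ℕ, (j : ℝ) ^ k * r ^ j ≤ M := by
  have h := tendsto_pow_const_mul_const_pow_of_abs_lt_one k (r := r) (by rwa [abs_of_nonneg h0])
  obtain ⟨M, hM⟩ := h.bddAbove_range
  have hM' : ∀ j : ℕ, (j : ℝ) ^ k * r ^ j ≤ M := fun j => hM ⟨j, rfl⟩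
  exact ⟨M, le_trans (by positivity) (hM' 0), hM'⟩

lemma exists_pow_half_le {q : ℝ} (hq0 : 0 < q) (hq1 : q < 1) :
    ∃ B : ℝ, 0 ≤ B ∧ ∀ n : ℕ, 2 ≤ n → 2 / (1 - q ^ 2) * q ^ (2 * (n / 2)) ≤ B / n := by
  have hq2 : 0 < 1 - q ^ 2 := by nlinarith
  obtain ⟨M, hM0, hM⟩ := exists_pow_mul_le 1 (r := q ^ 2) (by positivity) (by linarith)
  refine ⟨2 / (1 - q ^ 2) * (3 * M), by positivity, fun n hn => ?_⟩
  rw [mul_div_assoc]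
  refine mul_le_mul_of_nonneg_left ?_ (by positivity)
  have hn' : (0 : ℝ) < n := by exact_mod_cast (by omega : 0 < n)
  have h3 : (n : ℝ) ≤ 3 * (n / 2 : ℕ) := by exact_mod_cast (by omega : n ≤ 3 * (n / 2))
  have h := hM (n / 2)
  rw [le_div_iff₀ hn', pow_mul]
  have : 0 ≤ (q ^ 2) ^ (n / 2) := by positivity
  rw [pow_one] at h
  nlinarith

/-- With windows of half-length proportional to `n`, the error in the gap is `O(1 / n)`. -/
lemma exists_gapErr_le {q : ℝ} (hq0 : 0 < q) (hq1 : q < 1) {D : ℕ} (hD : 2 ≤ D) :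
    ∃ B : ℝ, 0 ≤ B ∧ ∀ n : ℕ, D ≤ n → gapErr q (n / D) n ≤ B / n := by
  have hγ := gap_pos hq0 hq1
  have hq2 : 0 < 1 - q ^ 2 := by nlinarith
  obtain ⟨M, hM0, hM⟩ := exists_pow_mul_le 3 (r := q ^ 2) (by positivity) (by linarith)
  obtain ⟨B, hB0, hB⟩ := exists_pow_half_le hq0 hq1
  refine ⟨12 * D ^ 2 / (1 - 2 * cpl q) + 2 * (12 * D ^ 2 / 2 / (1 - 2 * cpl q) ^ 2 + B)
    + 32 * D ^ 3 * M, by positivity, fun n hn => ?_⟩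
  have hD0 : (0 : ℝ) < D := by exact_mod_cast (by omega : 0 < D)
  have hn1 : (1 : ℝ) ≤ n := by exact_mod_cast (by omega : 1 ≤ n)
  have hR1 : 1 ≤ n / D := (Nat.one_le_div_iff (by omega)).2 hn
  set R := n / D with hR
  have hR0 : (0 : ℝ) < R := by exact_mod_cast hR1
  -- `n / D` is at least half of the real quotient, as it is at least `1`.
  have hnR : (n : ℝ) ≤ 2 * D * R := by
    have h1 : n < D * (R + 1) := by
      rw [hR]; exact Nat.lt_mul_div_succ n (by omega)
    have h2 : D * (R + 1) ≤ 2 * D * R := by nlinarith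
    exact_mod_cast h1.le.trans h2
  have e1 : (2 * n + 1 : ℝ) / R ^ 2 ≤ 12 * D ^ 2 / n := by
    rw [div_le_div_iff₀ (by positivity) (by linarith)]
    have : (n : ℝ) ^ 2 ≤ (2 * D * R) ^ 2 := pow_le_pow_left₀ (by linarith) hnR 2
    nlinarith
  have e2 : (n : ℝ) ^ 2 * q ^ (2 * R) ≤ 8 * D ^ 3 * M / n := by
    rw [le_div_iff₀ (by linarith), pow_mul]
    have h3 : (n : ℝ) ^ 3 ≤ (2 * D * R) ^ 3 := pow_le_pow_left₀ (by linarith) hnR 3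
    calc (n : ℝ) ^ 2 * (q ^ 2) ^ R * n = n ^ 3 * (q ^ 2) ^ R := by ring
      _ ≤ (2 * D * R) ^ 3 * (q ^ 2) ^ R := mul_le_mul_of_nonneg_right h3 (by positivity)
      _ = 8 * D ^ 3 * (R ^ 3 * (q ^ 2) ^ R) := by ring
      _ ≤ 8 * D ^ 3 * M := mul_le_mul_of_nonneg_left (hM R) (by positivity)
  have e3 : (2 * n + 1 : ℝ) / R ^ 2 / (1 - 2 * cpl q) ≤ 12 * D ^ 2 / n / (1 - 2 * cpl q) :=
    div_le_div_of_nonneg_right e1 hγ.le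
  have e4 : (2 * n + 1 : ℝ) / R ^ 2 / 2 / (1 - 2 * cpl q) ^ 2
      ≤ 12 * D ^ 2 / n / 2 / (1 - 2 * cpl q) ^ 2 :=
    div_le_div_of_nonneg_right (div_le_div_of_nonneg_right e1 (by norm_num)) (by positivity)
  have e5 := hB n (by omega)
  have e6 : (12 * D ^ 2 / (1 - 2 * cpl q) + 2 * (12 * D ^ 2 / 2 / (1 - 2 * cpl q) ^ 2 + B)
      + 32 * D ^ 3 * M) / (n : ℝ) = 12 * D ^ 2 / n / (1 - 2 * cpl q)
      + 2 * (12 * D ^ 2 / n / 2 / (1 - 2 * cpl q) ^ 2 + B / n) + 4 * (8 * D ^ 3 * M / n) := by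
    ring
  rw [e6, gapErr, locErr]
  linarith

lemma rpow_half_sq {q : ℝ} (hq0 : 0 < q) (n : ℕ) : (q ^ ((n : ℝ) / 2)) ^ 2 = q ^ n := by
  rw [← Real.rpow_natCast, ← Real.rpow_mul hq0.le, ← Real.rpow_natCast]
  congr 1
  push_cast
  ring

/-- The factor `q⁻¹` accounts for odd `n`, where `2 ⌊n/2⌋ = n - 1`. -/
lemma sqrt_pow_half_le {q : ℝ} (hq0 : 0 < q) (hq1 : q < 1) (n : ℕ) :
    √(10 * (2 / (1 - q ^ 2) * q ^ (2 * (n / 2))))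
      ≤ √(10 * (2 / (1 - q ^ 2) * q⁻¹)) * q ^ ((n : ℝ) / 2) := by
  have hq2 : 0 < 1 - q ^ 2 := by nlinarith
  have h : q ^ (2 * (n / 2)) ≤ q⁻¹ * q ^ n := by
    rw [inv_mul_eq_div, le_div_iff₀ hq0, ← pow_succ]
    exact pow_le_pow_of_le_one hq0.le hq1.le (by omega)
  rw [Real.sqrt_le_left (by positivity), mul_pow, rpow_half_sq hq0, Real.sq_sqrt (by positivity)]
  calc 10 * (2 / (1 - q ^ 2) * q ^ (2 * (n / 2)))
      ≤ 10 * (2 / (1 - q ^ 2) * (q⁻¹ * q ^ n)) := by gcongr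
    _ = _ := by ring

end XXZ

end

open XXZ in
theorem mainTheorem2 (Δ q : ℝ) (hΔ : 1 < Δ) (hq0 : 0 < q) (hq1 : q < 1)
    (hΔq : Δ = (q + q⁻¹) / 2) :
    ∃ C : ℝ,
      (∀ (L n : ℕ) (hL : 0 < L), n ≤ L →
        ‖(ham Δ 1 1 L hL - ((fieldA Δ : ℝ) : ℂ) • (1 : State L →L[ℂ] State L))
            * (dropletSpace q L n).starProjection‖ ≤ C * q ^ ((n : ℝ) / 2)) ∧
      ∃ ε : ℕ → ℝ,
        Filter.Tendsto ε Filter.atTop (nhds 0) ∧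
        ε =O[Filter.atTop] (fun n : ℕ => (n : ℝ) ^ (-(1 / 4) : ℝ)) ∧
        ∀ (L n : ℕ) (hL : 0 < L), n ≤ L →
          ((fieldA Δ - 2 * C * q ^ ((n : ℝ) / 2) : ℝ) : ℂ) • (sector L n).starProjection
              + (((1 - Δ⁻¹) - ε n : ℝ) : ℂ) •
                  ((sector L n).starProjection - (dropletSpace q L n).starProjection)
            ≤ ham Δ 1 1 L hL * (sector L n).starProjection := by
  have hγ := gap_pos hq0 hq1
  have hA := fld_nonneg hq0 hq1
  have hfld := fieldA_eq hq0 hq1 hΔq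
  obtain ⟨w, hw⟩ := exists_nat_ge ((2 * fld q + (1 - 2 * cpl q)) / (1 / 2 - cpl q))
  rw [div_le_iff₀' (by linarith)] at hw
  obtain ⟨B, hB0, hB⟩ := exists_gapErr_le hq0 hq1 (D := 8 * (w + 1)) (by omega)
  obtain ⟨B', hB0', hB'⟩ := exists_pow_half_le hq0 hq1
  obtain ⟨N, hN⟩ := exists_nat_ge (2 * B')
  set n₀ := 8 * (w + 1) + N with hn₀
  have hθ : ∀ n : ℕ, n₀ ≤ n → 2 / (1 - q ^ 2) * q ^ (2 * (n / 2)) ≤ 1 / 2 := by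
    intro n hn
    refine (hB' n (by omega)).trans ?_
    have h1 : (N : ℝ) ≤ n := by exact_mod_cast (by omega : N ≤ n)
    have h2 : (0 : ℝ) < n := by exact_mod_cast (by omega : 0 < n)
    rw [div_le_iff₀ h2]
    linarith
  -- The three summands serve the droplet energy, the droplet energy for small `n`, and the lower
  -- bound `-A(Δ)` for small `n`.
  set C := √(10 * (2 / (1 - q ^ 2) * q⁻¹)) + 2 * (n₀ + 2) * (q ^ ((n₀ : ℝ) / 2))⁻¹
    + fld q * (q ^ ((n₀ : ℝ) / 2))⁻¹ with hC
  have hCnn : 0 ≤ C := by positivity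
  have hpow : ∀ n : ℕ, n < n₀ → 1 ≤ (q ^ ((n₀ : ℝ) / 2))⁻¹ * q ^ ((n : ℝ) / 2) := by
    intro n hn
    rw [inv_mul_eq_div, one_le_div (by positivity)]
    have : (n : ℝ) ≤ n₀ := by exact_mod_cast hn.le
    exact Real.rpow_le_rpow_of_exponent_ge hq0 hq1.le (by linarith)
  have hsmall : ∀ (L n : ℕ) (hL : 0 < L), ∀ v ∈ dropletSpace q L n,
      ‖ham Δ 1 1 L hL v - ((fieldA Δ : ℝ) : ℂ) • v‖ ≤ C * q ^ ((n : ℝ) / 2) * ‖v‖ := by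
    intro L n hL v hv
    have hqn : 0 < q ^ ((n : ℝ) / 2) := by positivity
    rcases lt_or_ge n n₀ with hn | hn
    · refine (norm_ham_sub_le_of_mem_sector hq0 hq1 hΔq hL
        (dropletSpace_le_sector q L n hv)).trans (mul_le_mul_of_nonneg_right ?_ (norm_nonneg _))
      have h1 : (n : ℝ) ≤ n₀ := by exact_mod_cast hn.le
      have h2 : (n₀ + 2 : ℝ) * 1 ≤ (n₀ + 2) * ((q ^ ((n₀ : ℝ) / 2))⁻¹ * q ^ ((n : ℝ) / 2)) :=
        mul_le_mul_of_nonneg_left (hpow n hn) (by positivity)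
      have h3 : 0 ≤ (√(10 * (2 / (1 - q ^ 2) * q⁻¹)) + fld q * (q ^ ((n₀ : ℝ) / 2))⁻¹)
        * q ^ ((n : ℝ) / 2) := by positivity
      rw [hC]
      linarith
    · refine (norm_ham_sub_le_of_mem_dropletSpace hq0 hq1 hΔq hL (by omega) (hθ n hn) hv).trans
        (mul_le_mul_of_nonneg_right ((sqrt_pow_half_le hq0 hq1 n).trans ?_) (norm_nonneg _))
      refine mul_le_mul_of_nonneg_right ?_ hqn.le
      have : 0 ≤ 2 * (n₀ + 2) * (q ^ ((n₀ : ℝ) / 2))⁻¹ + fld q * (q ^ ((n₀ : ℝ) / 2))⁻¹ := by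
        positivity
      linarith
  refine ⟨C, fun L n hL _ => ?_, fun n => if n < n₀ then 1 - 2 * cpl q else B / n, ?_⟩
  · refine ContinuousLinearMap.opNorm_le_bound _ (by positivity) fun v => ?_
    refine (hsmall L n hL _ ((dropletSpace q L n).starProjection_apply_mem v)).trans ?_
    exact mul_le_mul_of_nonneg_left ((dropletSpace q L n).norm_starProjection_apply_le v)
      (by positivity)
  have hO : (fun n : ℕ => if n < n₀ then 1 - 2 * cpl q else B / (n : ℝ))
      =O[Filter.atTop] (fun n : ℕ => (n : ℝ) ^ (-(1 / 4) : ℝ)) := by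
    refine Asymptotics.IsBigO.of_bound B ?_
    filter_upwards [Filter.eventually_ge_atTop n₀] with n hn
    have h1 : (1 : ℝ) ≤ n := by exact_mod_cast (by omega : 1 ≤ n)
    rw [if_neg (by omega), Real.norm_of_nonneg (by positivity), Real.norm_of_nonneg (by positivity),
      div_eq_mul_inv, ← Real.rpow_neg_one]
    exact mul_le_mul_of_nonneg_left (Real.rpow_le_rpow_of_exponent_le h1 (by norm_num)) hB0
  -- `1 / n = O(n ^ (-1 / 4))` and `n ^ (-1 / 4) → 0`
  refine ⟨hO.trans_tendsto ((tendsto_rpow_neg_atTop (by norm_num)).comp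
    tendsto_natCast_atTop_atTop), hO, fun L n hL _ => ?_⟩
  refine smul_starProjection_add_le (sector L n) (dropletSpace q L n)
    (dropletSpace_le_sector q L n) (ham Δ 1 1 L hL) (inner_ham_comm hq0 hq1 hΔq hL)
    (fun v hv => ham_mem_sector hq0 hq1 hΔq hL hv) _ _ fun k hk z hz hzK => ?_
  rw [inv_anisotropy hΔq]
  beta_reduce
  rcases lt_or_ge n n₀ with hn | hn
  · rw [if_pos hn, sub_self, zero_mul, add_zero]
    refine le_trans (mul_le_mul_of_nonneg_right ?_ (sq_nonneg _))
      (re_inner_ham_ge hq0 hq1 hΔq hL (k + z))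
    have h1 := mul_le_mul_of_nonneg_left (hpow n hn) hA
    have h2 : 0 ≤ (√(10 * (2 / (1 - q ^ 2) * q⁻¹)) + 2 * (n₀ + 2) * (q ^ ((n₀ : ℝ) / 2))⁻¹)
      * q ^ ((n : ℝ) / 2) := by positivity
    rw [hfld, hC]
    linarith
  · rw [if_neg (by omega), mul_assoc 2]
    refine le_re_inner_add _ (inner_ham_comm hq0 hq1 hΔq hL) (hsmall L n hL k hk) (by positivity)
      (hzK k hk) ?_
    have hdiv := Nat.mul_div_le n (8 * (w + 1))
    have hR : 1 ≤ n / (8 * (w + 1)) := (Nat.one_le_div_iff (by omega)).2 (by omega)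
    have key := re_inner_ham_ge_of_orthogonal hq0 hq1 hΔq hL hR
      ((Nat.le_div_iff_mul_le two_pos).2 (by nlinarith)) hw (by linarith) hz hzK
    refine le_trans (mul_le_mul_of_nonneg_right ?_ (sq_nonneg _)) key
    have := hB n (by omega)
    rw [gapErr] at this
    rw [hfld]
    linarith
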